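/- **Setting.** Let $\mathcal X_1,\mathcal X_2,\hat{\mathcal X}_2$ be finite alphabets, $p(x_1,x_2)$ a probability distribution on $\mathcal X_1\times\mathcal X_2$, and $d:\mathcal X_2\times\hat{\mathcal X}_2\to[0,\infty)$ a distortion measure. Let $(X_{1k},X_{2k})_{k\ge1}$ be i.i.d. with law $p$. Assume that the sources have no common part: whenever $f(X_1)=g(X_2)$ almost surely, $f(X_1)$ is almost surely constant. Logarithms and information measures are to base $2$. A bipartite graph $G$ with vertex sets $\{1,\dots,\Delta_1\}$, $\{1,\dots,\Delta_2\}$ and edge set $E(G)$ is *nearly semi-regular* with parameters $(\Delta_1,\Delta_2,\Delta_1',\Delta_2',\mu)$, where $\mu>1$ and $\Delta_1',\Delta_2'>0$, if every vertex of the first set has degree in $[\Delta_2'\mu^{-1},\Delta_2'\mu]$ and every vertex of the second set has degree in $[\Delta_1'\mu^{-1},\Delta_1'\mu]$. A *distributed source coding system* of block length $n$ on $G$ consists of encoders $f_i:\mathcal X_i^n\to\{1,\dots,\Delta_i\}$ ($i=1,2$) and a decoder $g:E(G)\to\mathcal X_1^n\times\hat{\mathcal X}_2^n$. The reconstruction $(\hat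 X_1^n,\hat X_2^n)$ is $g(f_1(X_1^n),f_2(X_2^n))$ if $(f_1(X_1^n),f_2(X_2^n))\in E(G)$, and otherwise a fixed arbitrary pair of sequences belonging to the system. Its distortions are $$\tau_1=\frac1n\sum_{k=1}^n P(X_{1k}\ne\hat X_{1k}),\qquad \tau_2=\frac1n\sum_{k=1}^n E\,d(X_{2k},\hat X_{2k}).$$ A tuple $(R_1,R_2,R_1',R_2',D)$ of real numbers is *achievable* if for every $\epsilon>0$ and all sufficiently large $n$ there are a nearly semi-regular graph with parameters $(\Delta_1,\Delta_2,\Delta_1',\Delta_2',\mu)$ and a system of block length $n$ on it such that, for $i=1,2$, $\frac1n\log\Delta_i<R_i+\epsilon$, $\frac1n\log\Delta_i'<R_i'+\epsilon$, and moreover $\frac1n\log\mu<\epsilon$, $\tau_1\le\epsilon$, $\tau_2\le D+\epsilon$. It is *exactly achievable* if the same holds with $|\frac1n\log\Delta_i-R_i|<\epsilon$ and $|\frac1n\log\Delta_i'-R_i'|<\epsilon$ in place of the bounds on $\Delta_i$ and $\Delta_i'$. Let $\mathcal R^*$ be the union, over all random variables $V$ with a finite alphabet $\mathcal V$ such that $|\mathcal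 V|\le|\mathcal X_2|+2$ and $p(x_1,x_2,v)=p(x_1,x_2)\,p(v|x_2)$ (that is, $X_1\to X_2\to V$), of the sets of tuples $(R_1,R_2,R_1',R_2',D)$ such that $$R_i\ge R_i'\ge0\ (i=1,2),\quad R_1'\ge H(X_1|V),\quad R_2'\ge I(V;X_2|X_1),\quad R_1+R_2'=R_1'+R_2\ge H(X_1)+I(V;X_2|X_1),$$ and such that some function $\hat X_2=\hat X_2(X_1,V)$ satisfies $E\,d(X_2,\hat X_2)\le D$. **Theorem 1.** The set of exactly achievable tuples is equal to $\mathcal R^*$. Moreover, $\mathcal R^*$ is also equal to the set of those achievable tuples that satisfy the relations $R_i\ge R_i'\ge0$ ($i=1,2$) and $R_1+R_2'=R_1'+R_2$ between the exponents of a nearly semi-regular graph. -/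

import Mathlib

open scoped BigOperators

noncomputable section

/-! ### Information measures of random variables on a finite probability space (in bits) -/

/-- `law P X a` is the probability that `X = a`, when `P` is a probability mass function on the
finite set `Ω`. -/
def law {Ω α : Type*} [Fintype Ω] [DecidableEq α] (P : Ω → ℝ) (X : Ω → α) (a : α) : ℝ :=
  ∑ ω with X ω = a, P ω

/-- Shannon entropy `H(X) = - ∑ p(a) log p(a)`. -/
def entropy {Ω α : Type*} [Fintype Ω] [Fintype α] [DecidableEq α] (P : Ω → ℝ) (X : Ω → α) : ℝ :=
  -∑ a, law P X a * Real.logb 2 (law P X a)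

/-- Conditional entropy `H(X|Y) = - ∑ p(a,b) log p(a|b)`. -/
def condEntropy {Ω α β : Type*} [Fintype Ω] [Fintype α] [DecidableEq α] [Fintype β] [DecidableEq β]
    (P : Ω → ℝ) (X : Ω → α) (Y : Ω → β) : ℝ :=
  -∑ a, ∑ b, law P (fun ω => (X ω, Y ω)) (a, b) *
    Real.logb 2 (law P (fun ω => (X ω, Y ω)) (a, b) / law P Y b)

/-- Conditional mutual information
`I(X;Y|Z) = ∑ p(a,b,c) log (p(c) p(a,b,c) / (p(a,c) p(b,c)))`. -/
def condMutualInfo {Ω α β γ : Type*} [Fintype Ω] [Fintype α] [DecidableEq α] [Fintype β]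
    [DecidableEq β] [Fintype γ] [DecidableEq γ]
    (P : Ω → ℝ) (X : Ω → α) (Y : Ω → β) (Z : Ω → γ) : ℝ :=
  ∑ a, ∑ b, ∑ c, law P (fun ω => (X ω, Y ω, Z ω)) (a, b, c) *
    Real.logb 2 (law P Z c * law P (fun ω => (X ω, Y ω, Z ω)) (a, b, c) /
      (law P (fun ω => (X ω, Z ω)) (a, c) * law P (fun ω => (Y ω, Z ω)) (b, c)))

/-! ### Sources -/

/-- The sources have no common part: a random variable that can be computed almost surely both from
`X₁` alone and from `X₂` alone is almost surely constant. -/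
def NoCommonPart {X₁ X₂ : Type*} (p : X₁ × X₂ → ℝ) : Prop :=
  ∀ (f : X₁ → ℕ) (g : X₂ → ℕ), (∀ a b, 0 < p (a, b) → f a = g b) →
    ∃ c, ∀ a b, 0 < p (a, b) → f a = c

/-- The law of `n` independent copies of the source pair. -/
def iidLaw {X₁ X₂ : Type*} (p : X₁ × X₂ → ℝ) {n : ℕ} (x₁ : Fin n → X₁) (x₂ : Fin n → X₂) : ℝ :=
  ∏ k, p (x₁ k, x₂ k)

/-! ### Nearly semi-regular bipartite graphs -/

/-- Degree of a vertex of the first vertex set; a bipartite graph is given by its edge set. -/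
def deg₁ {Δ₁ Δ₂ : ℕ} (E : Finset (Fin Δ₁ × Fin Δ₂)) (u : Fin Δ₁) : ℕ :=
  (Finset.univ.filter fun v : Fin Δ₂ => (u, v) ∈ E).card

/-- Degree of a vertex of the second vertex set. -/
def deg₂ {Δ₁ Δ₂ : ℕ} (E : Finset (Fin Δ₁ × Fin Δ₂)) (v : Fin Δ₂) : ℕ :=
  (Finset.univ.filter fun u : Fin Δ₁ => (u, v) ∈ E).card

/-- The bipartite graph with vertex sets `Fin Δ₁`, `Fin Δ₂` and edge set `E` is nearly semi-regular
with parameters `(Δ₁, Δ₂, Δ₁', Δ₂', μ)`. -/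
structure IsNearlySemiRegular {Δ₁ Δ₂ : ℕ} (E : Finset (Fin Δ₁ × Fin Δ₂)) (Δ₁' Δ₂' μ : ℝ) :
    Prop where
  one_lt_slack : 1 < μ
  pos₁ : 0 < Δ₁'
  pos₂ : 0 < Δ₂'
  degree₁ : ∀ u, Δ₂' * μ⁻¹ ≤ (deg₁ E u : ℝ) ∧ (deg₁ E u : ℝ) ≤ Δ₂' * μ
  degree₂ : ∀ v, Δ₁' * μ⁻¹ ≤ (deg₂ E v : ℝ) ∧ (deg₂ E v : ℝ) ≤ Δ₁' * μ

/-! ### Coding systems -/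

/-- A distributed source coding system of block length `n` on the bipartite graph `E`: two separate
encoders and a decoder defined on the edges. If the pair of encoder outputs is not an edge, there is
nothing to decode, and the reconstruction is one fixed arbitrary pair of sequences `fallback`. -/
structure DSCSystem (X₁ X₂ Y : Type*) (n : ℕ) {Δ₁ Δ₂ : ℕ} (E : Finset (Fin Δ₁ × Fin Δ₂)) where
  f₁ : (Fin n → X₁) → Fin Δ₁
  f₂ : (Fin n → X₂) → Fin Δ₂
  g : {e : Fin Δ₁ × Fin Δ₂ // e ∈ E} → (Fin n → X₁) × (Fin n → Y)
  fallback : (Fin n → X₁) × (Fin n → Y)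

/-- The pair of reconstructed sequences. -/
def DSCSystem.reconstruct {X₁ X₂ Y : Type*} {n Δ₁ Δ₂ : ℕ} {E : Finset (Fin Δ₁ × Fin Δ₂)}
    (S : DSCSystem X₁ X₂ Y n E) (x₁ : Fin n → X₁) (x₂ : Fin n → X₂) :
    (Fin n → X₁) × (Fin n → Y) :=
  if h : (S.f₁ x₁, S.f₂ x₂) ∈ E then S.g ⟨(S.f₁ x₁, S.f₂ x₂), h⟩ else S.fallback

/-- Hamming distortion on one letter. -/
def hammingDistortion {X : Type*} [DecidableEq X] (a b : X) : ℝ := if a = b then 0 else 1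

/-- Average of a one-letter distortion over a block. -/
def blockDistortion {X Y : Type*} (d : X → Y → ℝ) {n : ℕ} (x : Fin n → X) (y : Fin n → Y) : ℝ :=
  (1 / (n : ℝ)) * ∑ k, d (x k) (y k)

/-- Expected Hamming distortion of the first source. -/
def DSCSystem.τ₁ {X₁ X₂ Y : Type*} [Fintype X₁] [DecidableEq X₁] [Fintype X₂]
    {n Δ₁ Δ₂ : ℕ} {E : Finset (Fin Δ₁ × Fin Δ₂)}
    (S : DSCSystem X₁ X₂ Y n E) (p : X₁ × X₂ → ℝ) : ℝ :=
  ∑ x₁ : Fin n → X₁, ∑ x₂ : Fin n → X₂,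
    iidLaw p x₁ x₂ * blockDistortion hammingDistortion x₁ (S.reconstruct x₁ x₂).1

/-- Expected distortion of the second source. -/
def DSCSystem.τ₂ {X₁ X₂ Y : Type*} [Fintype X₁] [Fintype X₂]
    {n Δ₁ Δ₂ : ℕ} {E : Finset (Fin Δ₁ × Fin Δ₂)}
    (S : DSCSystem X₁ X₂ Y n E) (p : X₁ × X₂ → ℝ) (d : X₂ → Y → ℝ) : ℝ :=
  ∑ x₁ : Fin n → X₁, ∑ x₂ : Fin n → X₂,
    iidLaw p x₁ x₂ * blockDistortion d x₂ (S.reconstruct x₁ x₂).2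

/-- Rate–distortion tuples `(R₁, R₂, R₁', R₂', D)`. -/
@[ext] structure RateTuple where
  R₁ : ℝ
  R₂ : ℝ
  R₁' : ℝ
  R₂' : ℝ
  D : ℝ

/-- Achievability where the rates bound the exponents of the graph parameters from above. -/
def Achievable {X₁ X₂ Y : Type*} [Fintype X₁] [DecidableEq X₁] [Fintype X₂]
    (p : X₁ × X₂ → ℝ) (d : X₂ → Y → ℝ) (t : RateTuple) : Prop :=
  ∀ ε : ℝ, 0 < ε → ∃ N : ℕ, ∀ n : ℕ, N ≤ n →
    ∃ (Δ₁ Δ₂ : ℕ) (Δ₁' Δ₂' μ : ℝ) (E : Finset (Fin Δ₁ × Fin Δ₂)) (S : DSCSystem X₁ X₂ Y n E),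
      IsNearlySemiRegular E Δ₁' Δ₂' μ ∧
      (1 / (n : ℝ)) * Real.logb 2 Δ₁ < t.R₁ + ε ∧
      (1 / (n : ℝ)) * Real.logb 2 Δ₂ < t.R₂ + ε ∧
      (1 / (n : ℝ)) * Real.logb 2 Δ₁' < t.R₁' + ε ∧
      (1 / (n : ℝ)) * Real.logb 2 Δ₂' < t.R₂' + ε ∧
      (1 / (n : ℝ)) * Real.logb 2 μ < ε ∧
      S.τ₁ p ≤ ε ∧ S.τ₂ p d ≤ t.D + ε

/-- Achievability where the rates are the exponents of the graph parameters. -/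
def ExactlyAchievable {X₁ X₂ Y : Type*} [Fintype X₁] [DecidableEq X₁] [Fintype X₂]
    (p : X₁ × X₂ → ℝ) (d : X₂ → Y → ℝ) (t : RateTuple) : Prop :=
  ∀ ε : ℝ, 0 < ε → ∃ N : ℕ, ∀ n : ℕ, N ≤ n →
    ∃ (Δ₁ Δ₂ : ℕ) (Δ₁' Δ₂' μ : ℝ) (E : Finset (Fin Δ₁ × Fin Δ₂)) (S : DSCSystem X₁ X₂ Y n E),
      IsNearlySemiRegular E Δ₁' Δ₂' μ ∧
      |(1 / (n : ℝ)) * Real.logb 2 Δ₁ - t.R₁| < ε ∧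
      |(1 / (n : ℝ)) * Real.logb 2 Δ₂ - t.R₂| < ε ∧
      |(1 / (n : ℝ)) * Real.logb 2 Δ₁' - t.R₁'| < ε ∧
      |(1 / (n : ℝ)) * Real.logb 2 Δ₂' - t.R₂'| < ε ∧
      (1 / (n : ℝ)) * Real.logb 2 μ < ε ∧
      S.τ₁ p ≤ ε ∧ S.τ₂ p d ≤ t.D + ε

/-- The tuple obeys the relations between the exponents of a nearly semi-regular graph: degrees are
at least one and at most the number of vertices, and counting the edges from either side gives the
same number. -/
def RateTuple.IsGraphical (t : RateTuple) : Prop :=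
  (0 ≤ t.R₁' ∧ t.R₁' ≤ t.R₁) ∧ (0 ≤ t.R₂' ∧ t.R₂' ≤ t.R₂) ∧ t.R₁ + t.R₂' = t.R₁' + t.R₂

/-! ### The single-letter region -/

/-- The joint law `p(x₁, x₂, v) = p(x₁, x₂) q(v | x₂)`, under which `X₁ → X₂ → V`. -/
def jointLaw {X₁ X₂ V : Type*} (p : X₁ × X₂ → ℝ) (q : X₂ → V → ℝ) (ω : X₁ × X₂ × V) : ℝ :=
  p (ω.1, ω.2.1) * q ω.2.1 ω.2.2

/-- The union over all channels `q(v | x₂)` with an auxiliary alphabet of at most `|X₂| + 2`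
letters. -/
def rateRegion {X₁ X₂ Y : Type*} [Fintype X₁] [DecidableEq X₁] [Fintype X₂] [DecidableEq X₂]
    (p : X₁ × X₂ → ℝ) (d : X₂ → Y → ℝ) : Set RateTuple :=
  {t | ∃ (k : ℕ) (q : X₂ → Fin k → ℝ),
    k ≤ Fintype.card X₂ + 2 ∧
    (∀ x₂, q x₂ ∈ stdSimplex ℝ (Fin k)) ∧
    (∃ xhat : X₁ → Fin k → Y,
      ∑ ω : X₁ × X₂ × Fin k, jointLaw p q ω * d ω.2.1 (xhat ω.1 ω.2.2) ≤ t.D) ∧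
    (t.R₁' ≤ t.R₁ ∧ 0 ≤ t.R₁') ∧
    (t.R₂' ≤ t.R₂ ∧ 0 ≤ t.R₂') ∧
    condEntropy (jointLaw p q) (fun ω => ω.1) (fun ω => ω.2.2) ≤ t.R₁' ∧
    condMutualInfo (jointLaw p q) (fun ω => ω.2.2) (fun ω => ω.2.1) (fun ω => ω.1) ≤ t.R₂' ∧
    t.R₁ + t.R₂' = t.R₁' + t.R₂ ∧
    entropy (jointLaw p q) (fun ω => ω.1) +
      condMutualInfo (jointLaw p q) (fun ω => ω.2.2) (fun ω => ω.2.1) (fun ω => ω.1) ≤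
        t.R₁ + t.R₂'}

end

/-! Converse. Let `F` be the output of the second encoder. The edges at a vertex of the second side
number at most Δ₁'μ, and each names one candidate that X₁ⁿ resembles up to a small Hamming
distortion, so H(X₁ⁿ|F) is at most about log Δ₁'. Given X₁ⁿ, the vertex `F` is a neighbour of a
known vertex, so H(F|X₁ⁿ) is at most about log Δ₂'. The pair (F, X₁ⁿ) is nearly read off from one of
at most Δ₁Δ₂'μ edges, so its entropy is at most about log(Δ₁Δ₂'). These are `condEntropy_fst_le`,
`condEntropy_snd_le` and `entropy_pair_le`, each a Gibbs inequality against an explicit test law.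
They need non-edges to be rare: a non-edge yields one fixed sequence, and this is far from X₁ⁿ with
high probability unless X₁ is constant (`nonEdgeProb_le`); constant X₁ gets its own argument.

Single letters. Take V to be a uniform index i together with `F` and X₁ⁿ without its letter i. Since
the source is memoryless, X₁ᵢ → X₂ᵢ → V holds, and both H(X₁|V) and I(V;X₂|X₁) are bounded by the
normalized block quantities (`exists_single_letter`). A Carathéodory reduction
(`exists_channel_fin`) brings V down to |X₂|+2 letters, and compactness
(`exists_channel_of_forall_slack`) removes the slack ε.

Direct part. A random codebook of about 2^{nI(V;X₂)} words covers X₂ⁿ; the encoder picks a word that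
is jointly good with most x₁ given x₂ (`exists_codebook`). Typicality gives a sparse relation
between x₁ and codewords: about 2^{nI(V;X₂|X₁)} codewords per x₁, at most about 2^{nH(X₁|V)}
sequences per codeword, about 2^{n(H(X₁)+I(V;X₂|X₁))} pairs in all. Both sides are binned at random;
the three rate conditions are what makes collisions and overloaded bins rare (`exists_binning`). The
occupied pairs of bins satisfy only upper degree bounds, so they are joined to a disjoint union of
complete bipartite graphs of exactly the required degrees, and the union is nearly semi-regular with
slack 2.

Finally, exact achievability forces the graphical relations by counting edges from both sides
(`ExactlyAchievable.isGraphical`). -/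

open scoped BigOperators

noncomputable section

set_option linter.unusedSectionVars false

/-! ### Laws of random variables and information measures as expectations -/

section Law

variable {Ω α β γ : Type*} [Fintype Ω]

theorem sum_law_mul [Fintype α] [DecidableEq α] (P : Ω → ℝ) (X : Ω → α) (φ : α → ℝ) :
    ∑ a, law P X a * φ a = ∑ ω, P ω * φ (X ω) := by
  rw [← Finset.sum_fiberwise Finset.univ X (fun ω => P ω * φ (X ω))]
  refine Finset.sum_congr rfl fun a _ => ?_
  rw [law, Finset.sum_mul]
  refine Finset.sum_congr rfl fun ω hω => ?_
  rw [(Finset.mem_filter.1 hω).2]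

theorem sum_law [Fintype α] [DecidableEq α] (P : Ω → ℝ) (X : Ω → α) :
    ∑ a, law P X a = ∑ ω, P ω := by
  simpa using sum_law_mul P X (fun _ => 1)

theorem law_nonneg [DecidableEq α] {P : Ω → ℝ} (hP : ∀ ω, 0 ≤ P ω) (X : Ω → α) (a : α) :
    0 ≤ law P X a :=
  Finset.sum_nonneg fun ω _ => hP ω

theorem law_eq_sum_ite [DecidableEq α] (P : Ω → ℝ) (X : Ω → α) (a : α) :
    law P X a = ∑ ω, P ω * (if X ω = a then 1 else 0) := by
  simp [law, Finset.sum_filter]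

theorem law_law [Fintype α] [DecidableEq α] [DecidableEq β] (P : Ω → ℝ) (Z : Ω → α) (f : α → β)
    (b : β) : law (law P Z) f b = law P (fun ω => f (Z ω)) b := by
  rw [law_eq_sum_ite, law_eq_sum_ite, sum_law_mul P Z]

theorem le_law [DecidableEq α] {P : Ω → ℝ} (hP : ∀ ω, 0 ≤ P ω) (X : Ω → α) (ω : Ω) :
    P ω ≤ law P X (X ω) :=
  Finset.single_le_sum (f := P) (fun i _ => hP i) (by simp)

theorem law_pos [DecidableEq α] {P : Ω → ℝ} (hP : ∀ ω, 0 ≤ P ω) (X : Ω → α) {ω : Ω}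
    (h : 0 < P ω) : 0 < law P X (X ω) :=
  h.trans_le (le_law hP X ω)

theorem exists_of_law_pos [DecidableEq α] {P : Ω → ℝ} (hP : ∀ ω, 0 ≤ P ω) {X : Ω → α} {a : α}
    (h : 0 < law P X a) : ∃ ω, X ω = a ∧ 0 < P ω := by
  obtain ⟨ω, hω, h'⟩ := Finset.exists_ne_zero_of_sum_ne_zero h.ne'
  exact ⟨ω, (Finset.mem_filter.1 hω).2, lt_of_le_of_ne (hP ω) h'.symm⟩

theorem sum_law_pair_left [Fintype α] [DecidableEq α] [DecidableEq β] (P : Ω → ℝ)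
    (X : Ω → α) (Y : Ω → β) (b : β) :
    ∑ a, law P (fun ω => (X ω, Y ω)) (a, b) = law P Y b := by
  simp only [law_eq_sum_ite, Prod.mk.injEq]
  rw [Finset.sum_comm]
  refine Finset.sum_congr rfl fun ω _ => ?_
  rw [← Finset.mul_sum]
  congr 1
  by_cases h : Y ω = b <;> simp [h]

theorem law_equiv_apply [DecidableEq α] [DecidableEq β] (P : Ω → ℝ) (X : Ω → α) (f : α → β)
    (hf : Function.Injective f) (a : α) : law P (fun ω => f (X ω)) (f a) = law P X a := by
  simp only [law, hf.eq_iff]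

/-- As expectations over sample points, information measures can be compared termwise: where `P ω`
is positive, all laws at the values taken are positive, so logarithms of products split. -/
theorem entropy_eq_sum [Fintype α] [DecidableEq α] (P : Ω → ℝ) (X : Ω → α) :
    entropy P X = ∑ ω, P ω * -Real.logb 2 (law P X (X ω)) := by
  rw [entropy, sum_law_mul P X (fun a => Real.logb 2 (law P X a)), ← Finset.sum_neg_distrib]
  simp

theorem condEntropy_eq_sum [Fintype α] [DecidableEq α] [Fintype β] [DecidableEq β]
    (P : Ω → ℝ) (X : Ω → α) (Y : Ω → β) :
    condEntropy P X Y = ∑ ω, P ω * -Real.logb 2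
      (law P (fun ω => (X ω, Y ω)) (X ω, Y ω) / law P Y (Y ω)) := by
  have := sum_law_mul P (fun ω => (X ω, Y ω))
    (fun c => Real.logb 2 (law P (fun ω => (X ω, Y ω)) c / law P Y c.2))
  rw [Fintype.sum_prod_type] at this
  rw [condEntropy, this, ← Finset.sum_neg_distrib]
  simp

theorem condMutualInfo_eq_sum [Fintype α] [DecidableEq α] [Fintype β] [DecidableEq β]
    [Fintype γ] [DecidableEq γ] (P : Ω → ℝ) (X : Ω → α) (Y : Ω → β) (Z : Ω → γ) :
    condMutualInfo P X Y Z = ∑ ω, P ω * Real.logb 2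
      (law P Z (Z ω) * law P (fun ω => (X ω, Y ω, Z ω)) (X ω, Y ω, Z ω) /
      (law P (fun ω => (X ω, Z ω)) (X ω, Z ω) * law P (fun ω => (Y ω, Z ω)) (Y ω, Z ω))) := by
  have := sum_law_mul P (fun ω => (X ω, Y ω, Z ω))
    (fun c => Real.logb 2 (law P Z c.2.2 * law P (fun ω => (X ω, Y ω, Z ω)) c /
      (law P (fun ω => (X ω, Z ω)) (c.1, c.2.2) * law P (fun ω => (Y ω, Z ω)) (c.2.1, c.2.2))))
  simp only [Fintype.sum_prod_type] at this
  rw [condMutualInfo, this]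

end Law

/-! ### Gibbs' inequality and cross-entropy bounds -/

section Gibbs

/-- This is log x ≤ x − 1 at x = Q/P. Only the totals are compared, so `Q` may lose mass, which
allows test laws that are merely subprobabilities. -/
theorem sum_mul_logb_div_nonpos {ι : Type*} [Fintype ι] {P Q : ι → ℝ} (hP : ∀ i, 0 ≤ P i)
    (hQ : ∀ i, 0 ≤ Q i) (h : ∑ i, Q i ≤ ∑ i, P i) (hpos : ∀ i, 0 < P i → 0 < Q i) :
    ∑ i, P i * Real.logb 2 (Q i / P i) ≤ 0 := by
  have h2 : (0 : ℝ) < Real.log 2 := Real.log_pos (by norm_num)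
  have key : ∀ i, P i * Real.logb 2 (Q i / P i) ≤ (Q i - P i) / Real.log 2 := by
    intro i
    rcases (hP i).eq_or_lt with h0 | h0
    · rw [← h0]; simpa using div_nonneg (hQ i) h2.le
    · rw [Real.logb, ← mul_div_assoc, div_le_div_iff_of_pos_right h2]
      have := Real.log_le_sub_one_of_pos (div_pos (hpos i h0) h0)
      calc P i * Real.log (Q i / P i) ≤ P i * (Q i / P i - 1) := by gcongr
        _ = Q i - P i := by field_simp
  calc _ ≤ ∑ i, (Q i - P i) / Real.log 2 := Finset.sum_le_sum fun i _ => key i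
    _ = (∑ i, Q i - ∑ i, P i) / Real.log 2 := by
        rw [← Finset.sum_div, Finset.sum_sub_distrib]
    _ ≤ 0 := div_nonpos_of_nonpos_of_nonneg (by linarith) h2.le

variable {Ω α β γ : Type*} [Fintype Ω]

/-- Cross entropy with respect to a subchannel bounds the conditional entropy. -/
theorem condEntropy_le [Fintype α] [DecidableEq α] [Fintype β] [DecidableEq β] {P : Ω → ℝ}
    (hP : ∀ ω, 0 ≤ P ω) (X : Ω → α) (Y : Ω → β) {Q : α → β → ℝ} (hQ : ∀ a b, 0 ≤ Q a b)
    (hQ1 : ∀ b, ∑ a, Q a b ≤ 1) (hpos : ∀ ω, 0 < P ω → 0 < Q (X ω) (Y ω)) :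
    condEntropy P X Y ≤ ∑ ω, P ω * -Real.logb 2 (Q (X ω) (Y ω)) := by
  set L := law P (fun ω => (X ω, Y ω)) with hL
  have hL0 : ∀ c, 0 ≤ L c := law_nonneg hP _
  have g := sum_mul_logb_div_nonpos (P := L) (Q := fun c => Q c.1 c.2 * law P Y c.2) hL0
    (fun c => mul_nonneg (hQ _ _) (law_nonneg hP _ _)) (by
      rw [hL, sum_law, Fintype.sum_prod_type, Finset.sum_comm, ← sum_law P Y]
      refine Finset.sum_le_sum fun b _ => ?_
      dsimp only
      rw [← Finset.sum_mul]
      exact mul_le_of_le_one_left (law_nonneg hP _ _) (hQ1 b)) (by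
      intro c hc
      obtain ⟨ω, rfl, hω⟩ := exists_of_law_pos hP hc
      exact mul_pos (hpos ω hω) (law_pos hP Y hω))
  rw [hL, sum_law_mul] at g
  rw [condEntropy_eq_sum, ← sub_nonpos, ← Finset.sum_sub_distrib]
  refine le_of_eq_of_le (Finset.sum_congr rfl fun ω _ => ?_) g
  rcases (hP ω).eq_or_lt with h0 | h0
  · simp [← h0]
  have h1 := hpos ω h0
  have h2 := law_pos hP Y h0
  have h3 : 0 < L (X ω, Y ω) := law_pos hP (fun ω => (X ω, Y ω)) h0
  dsimp only
  rw [← hL, Real.logb_div h3.ne' h2.ne', Real.logb_div (mul_pos h1 h2).ne' h3.ne',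
    Real.logb_mul h1.ne' h2.ne']
  ring

theorem condEntropy_le_comp [Fintype α] [DecidableEq α] [Fintype β] [DecidableEq β]
    [Fintype γ] [DecidableEq γ] {P : Ω → ℝ}
    (hP : ∀ ω, 0 ≤ P ω) (X : Ω → α) (Y : Ω → β) (g : β → γ) :
    condEntropy P X Y ≤ condEntropy P X (fun ω => g (Y ω)) := by
  rw [condEntropy_eq_sum P X (fun ω => g (Y ω))]
  refine condEntropy_le hP X Y (Q := fun a b => law P (fun ω => (X ω, g (Y ω))) (a, g b) /
    law P (fun ω => g (Y ω)) (g b)) (fun a b => div_nonneg (law_nonneg hP _ _)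
      (law_nonneg hP _ _)) (fun b => ?_) (fun ω h => ?_)
  · rw [← Finset.sum_div, sum_law_pair_left P X (fun ω => g (Y ω))]
    -- Only ≤ 1: at values of mass zero the quotient 0/0 is 0.
    exact div_self_le_one _
  · exact div_pos (law_pos hP (fun ω => (X ω, g (Y ω))) h) (law_pos hP (fun ω => g (Y ω)) h)

theorem entropy_pair [Fintype α] [DecidableEq α] [Fintype β] [DecidableEq β]
    {P : Ω → ℝ} (hP : ∀ ω, 0 ≤ P ω) (X : Ω → α) (Y : Ω → β) :
    entropy P (fun ω => (X ω, Y ω)) = entropy P Y + condEntropy P X Y := by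
  rw [entropy_eq_sum, entropy_eq_sum, condEntropy_eq_sum, ← Finset.sum_add_distrib]
  refine Finset.sum_congr rfl fun ω _ => ?_
  rcases (hP ω).eq_or_lt with h0 | h0
  · simp [← h0]
  rw [Real.logb_div (law_pos hP (fun ω => (X ω, Y ω)) h0).ne' (law_pos hP Y h0).ne']
  ring

/-- Cross entropy with respect to a subprobability bounds the entropy. -/
theorem entropy_le [Fintype α] [DecidableEq α] {P : Ω → ℝ}
    (hP : ∀ ω, 0 ≤ P ω) (hP1 : ∑ ω, P ω = 1) (X : Ω → α) {Q : α → ℝ} (hQ : ∀ a, 0 ≤ Q a)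
    (hQ1 : ∑ a, Q a ≤ 1) (hpos : ∀ ω, 0 < P ω → 0 < Q (X ω)) :
    entropy P X ≤ ∑ ω, P ω * -Real.logb 2 (Q (X ω)) := by
  -- Entropy is conditional entropy given a one-point variable.
  have h1 : ∀ u, law P (fun _ : Ω => ()) u = 1 := fun u => by simp [law, hP1]
  have := condEntropy_le hP X (fun _ => ()) (Q := fun a _ => Q a) (fun a _ => hQ a)
    (fun _ => hQ1) hpos
  refine le_of_eq_of_le ?_ this
  rw [condEntropy_eq_sum, entropy_eq_sum]
  refine Finset.sum_congr rfl fun ω _ => ?_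
  rw [h1, div_one, law_equiv_apply P X (fun a => (a, ())) (fun a b h => (Prod.ext_iff.1 h).1)]

end Gibbs

/-! ### Decomposition of the information measures over the letters of V -/

section Columns

variable {X₁ X₂ V Y : Type*} [Fintype X₁] [Fintype X₂]

/-- The contribution of one letter `v`, with `m x₂ = q(v | x₂)`, to `H(X₁|V)`. -/
def columnEntropy (p : X₁ × X₂ → ℝ) (m : X₂ → ℝ) : ℝ :=
  (∑ a, Real.negMulLog (∑ b, p (a, b) * m b) - Real.negMulLog (∑ a, ∑ b, p (a, b) * m b)) /
    Real.log 2

/-- The contribution of one letter `v`, with `m x₂ = q(v | x₂)`, to `I(V;X₂|X₁)`. -/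
def columnInfo (p : X₁ × X₂ → ℝ) (m : X₂ → ℝ) : ℝ :=
  (∑ a, (Real.negMulLog (∑ b, p (a, b) * m b) +
    ∑ b, (p (a, b) * m b * Real.log (∑ b', p (a, b')) - p (a, b) * Real.negMulLog (m b)))) /
    Real.log 2

/-- The terms c log c produced by the scaling cancel. With homogeneity of degree one, reweighting
the letters of V changes the information measures linearly, as the support reduction needs. -/
theorem columnEntropy_smul (p : X₁ × X₂ → ℝ) (m : X₂ → ℝ) (c : ℝ) :
    columnEntropy p (fun b => c * m b) = c * columnEntropy p m := by
  have h : ∀ a, ∑ b, p (a, b) * (c * m b) = c * ∑ b, p (a, b) * m b := fun a => by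
    rw [Finset.mul_sum]; exact Finset.sum_congr rfl fun b _ => by ring
  simp only [columnEntropy, h]
  rw [← Finset.mul_sum, Real.negMulLog_mul]
  simp only [Real.negMulLog_mul, Finset.sum_add_distrib, ← Finset.mul_sum, ← Finset.sum_mul]
  ring

theorem columnInfo_smul (p : X₁ × X₂ → ℝ) (m : X₂ → ℝ) (c : ℝ) :
    columnInfo p (fun b => c * m b) = c * columnInfo p m := by
  have h : ∀ a, ∑ b, p (a, b) * (c * m b) = c * ∑ b, p (a, b) * m b := fun a => by
    rw [Finset.mul_sum]; exact Finset.sum_congr rfl fun b _ => by ring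
  simp only [columnInfo, h]
  rw [← mul_div_assoc]
  congr 1
  rw [Finset.mul_sum]
  refine Finset.sum_congr rfl fun a _ => ?_
  rw [Real.negMulLog_mul, mul_add, Finset.mul_sum, Finset.sum_mul, add_right_comm,
    ← Finset.sum_add_distrib, add_comm]
  congr 1
  refine Finset.sum_congr rfl fun b _ => ?_
  rw [Real.negMulLog_mul]
  ring

theorem continuous_columnEntropy (p : X₁ × X₂ → ℝ) : Continuous (columnEntropy p) := by
  unfold columnEntropy; fun_prop

theorem continuous_columnInfo (p : X₁ × X₂ → ℝ) : Continuous (columnInfo p) := by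
  unfold columnInfo; fun_prop

theorem mul_logb_div_eq {x y : ℝ} (h : 0 < x → 0 < y) (hx : 0 ≤ x) :
    x * Real.logb 2 (x / y) = (-Real.negMulLog x - x * Real.log y) / Real.log 2 := by
  rcases hx.eq_or_lt with h0 | h0
  · simp [← h0]
  · rw [Real.logb, Real.log_div h0.ne' (h h0).ne', Real.negMulLog]; ring

theorem sum_jointLaw_mul [Fintype V] (p : X₁ × X₂ → ℝ) (q : X₂ → V → ℝ) (φ : X₁ → X₂ → V → ℝ) :
    ∑ ω, jointLaw p q ω * φ ω.1 ω.2.1 ω.2.2 =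
      ∑ v, ∑ a, ∑ b, p (a, b) * q b v * φ a b v := by
  simp only [jointLaw, Fintype.sum_prod_type]
  rw [Finset.sum_comm' (t' := Finset.univ) (s' := fun _ => Finset.univ) (by simp)]
  rw [Finset.sum_comm]
  simp only [Finset.sum_comm (γ := V)]

variable [DecidableEq X₁] [DecidableEq X₂] [Fintype V] [DecidableEq V]

theorem law_jointLaw_fst_label (p : X₁ × X₂ → ℝ) (q : X₂ → V → ℝ) (a : X₁) (v : V) :
    law (jointLaw p q) (fun ω => (ω.1, ω.2.2)) (a, v) = ∑ b, p (a, b) * q b v := by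
  rw [law_eq_sum_ite,
    sum_jointLaw_mul p q (fun a' _ v' => if (a', v') = (a, v) then 1 else 0)]
  simp [Prod.mk.injEq, ite_and]

theorem law_jointLaw_label_fst (p : X₁ × X₂ → ℝ) (q : X₂ → V → ℝ) (a : X₁) (v : V) :
    law (jointLaw p q) (fun ω => (ω.2.2, ω.1)) (v, a) = ∑ b, p (a, b) * q b v := by
  rw [law_eq_sum_ite,
    sum_jointLaw_mul p q (fun a' _ v' => if (v', a') = (v, a) then 1 else 0)]
  simp [Prod.mk.injEq, ite_and]

theorem law_jointLaw_label (p : X₁ × X₂ → ℝ) (q : X₂ → V → ℝ) (v : V) :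
    law (jointLaw p q) (fun ω => ω.2.2) v = ∑ a, ∑ b, p (a, b) * q b v := by
  rw [law_eq_sum_ite, sum_jointLaw_mul p q (fun _ _ v' => if v' = v then 1 else 0)]
  simp

theorem law_jointLaw_all (p : X₁ × X₂ → ℝ) (q : X₂ → V → ℝ) (a : X₁) (b : X₂) (v : V) :
    law (jointLaw p q) (fun ω => (ω.2.2, ω.2.1, ω.1)) (v, b, a) = p (a, b) * q b v := by
  rw [law_eq_sum_ite,
    sum_jointLaw_mul p q (fun a' b' v' => if (v', b', a') = (v, b, a) then 1 else 0)]
  simp [Prod.mk.injEq, ite_and]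

theorem law_jointLaw_snd_fst (p : X₁ × X₂ → ℝ) {q : X₂ → V → ℝ}
    (hq : ∀ b, q b ∈ stdSimplex ℝ V) (a : X₁) (b : X₂) :
    law (jointLaw p q) (fun ω => (ω.2.1, ω.1)) (b, a) = p (a, b) := by
  rw [law_eq_sum_ite,
    sum_jointLaw_mul p q (fun a' b' _ => if (b', a') = (b, a) then 1 else 0)]
  simp [Prod.mk.injEq, ite_and, ← Finset.mul_sum, (hq b).2]

theorem law_jointLaw_fst (p : X₁ × X₂ → ℝ) {q : X₂ → V → ℝ}
    (hq : ∀ b, q b ∈ stdSimplex ℝ V) (a : X₁) :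
    law (jointLaw p q) (fun ω => ω.1) a = ∑ b, p (a, b) := by
  rw [law_eq_sum_ite, sum_jointLaw_mul p q (fun a' _ _ => if a' = a then 1 else 0)]
  simp only [mul_ite, mul_one, mul_zero]
  rw [Finset.sum_comm]
  rw [Finset.sum_eq_single a (by intro c _ h; simp [h]) (by simp), Finset.sum_comm]
  simp [← Finset.mul_sum, (hq _).2]

/-- Besides additivity over letters, this form is manifestly continuous in the channel, since
`Real.negMulLog` is continuous at zero. -/
theorem condEntropy_jointLaw {p : X₁ × X₂ → ℝ} (hp : ∀ x, 0 ≤ p x) {q : X₂ → V → ℝ}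
    (hq : ∀ b v, 0 ≤ q b v) :
    condEntropy (jointLaw p q) (fun ω => ω.1) (fun ω => ω.2.2) =
      ∑ v, columnEntropy p (fun b => q b v) := by
  simp only [condEntropy, law_jointLaw_fst_label, law_jointLaw_label]
  rw [Finset.sum_comm, ← Finset.sum_neg_distrib]
  refine Finset.sum_congr rfl fun v _ => ?_
  have h0 : ∀ a, 0 ≤ ∑ b, p (a, b) * q b v := fun a =>
    Finset.sum_nonneg fun b _ => mul_nonneg (hp _) (hq _ _)
  rw [columnEntropy, ← Finset.sum_neg_distrib]
  have : ∀ a, -((∑ b, p (a, b) * q b v) * Real.logb 2 ((∑ b, p (a, b) * q b v) /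
      ∑ a, ∑ b, p (a, b) * q b v)) = (Real.negMulLog (∑ b, p (a, b) * q b v) +
        (∑ b, p (a, b) * q b v) * Real.log (∑ a, ∑ b, p (a, b) * q b v)) / Real.log 2 := by
    intro a
    rw [mul_logb_div_eq (fun h => h.trans_le (Finset.single_le_sum
      (f := fun a => ∑ b, p (a, b) * q b v) (fun a _ => h0 a) (Finset.mem_univ a))) (h0 a)]
    ring
  simp only [this]
  rw [← Finset.sum_div, Finset.sum_add_distrib, ← Finset.sum_mul]
  congr 1
  rw [Real.negMulLog]
  ring

theorem condMutualInfo_jointLaw {p : X₁ × X₂ → ℝ} (hp : ∀ x, 0 ≤ p x) {q : X₂ → V → ℝ}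
    (hq : ∀ b, q b ∈ stdSimplex ℝ V) :
    condMutualInfo (jointLaw p q) (fun ω => ω.2.2) (fun ω => ω.2.1) (fun ω => ω.1) =
      ∑ v, columnInfo p (fun b => q b v) := by
  simp only [condMutualInfo, law_jointLaw_all, law_jointLaw_label_fst, law_jointLaw_snd_fst p hq,
    law_jointLaw_fst p hq]
  refine Finset.sum_congr rfl fun v _ => ?_
  have key : ∀ a b, p (a, b) * q b v * Real.logb 2 ((∑ b, p (a, b)) * (p (a, b) * q b v) /
      ((∑ b, p (a, b) * q b v) * p (a, b))) =
      (p (a, b) * q b v * Real.log (∑ b', p (a, b')) - p (a, b) * Real.negMulLog (q b v) -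
        p (a, b) * q b v * Real.log (∑ b, p (a, b) * q b v)) / Real.log 2 := by
    intro a b
    rcases (hp (a, b)).eq_or_lt with h1 | h1
    · simp [← h1]
    rcases ((hq b).1 v).eq_or_lt with h2 | h2
    · simp [← h2]
    have h3 : 0 < ∑ b, p (a, b) := h1.trans_le (Finset.single_le_sum
      (f := fun b => p (a, b)) (fun b _ => hp _) (Finset.mem_univ b))
    have h4 : 0 < ∑ b, p (a, b) * q b v := (mul_pos h1 h2).trans_le (Finset.single_le_sum
      (f := fun b => p (a, b) * q b v) (fun b _ => mul_nonneg (hp _) ((hq b).1 v))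
      (Finset.mem_univ b))
    rw [Real.logb, Real.log_div (by positivity) (by positivity), Real.log_mul h3.ne' (by positivity),
      Real.log_mul h1.ne' h2.ne', Real.log_mul h4.ne' h1.ne', Real.negMulLog]
    ring
  simp only [key]
  rw [Finset.sum_comm, columnInfo, Finset.sum_div]
  refine Finset.sum_congr rfl fun a _ => ?_
  rw [← Finset.sum_div, Finset.sum_sub_distrib, ← Finset.sum_mul]
  congr 1
  rw [Real.negMulLog]
  ring

theorem entropy_jointLaw_fst (p : X₁ × X₂ → ℝ) {q : X₂ → V → ℝ}
    (hq : ∀ b, q b ∈ stdSimplex ℝ V) :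
    entropy (jointLaw p q) (fun ω => ω.1) = entropy p Prod.fst := by
  have : ∀ a, law p Prod.fst a = ∑ b, p (a, b) := fun a => by
    rw [law_eq_sum_ite, Fintype.sum_prod_type]
    simp only [mul_ite, mul_one, mul_zero]
    rw [Finset.sum_eq_single a (by intro c _ h; simp [h]) (by simp)]
    simp
  simp only [entropy, law_jointLaw_fst p hq, this]

end Columns

/-! ### Carathéodory reduction of the auxiliary alphabet -/

section Support

variable {V ι : Type*} [Fintype V] [Fintype ι]

/-- With more active letters than constraints there is a nonzero direction on the active letters
that preserves every constraint. Moving along it until the first weight vanishes removes a letter.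
-/
theorem exists_lt_support (c : ι → V → ℝ) (e l : V → ℝ) (hl : ∀ v, 0 ≤ l v) (w : ι → ℝ)
    (hw : ∀ v, l v ≠ 0 → 0 < ∑ j, w j * c j v)
    (hcard : Fintype.card ι < (Finset.univ.filter fun v => l v ≠ 0).card) :
    ∃ l' : V → ℝ, (∀ v, 0 ≤ l' v) ∧ (∀ v, l v = 0 → l' v = 0) ∧
      (∀ j, ∑ v, l' v * c j v = ∑ v, l v * c j v) ∧ ∑ v, l' v * e v ≤ ∑ v, l v * e v ∧
      (Finset.univ.filter fun v => l' v ≠ 0).card < (Finset.univ.filter fun v => l v ≠ 0).card := by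
  classical
  set s := Finset.univ.filter fun v => l v ≠ 0 with hs
  obtain ⟨δ, hδs, hδc, hδ0, hδe⟩ : ∃ δ : V → ℝ, (∀ v, l v = 0 → δ v = 0) ∧
      (∀ j, ∑ v, δ v * c j v = 0) ∧ (∃ v, δ v ≠ 0) ∧ ∑ v, δ v * e v ≤ 0 := by
    let T : (s → ℝ) →ₗ[ℝ] (ι → ℝ) :=
      { toFun := fun x j => ∑ v : s, x v * c j v
        map_add' := fun x y => by
          ext j; simp [add_mul, Finset.sum_add_distrib]
        map_smul' := fun r x => by
          ext j; simp [Finset.mul_sum, mul_assoc] }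
    obtain ⟨x, hx, hx0⟩ := (Submodule.ne_bot_iff _).1
      (LinearMap.ker_ne_bot_of_finrank_lt (f := T) (by simpa using hcard))
    let δ : V → ℝ := fun v => if h : v ∈ s then x ⟨v, h⟩ else 0
    have hsum : ∀ φ : V → ℝ, ∑ v, δ v * φ v = ∑ v : s, x v * φ v := by
      intro φ
      rw [← Finset.sum_subset (Finset.subset_univ s) (fun v _ hv => by simp [δ, hv]),
        ← Finset.sum_coe_sort s]
      exact Finset.sum_congr rfl fun v _ => by simp [δ]
    have h1 : ∀ v, l v = 0 → δ v = 0 := fun v hv => by simp [δ, hs, hv]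
    have h2 : ∀ j, ∑ v, δ v * c j v = 0 := fun j => by
      rw [hsum]; exact congrFun (LinearMap.mem_ker.1 hx) j
    have h3 : ∃ v, δ v ≠ 0 := by
      obtain ⟨v, hv⟩ := Function.ne_iff.1 hx0
      exact ⟨v, by simpa [δ] using hv⟩
    -- A kernel direction may be reversed; the sign is chosen so that the objective does not
    -- increase.
    rcases le_total (∑ v, δ v * e v) 0 with h | h
    · exact ⟨δ, h1, h2, h3, h⟩
    · refine ⟨fun v => -δ v, fun v hv => by simp [h1 v hv], fun j => by simp [h2 j], ?_, ?_⟩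
      · obtain ⟨v, hv⟩ := h3; exact ⟨v, neg_ne_zero.2 hv⟩
      · simpa using h
  -- A nonnegative nonzero direction would change the combination with weights `w`, which is
  -- positive on active letters, whereas the direction annihilates every constraint.
  have hneg : ∃ v, δ v < 0 := by
    by_contra! hcon
    obtain ⟨v, hv⟩ := hδ0
    have hz : ∑ v, δ v * ∑ j, w j * c j v = 0 := by
      simp only [Finset.mul_sum]
      rw [Finset.sum_comm]
      refine Finset.sum_eq_zero fun j _ => ?_
      calc ∑ v, δ v * (w j * c j v) = w j * ∑ v, δ v * c j v := by
            rw [Finset.mul_sum]; exact Finset.sum_congr rfl fun _ _ => by ring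
        _ = 0 := by rw [hδc, mul_zero]
    have hnn : ∀ v ∈ Finset.univ, 0 ≤ δ v * ∑ j, w j * c j v := fun v _ => by
      by_cases h : l v = 0
      · simp [hδs v h]
      · exact mul_nonneg (hcon v) (hw v h).le
    have := (Finset.sum_eq_zero_iff_of_nonneg hnn).1 hz v (Finset.mem_univ v)
    have hlv : l v ≠ 0 := fun h => hv (hδs v h)
    exact (mul_ne_zero hv (hw v hlv).ne') this
  -- Ratio test: the smallest quotient is the first time at which a weight reaches zero.
  obtain ⟨v₀, hv₀, hmin⟩ := Finset.exists_min_image (Finset.univ.filter fun v => δ v < 0)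
    (fun v => l v / -δ v) (by obtain ⟨v, hv⟩ := hneg; exact ⟨v, by simpa using hv⟩)
  have hv₀' : δ v₀ < 0 := by simpa using hv₀
  set t := l v₀ / -δ v₀ with ht
  have ht0 : 0 ≤ t := div_nonneg (hl _) (by linarith)
  refine ⟨fun v => l v + t * δ v, fun v => ?_, fun v hv => by simp [hv, hδs v hv], fun j => ?_, ?_,
    ?_⟩
  · by_cases h : δ v < 0
    · have := hmin v (by simpa using h)
      rw [le_div_iff₀ (by linarith)] at this
      dsimp only; linarith
    · exact add_nonneg (hl v) (mul_nonneg ht0 (not_lt.1 h))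
  · simp only [add_mul, Finset.sum_add_distrib, mul_assoc, ← Finset.mul_sum, hδc, mul_zero, add_zero]
  · simp only [add_mul, Finset.sum_add_distrib, mul_assoc, ← Finset.mul_sum]
    nlinarith
  · refine Finset.card_lt_card ⟨fun v hv => ?_, fun h => ?_⟩
    · simp only [hs, Finset.mem_filter, Finset.mem_univ, true_and] at hv ⊢
      intro h; exact hv (by simp [h, hδs v h])
    · have hin : v₀ ∈ s := by
        simp only [hs, Finset.mem_filter, Finset.mem_univ, true_and]
        intro h; rw [hδs v₀ h] at hv₀'; exact lt_irrefl _ hv₀'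
      have := h hin
      simp only [Finset.mem_filter, Finset.mem_univ, true_and] at this
      apply this
      rw [ht]
      rw [div_mul_eq_mul_div, mul_div_assoc, div_neg, div_self hv₀'.ne]
      ring

/-- A nonnegative combination obeying `card ι` linear constraints can be replaced by one with at
most `card ι` nonzero weights that does not increase a further linear objective. -/
theorem exists_small_support (c : ι → V → ℝ) (e : V → ℝ) (w : ι → ℝ) (l : V → ℝ)
    (hl : ∀ v, 0 ≤ l v) (hw : ∀ v, l v ≠ 0 → 0 < ∑ j, w j * c j v) :
    ∃ l' : V → ℝ, (∀ v, 0 ≤ l' v) ∧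
      (∀ j, ∑ v, l' v * c j v = ∑ v, l v * c j v) ∧ ∑ v, l' v * e v ≤ ∑ v, l v * e v ∧
      (Finset.univ.filter fun v => l' v ≠ 0).card ≤ Fintype.card ι := by
  classical
  induction hn : (Finset.univ.filter fun v => l v ≠ 0).card using Nat.strong_induction_on
    generalizing l with
  | _ n ih =>
    rcases le_or_gt n (Fintype.card ι) with h | h
    · exact ⟨l, hl, fun _ => rfl, le_rfl, hn ▸ h⟩
    · obtain ⟨l₁, h1, h2, h3, h4, h5⟩ := exists_lt_support c e l hl w hw (hn ▸ h)
      obtain ⟨l₂, k1, k2, k3, k4⟩ := ih _ (hn ▸ h5) l₁ h1 (fun v hv => hw v fun h => hv (h2 v h)) rfl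
      exact ⟨l₂, k1, fun j => (k2 j).trans (h3 j), k3.trans h4, k4⟩

/-- Embeds the active letters into `Fin K`; unused positions become `none` and contribute zero, so
the alphabet has exactly `K` letters. -/
theorem exists_relabel (s : Finset V) {K : ℕ} (hK : s.card ≤ K) :
    ∃ r : Fin K → Option V, ∀ φ : V → ℝ, (∀ v, v ∉ s → φ v = 0) →
      ∑ j, (r j).elim 0 φ = ∑ v, φ v := by
  classical
  let f : s ↪ Fin K := s.equivFin.toEmbedding.trans (Fin.castLEEmb hK)
  refine ⟨fun j => if h : ∃ v : s, f v = j then some h.choose else none, fun φ hφ => ?_⟩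
  have h1 : ∑ v, φ v = ∑ v : s, φ v := by
    rw [← Finset.sum_subset (Finset.subset_univ s) (fun v _ hv => hφ v hv), ← Finset.sum_coe_sort s]
  rw [h1, ← Finset.sum_subset (Finset.subset_univ (Finset.univ.map f)), Finset.sum_map]
  · refine Finset.sum_congr rfl fun v _ => ?_
    have h : ∃ v' : s, f v' = f v := ⟨v, rfl⟩
    dsimp only
    rw [dif_pos h, f.injective h.choose_spec]
    rfl
  · intro j _ hj
    have h : ¬∃ v' : s, f v' = j := fun ⟨v, hv⟩ => hj (by simp [← hv])
    dsimp only
    rw [dif_neg h]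
    rfl

end Support

/-! ### Bounded alphabets and closedness of the single-letter conditions -/

section Region

variable {X₁ X₂ V Y : Type*} [Fintype X₁] [DecidableEq X₁] [Fintype X₂] [DecidableEq X₂]
  [Fintype V] [DecidableEq V]

/-- The bound |X₂|+2 counts constraints: one normalization per letter x₂, plus the values of H(X₁|V)
and I(V;X₂|X₁). The distortion is linear in the weights and serves as the objective, so it costs no
letter. -/
theorem exists_channel_fin [Nonempty Y] {p : X₁ × X₂ → ℝ} (hp : ∀ x, 0 ≤ p x) {q : X₂ → V → ℝ}
    (hq : ∀ b, q b ∈ stdSimplex ℝ V) (d : X₂ → Y → ℝ) (xhat : X₁ → V → Y) :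
    ∃ (q' : X₂ → Fin (Fintype.card X₂ + 2) → ℝ) (xhat' : X₁ → Fin (Fintype.card X₂ + 2) → Y),
      (∀ b, q' b ∈ stdSimplex ℝ _) ∧
      condEntropy (jointLaw p q') (fun ω => ω.1) (fun ω => ω.2.2) =
        condEntropy (jointLaw p q) (fun ω => ω.1) (fun ω => ω.2.2) ∧
      condMutualInfo (jointLaw p q') (fun ω => ω.2.2) (fun ω => ω.2.1) (fun ω => ω.1) =
        condMutualInfo (jointLaw p q) (fun ω => ω.2.2) (fun ω => ω.2.1) (fun ω => ω.1) ∧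
      ∑ ω, jointLaw p q' ω * d ω.2.1 (xhat' ω.1 ω.2.2) ≤
        ∑ ω, jointLaw p q ω * d ω.2.1 (xhat ω.1 ω.2.2) := by
  classical
  let c : X₂ ⊕ Bool → V → ℝ := Sum.elim (fun b v => q b v)
    (fun i v => if i then columnEntropy p (fun b => q b v) else columnInfo p (fun b => q b v))
  let e : V → ℝ := fun v => ∑ a, ∑ b, p (a, b) * q b v * d b (xhat a v)
  -- All weights are 1 except on letters whose column vanishes; excluding those makes the sum of the
  -- normalization constraints strictly positive on the support.
  let l : V → ℝ := fun v => if ∀ b, q b v = 0 then 0 else 1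
  have hl1 : ∀ v, l v ≠ 1 → ∀ b, q b v = 0 := fun v hv => by
    by_contra h; exact hv (by simp only [l, h, if_false])
  have colH0 : columnEntropy p (fun _ => 0) = 0 := by
    simpa using columnEntropy_smul p (fun _ => 0) 0
  have colI0 : columnInfo p (fun _ => 0) = 0 := by
    simpa using columnInfo_smul p (fun _ => 0) 0
  obtain ⟨l', h0, hc, he, hcard⟩ := exists_small_support c e
    (Sum.elim (fun _ => 1) (fun _ => 0)) l
    (fun v => by simp only [l]; split_ifs <;> norm_num) (fun v hv => by
      simp only [Fintype.sum_sum_type, Sum.elim_inl, one_mul, Sum.elim_inr, zero_mul,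
        Finset.sum_const_zero, add_zero, c]
      have : ∃ b, q b v ≠ 0 := by
        by_contra! h; exact hv (by simp only [l, h, implies_true, if_true])
      obtain ⟨b, hb⟩ := this
      exact Finset.sum_pos' (fun b _ => (hq b).1 v)
        ⟨b, Finset.mem_univ b, lt_of_le_of_ne ((hq b).1 v) hb.symm⟩)
  have hc' : ∀ j, ∑ v, l' v * c j v = ∑ v, c j v := fun j => by
    rw [hc]
    refine Finset.sum_congr rfl fun v _ => ?_
    by_cases h : l v = 1
    · rw [h, one_mul]
    · have h0 := hl1 v h
      rcases j with b | i
      · simp [c, h0]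
      · simp [c, h0, colH0, colI0]
  have he' : ∑ v, l' v * e v ≤ ∑ v, e v := by
    refine he.trans_eq (Finset.sum_congr rfl fun v _ => ?_)
    by_cases h : l v = 1
    · rw [h, one_mul]
    · simp [e, hl1 v h]
  obtain ⟨r, hr⟩ := exists_relabel (Finset.univ.filter fun v => l' v ≠ 0)
    (K := Fintype.card X₂ + 2) (by simpa using hcard)
  have hr' : ∀ φ : V → ℝ, ∑ j, (r j).elim 0 (fun v => l' v * φ v) = ∑ v, l' v * φ v :=
    fun φ => hr _ fun v hv => by
      have : l' v = 0 := by simpa using hv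
      rw [this, zero_mul]
  let q' : X₂ → Fin (Fintype.card X₂ + 2) → ℝ := fun b j => (r j).elim 0 (fun v => l' v * q b v)
  let y₀ : Y := Classical.arbitrary Y
  have hq' : ∀ b, q' b ∈ stdSimplex ℝ _ := fun b => by
    refine ⟨fun j => ?_, ?_⟩
    · simp only [q']
      cases r j with
      | none => exact le_rfl
      | some v => exact mul_nonneg (h0 v) ((hq b).1 v)
    · simp only [q']
      rw [hr', show ∑ v, l' v * q b v = ∑ v, q b v from hc' (Sum.inl b), (hq b).2]
  refine ⟨q', fun a j => (r j).elim y₀ (xhat a), hq', ?_, ?_, ?_⟩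
  · rw [condEntropy_jointLaw hp (fun b => (hq' b).1), condEntropy_jointLaw hp (fun b => (hq b).1)]
    refine Eq.trans ?_ ((hr' _).trans (hc' (Sum.inr true)))
    refine Finset.sum_congr rfl fun j _ => ?_
    simp only [q', c, Sum.elim_inr, if_true]
    cases r j with
    | none => exact colH0
    | some v => exact columnEntropy_smul p _ _
  · rw [condMutualInfo_jointLaw hp hq', condMutualInfo_jointLaw hp hq]
    refine Eq.trans ?_ ((hr' _).trans (hc' (Sum.inr false)))
    refine Finset.sum_congr rfl fun j _ => ?_
    simp only [q', c, Sum.elim_inr]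
    cases r j with
    | none => exact colI0
    | some v => exact columnInfo_smul p _ _
  · rw [sum_jointLaw_mul p q (fun a b v => d b (xhat a v)),
      sum_jointLaw_mul p q' (fun a b j => d b ((r j).elim y₀ (xhat a)))]
    refine le_of_eq_of_le (Eq.trans ?_ (hr' e)) he'
    refine Finset.sum_congr rfl fun j _ => ?_
    simp only [q', e]
    cases r j with
    | none => simp
    | some v =>
      simp only [Option.elim_some, Finset.mul_sum]
      exact Finset.sum_congr rfl fun a _ => Finset.sum_congr rfl fun b _ => by ring

/-- The conditions defining `rateRegion` are closed: they hold exactly as soon as they hold up to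
every positive slack. -/
theorem exists_channel_of_forall_slack [Finite Y] [Nonempty X₂] {p : X₁ × X₂ → ℝ}
    (hp : ∀ x, 0 ≤ p x) (d : X₂ → Y → ℝ) (K : ℕ) (r₁ r₂ r₃ D : ℝ)
    (h : ∀ ε : ℝ, 0 < ε → ∃ (q : X₂ → Fin K → ℝ) (xhat : X₁ → Fin K → Y),
      (∀ b, q b ∈ stdSimplex ℝ (Fin K)) ∧
      condEntropy (jointLaw p q) (fun ω => ω.1) (fun ω => ω.2.2) ≤ r₁ + ε ∧
      condMutualInfo (jointLaw p q) (fun ω => ω.2.2) (fun ω => ω.2.1) (fun ω => ω.1) ≤ r₂ + ε ∧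
      entropy p Prod.fst +
        condMutualInfo (jointLaw p q) (fun ω => ω.2.2) (fun ω => ω.2.1) (fun ω => ω.1) ≤ r₃ + ε ∧
      ∑ ω, jointLaw p q ω * d ω.2.1 (xhat ω.1 ω.2.2) ≤ D + ε) :
    ∃ (q : X₂ → Fin K → ℝ) (xhat : X₁ → Fin K → Y),
      (∀ b, q b ∈ stdSimplex ℝ (Fin K)) ∧
      condEntropy (jointLaw p q) (fun ω => ω.1) (fun ω => ω.2.2) ≤ r₁ ∧
      condMutualInfo (jointLaw p q) (fun ω => ω.2.2) (fun ω => ω.2.1) (fun ω => ω.1) ≤ r₂ ∧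
      entropy p Prod.fst +
        condMutualInfo (jointLaw p q) (fun ω => ω.2.2) (fun ω => ω.2.1) (fun ω => ω.1) ≤ r₃ ∧
      ∑ ω, jointLaw p q ω * d ω.2.1 (xhat ω.1 ω.2.2) ≤ D := by
  classical
  let S : Set (X₂ → Fin K → ℝ) := {q | ∀ b, q b ∈ stdSimplex ℝ (Fin K)}
  have hS : IsCompact S := by
    have := isCompact_univ_pi (fun _ : X₂ => isCompact_stdSimplex ℝ (Fin K))
    convert this using 1
    ext q; simp [S]
  have hSn : S.Nonempty := by
    obtain ⟨q, _, hq, _⟩ := h 1 one_pos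
    exact ⟨q, hq⟩
  -- The largest of the four excesses: one continuous function of the channel whose sign decides all
  -- conditions at once.
  let g : (X₁ → Fin K → Y) → (X₂ → Fin K → ℝ) → ℝ := fun xhat q =>
    max (max (∑ v, columnEntropy p (fun b => q b v) - r₁) (∑ v, columnInfo p (fun b => q b v) - r₂))
      (max (entropy p Prod.fst + ∑ v, columnInfo p (fun b => q b v) - r₃)
        (∑ ω, jointLaw p q ω * d ω.2.1 (xhat ω.1 ω.2.2) - D))
  have hg : ∀ xhat, Continuous (g xhat) := fun xhat => by
    have h1 : ∀ v : Fin K, Continuous fun q : X₂ → Fin K → ℝ => columnEntropy p (fun b => q b v) :=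
      fun v => (continuous_columnEntropy p).comp (by fun_prop)
    have h2 : ∀ v : Fin K, Continuous fun q : X₂ → Fin K → ℝ => columnInfo p (fun b => q b v) :=
      fun v => (continuous_columnInfo p).comp (by fun_prop)
    simp only [g, jointLaw]
    fun_prop
  have hgiff : ∀ xhat, ∀ q ∈ S, ∀ ε, g xhat q ≤ ε ↔
      condEntropy (jointLaw p q) (fun ω => ω.1) (fun ω => ω.2.2) ≤ r₁ + ε ∧
      condMutualInfo (jointLaw p q) (fun ω => ω.2.2) (fun ω => ω.2.1) (fun ω => ω.1) ≤ r₂ + ε ∧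
      entropy p Prod.fst +
        condMutualInfo (jointLaw p q) (fun ω => ω.2.2) (fun ω => ω.2.1) (fun ω => ω.1) ≤ r₃ + ε ∧
      ∑ ω, jointLaw p q ω * d ω.2.1 (xhat ω.1 ω.2.2) ≤ D + ε := fun xhat q hq ε => by
    rw [condEntropy_jointLaw hp (fun b => (hq b).1), condMutualInfo_jointLaw hp hq]
    simp only [g, max_le_iff, sub_le_iff_le_add']
    tauto
  by_contra hcon
  have hmin : ∀ xhat, ∃ m : ℝ, 0 < m ∧ ∀ q ∈ S, m ≤ g xhat q := fun xhat => by
    obtain ⟨q, hq, hqm⟩ := hS.exists_isMinOn hSn (hg xhat).continuousOn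
    refine ⟨g xhat q, ?_, fun q' hq' => hqm hq'⟩
    by_contra hle
    have := (hgiff xhat q hq 0).1 (not_lt.1 hle)
    simp only [add_zero] at this
    exact hcon ⟨q, xhat, hq, this⟩
  choose m hm0 hm using hmin
  obtain ⟨_, xhat₀, _⟩ := h 1 one_pos
  have : Nonempty (X₁ → Fin K → Y) := ⟨xhat₀⟩
  -- There are finitely many estimators, so the minima over channels have a positive least value;
  -- half of it is a slack that no channel attains.
  obtain ⟨x₁, hx₁⟩ := Finite.exists_min m
  obtain ⟨q, xhat, hq, hle⟩ := h (m x₁ / 2) (half_pos (hm0 x₁))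
  have h1 := (hgiff xhat q hq _).2 hle
  have h2 := hm xhat q hq
  have h3 := hx₁ xhat
  have h4 := hm0 x₁
  linarith

end Region

/-! ### Chain rule over the letters of a block -/

section Chain

theorem law_congr {Ω α β : Type*} [Fintype Ω] [DecidableEq α] [DecidableEq β] (P : Ω → ℝ)
    (A : Ω → α) (B : Ω → β) (ω : Ω) (h : ∀ ω', A ω' = A ω ↔ B ω' = B ω) :
    law P A (A ω) = law P B (B ω) := by
  simp only [law, h]

theorem eq_iff_removeNth {α : Type*} {m : ℕ} (i : Fin (m + 1)) (x y : Fin (m + 1) → α) :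
    x = y ↔ x i = y i ∧ i.removeNth x = i.removeNth y := by
  constructor
  · rintro rfl; exact ⟨rfl, rfl⟩
  · rintro ⟨h1, h2⟩
    rw [← Fin.insertNth_self_removeNth i x, ← Fin.insertNth_self_removeNth i y, h1, h2]

/-- The entropy of a block is at least the sum of the entropies of its letters given all the other
letters. -/
theorem sum_condEntropy_removeNth_le {Ω α β : Type*} [Fintype Ω] [Fintype α] [DecidableEq α]
    [Fintype β] [DecidableEq β] {P : Ω → ℝ} (hP : ∀ ω, 0 ≤ P ω) {m : ℕ}
    (X : Ω → Fin (m + 1) → α) (F : Ω → β) :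
    ∑ i, condEntropy P (fun ω => X ω i) (fun ω => (F ω, i.removeNth (X ω))) ≤
      condEntropy P X F := by
  -- `T j` reveals `F` and the first `j` letters. Hiding the others behind `none` keeps one type for
  -- all `j`, so that the chain rule telescopes.
  let T : ℕ → Ω → β × (Fin (m + 1) → Option α) := fun j ω =>
    (F ω, fun k => if k.val < j then some (X ω k) else none)
  have hT : ∀ j ω ω', T j ω = T j ω' ↔ F ω = F ω' ∧ ∀ k : Fin (m + 1), k.val < j → X ω k = X ω' k := by
    intro j ω ω'
    simp only [T, Prod.mk.injEq, funext_iff]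
    refine and_congr_right fun _ => forall_congr' fun k => ?_
    split_ifs with h <;> simp [h]
  have step : ∀ i : Fin (m + 1),
      condEntropy P (fun ω => X ω i) (fun ω => (F ω, i.removeNth (X ω))) ≤
        condEntropy P (fun ω => X ω i) (T i.val) := by
    intro i
    -- All other letters determine the earlier ones, so conditioning on them gives less entropy.
    refine (condEntropy_le_comp hP _ _ (fun c : β × (Fin m → α) =>
      ((c.1, fun k => if h : k.val < i.val then some (c.2 ⟨k.val, by omega⟩) else none) :
        β × (Fin (m + 1) → Option α)))).trans_eq ?_
    congr 1
    funext ω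
    simp only [T, Prod.mk.injEq, true_and]
    funext k
    split_ifs with h
    · rw [Fin.removeNth, Fin.succAbove_of_castSucc_lt _ _ (show (Fin.castSucc ⟨k.val, by omega⟩ : Fin (m + 1)) < i from h)]
      rfl
    · rfl
  refine (Finset.sum_le_sum fun i _ => step i).trans_eq ?_
  simp only [condEntropy_eq_sum]
  rw [Finset.sum_comm]
  refine Finset.sum_congr rfl fun ω _ => ?_
  rw [← Finset.mul_sum]
  rcases (hP ω).eq_or_lt with h0 | h0
  · simp [← h0]
  congr 1
  have e1 : ∀ i : Fin (m + 1), -Real.logb 2 (law P (fun ω => (X ω i, T i.val ω)) (X ω i, T i.val ω) /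
      law P (T i.val) (T i.val ω)) = Real.logb 2 (law P (T i.val) (T i.val ω)) -
        Real.logb 2 (law P (T (i.val + 1)) (T (i.val + 1) ω)) := by
    intro i
    -- Letter `i` together with `T i` has the same fibres as `T (i + 1)`.
    rw [law_congr P (fun ω => (X ω i, T i.val ω)) (T (i.val + 1)) ω, Real.logb_div
      (law_pos hP _ h0).ne' (law_pos hP _ h0).ne']
    · ring
    · intro ω'
      rw [Prod.mk.injEq, hT, hT]
      constructor
      · rintro ⟨h1, h2, h3⟩
        refine ⟨h2, fun k hk => ?_⟩
        rcases Nat.lt_succ_iff_lt_or_eq.1 hk with h | h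
        · exact h3 k h
        · rwa [Fin.ext h]
      · rintro ⟨h2, h3⟩
        exact ⟨h3 i (Nat.lt_succ_self _), h2, fun k hk => h3 k (hk.trans (Nat.lt_succ_self _))⟩
  rw [Finset.sum_congr rfl fun i _ => e1 i,
    Fin.sum_univ_eq_sum_range (fun j => Real.logb 2 (law P (T j) (T j ω)) -
      Real.logb 2 (law P (T (j + 1)) (T (j + 1) ω))) (m + 1), Finset.sum_range_sub',
    law_congr P (T 0) F ω (fun ω' => by rw [hT]; simp),
    law_congr P (T (m + 1)) (fun ω => (X ω, F ω)) ω (fun ω' => by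
      rw [hT, Prod.mk.injEq, and_comm, funext_iff]
      refine and_congr_left fun _ => forall_congr' fun k => ?_
      simp [k.isLt]), Real.logb_div (law_pos hP (fun ω => (X ω, F ω)) h0).ne' (law_pos hP _ h0).ne']
  ring

end Chain

/-! ### Single-letterization of a block code -/

section Block

variable {X₁ X₂ Y 𝓜 : Type*} [Fintype X₁] [DecidableEq X₁] [Fintype X₂] [DecidableEq X₂]
  [Fintype 𝓜] [DecidableEq 𝓜]

/-- The law of a block of `n` source pairs, on pairs of sequences. -/
def blockLaw (p : X₁ × X₂ → ℝ) (n : ℕ) (ω : (Fin n → X₁) × (Fin n → X₂)) : ℝ := iidLaw p ω.1 ω.2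

theorem blockLaw_nonneg {p : X₁ × X₂ → ℝ} (hp : ∀ x, 0 ≤ p x) (n : ℕ)
    (ω : (Fin n → X₁) × (Fin n → X₂)) : 0 ≤ blockLaw p n ω := by
  rw [blockLaw, iidLaw]
  exact Finset.prod_nonneg fun _ _ => hp _

theorem sum_prod_apply {ι α : Type*} [Fintype ι] [DecidableEq ι] [Fintype α] (φ : ι → α → ℝ) :
    ∑ x : ι → α, ∏ k, φ k (x k) = ∏ k, ∑ a, φ k a := by
  rw [Finset.prod_univ_sum, Fintype.piFinset_univ]

theorem sum_iidLaw_right (p : X₁ × X₂ → ℝ) {n : ℕ} (x₁ : Fin n → X₁) :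
    ∑ x₂, iidLaw p x₁ x₂ = ∏ k, ∑ b, p (x₁ k, b) :=
  sum_prod_apply fun k b => p (x₁ k, b)

theorem sum_blockLaw {p : X₁ × X₂ → ℝ} (hp : ∑ x, p x = 1) (n : ℕ) :
    ∑ ω, blockLaw p n ω = 1 := by
  rw [Fintype.sum_prod_type]
  simp only [blockLaw, sum_iidLaw_right]
  rw [sum_prod_apply fun _ a => ∑ b, p (a, b), ← Fintype.sum_prod_type, hp]
  simp

theorem law_blockLaw_fst (p : X₁ × X₂ → ℝ) {n : ℕ} (x₁ : Fin n → X₁) :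
    law (blockLaw p n) Prod.fst x₁ = ∏ k, ∑ b, p (x₁ k, b) := by
  rw [← sum_iidLaw_right, law_eq_sum_ite, Fintype.sum_prod_type]
  simp only [mul_ite, mul_one, mul_zero]
  rw [Finset.sum_eq_single x₁ (by intro c _ h; simp [h]) (by simp)]
  simp [blockLaw]

theorem sum_insertNth {α : Type*} [Fintype α] {m : ℕ} (i : Fin (m + 1))
    (φ : (Fin (m + 1) → α) → ℝ) : ∑ x, φ x = ∑ a, ∑ z, φ (i.insertNth a z) := by
  rw [← (Fin.insertNthEquiv (fun _ => α) i).sum_comp, Fintype.sum_prod_type]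
  rfl

theorem iidLaw_insertNth (p : X₁ × X₂ → ℝ) {m : ℕ} (i : Fin (m + 1)) (a : X₁) (b : X₂)
    (z : Fin m → X₁) (y : Fin m → X₂) :
    iidLaw p (i.insertNth (α := fun _ => X₁) a z) (i.insertNth (α := fun _ => X₂) b y) =
      p (a, b) * iidLaw p z y := by
  simp [iidLaw, Fin.prod_univ_succAbove _ i]

/-- The channel from the letter `X₂ᵢ` to a description `F` of the whole second block together with
the first block without its letter `i`. -/
def letterChannel (p : X₁ × X₂ → ℝ) {m : ℕ} (F : (Fin (m + 1) → X₂) → 𝓜) (i : Fin (m + 1)) (b : X₂)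
    (v : 𝓜 × (Fin m → X₁)) : ℝ :=
  ∑ y, iidLaw p v.2 y * if F (i.insertNth (α := fun _ => X₂) b y) = v.1 then 1 else 0

theorem letterChannel_mem {p : X₁ × X₂ → ℝ} (hp : p ∈ stdSimplex ℝ (X₁ × X₂)) {m : ℕ}
    (F : (Fin (m + 1) → X₂) → 𝓜) (i : Fin (m + 1)) (b : X₂) :
    letterChannel p F i b ∈ stdSimplex ℝ (𝓜 × (Fin m → X₁)) := by
  refine ⟨fun v => Finset.sum_nonneg fun y _ => mul_nonneg (Finset.prod_nonneg fun _ _ => hp.1 _)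
    (by split_ifs <;> norm_num), ?_⟩
  refine Eq.trans ?_ (sum_blockLaw hp.2 m)
  simp only [letterChannel]
  rw [Fintype.sum_prod_type, Finset.sum_comm, Fintype.sum_prod_type]
  refine Finset.sum_congr rfl fun z _ => ?_
  rw [Finset.sum_comm]
  refine Finset.sum_congr rfl fun y _ => ?_
  simp [blockLaw]

/-- The letter pair at position `i` with the label produced by `letterChannel`. -/
def letterTriple {m : ℕ} (F : (Fin (m + 1) → X₂) → 𝓜) (i : Fin (m + 1))
    (ω : (Fin (m + 1) → X₁) × (Fin (m + 1) → X₂)) : X₁ × X₂ × 𝓜 × (Fin m → X₁) :=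
  (ω.1 i, ω.2 i, F ω.2, i.removeNth ω.1)

/-- Memorylessness: splitting off position `i` factors the block law. Given its own X₂ᵢ, the label
depends only on the other positions, which are independent of the pair at `i`; this is the Markov
chain X₁ᵢ → X₂ᵢ → V. -/
theorem law_letterTriple (p : X₁ × X₂ → ℝ) {m : ℕ} (F : (Fin (m + 1) → X₂) → 𝓜)
    (i : Fin (m + 1)) :
    law (blockLaw p (m + 1)) (letterTriple F i) = jointLaw p (letterChannel p F i) := by
  funext c
  obtain ⟨a, b, f, z⟩ := c
  rw [law_eq_sum_ite, Fintype.sum_prod_type, sum_insertNth i]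
  simp only [blockLaw, sum_insertNth (α := X₂) i, iidLaw_insertNth]
  simp only [letterTriple, Fin.insertNth_apply_same, Fin.removeNth_insertNth, Prod.mk.injEq,
    jointLaw, letterChannel, Finset.mul_sum]
  rw [Finset.sum_eq_single a (fun c _ h => by simp [h]) (by simp),
    Finset.sum_eq_single z (fun c _ h => by simp [h]) (by simp),
    Finset.sum_eq_single b (fun c _ h => by simp [h]) (by simp)]
  refine Finset.sum_congr rfl fun y _ => ?_
  simp

/-- By independence across positions, each summand is I(F;X₂ᵢ|X₁ⁿ), and these add up to at most
I(F;X₂ⁿ|X₁ⁿ), because the X₂ᵢ are independent given X₁ⁿ. Both facts are absorbed into one Gibbs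
inequality: the difference of the two sides is the expectation of log(R/P) for the law `R` below. -/
theorem sum_condMutualInfo_letterChannel_le {p : X₁ × X₂ → ℝ} (hp : p ∈ stdSimplex ℝ (X₁ × X₂))
    {m : ℕ} (F : (Fin (m + 1) → X₂) → 𝓜) :
    ∑ i, condMutualInfo (jointLaw p (letterChannel p F i)) (fun ω => ω.2.2) (fun ω => ω.2.1)
      (fun ω => ω.1) ≤
      condEntropy (blockLaw p (m + 1)) (fun ω => F ω.2) (fun ω => ω.1) := by
  set P := blockLaw p (m + 1) with hPdef
  have hP : ∀ ω, 0 ≤ P ω := blockLaw_nonneg hp.1 _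
  let B : 𝓜 × (Fin (m + 1) → X₁) → ℝ := law P (fun ω => (F ω.2, ω.1))
  let A : Fin (m + 1) → X₂ × 𝓜 × (Fin (m + 1) → X₁) → ℝ := fun i =>
    law P (fun ω => (ω.2 i, F ω.2, ω.1))
  have hB : ∀ c, 0 ≤ B c := law_nonneg hP _
  have hA : ∀ i c, 0 ≤ A i c := fun i => law_nonneg hP _
  have hAB : ∀ i c, ∑ b, A i (b, c) = B c := fun i c =>
    sum_law_pair_left P (fun ω => ω.2 i) (fun ω => (F ω.2, ω.1)) c
  -- The law that makes the letters of X₂ⁿ conditionally independent given (F, X₁ⁿ), keeping each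
  -- conditional marginal.
  let R : 𝓜 × (Fin (m + 1) → X₁) → (Fin (m + 1) → X₂) → ℝ := fun c x =>
    B c * ∏ i, (A i (x i, c) / B c)
  have hR : ∀ c x, 0 ≤ R c x := fun c x =>
    mul_nonneg (hB c) (Finset.prod_nonneg fun i _ => div_nonneg (hA _ _) (hB c))
  have hRsum : ∀ c, ∑ x, R c x ≤ B c := fun c => by
    simp only [R]
    rw [← Finset.mul_sum, sum_prod_apply fun i b => A i (b, c) / B c]
    refine mul_le_of_le_one_right (hB c) (Finset.prod_le_one (fun i _ => Finset.sum_nonneg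
      fun b _ => div_nonneg (hA _ _) (hB c)) fun i _ => ?_)
    rw [← Finset.sum_div, hAB]
    exact div_self_le_one _
  have hApos : ∀ i ω, 0 < P ω → 0 < A i (ω.2 i, F ω.2, ω.1) := fun i ω h =>
    law_pos hP (fun ω : (Fin (m + 1) → X₁) × (Fin (m + 1) → X₂) => (ω.2 i, F ω.2, ω.1)) h
  have hBpos : ∀ ω, 0 < P ω → 0 < B (F ω.2, ω.1) := fun ω h =>
    law_pos hP (fun ω : (Fin (m + 1) → X₁) × (Fin (m + 1) → X₂) => (F ω.2, ω.1)) h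
  have g := sum_mul_logb_div_nonpos (P := P) (Q := fun ω => R (F ω.2, ω.1) ω.2) hP
    (fun ω => hR _ _) (by
      -- `R` need not be carried by the pairs with f = F(x₂); its mass there is at most its total
      -- mass.
      calc ∑ ω : (Fin (m + 1) → X₁) × (Fin (m + 1) → X₂), R (F ω.2, ω.1) ω.2
          ≤ ∑ ω : (Fin (m + 1) → X₁) × (Fin (m + 1) → X₂), ∑ f, R (f, ω.1) ω.2 :=
            Finset.sum_le_sum fun ω _ => Finset.single_le_sum (f := fun f => R (f, ω.1) ω.2)
              (fun f _ => hR _ _) (Finset.mem_univ _)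
        _ = ∑ f, ∑ x₁, ∑ x₂, R (f, x₁) x₂ := by
            rw [Finset.sum_comm]
            exact Finset.sum_congr rfl fun f _ => Fintype.sum_prod_type _
        _ ≤ ∑ f, ∑ x₁, B (f, x₁) := Finset.sum_le_sum fun f _ => Finset.sum_le_sum fun x _ => hRsum _
        _ = ∑ ω, P ω := by rw [← Fintype.sum_prod_type, sum_law])
    (fun ω h => mul_pos (hBpos ω h) (Finset.prod_pos fun i _ =>
      div_pos (hApos i ω h) (hBpos ω h)))
  have e : ∀ i, condMutualInfo (jointLaw p (letterChannel p F i)) (fun ω => ω.2.2)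
      (fun ω => ω.2.1) (fun ω => ω.1) = ∑ ω, P ω * Real.logb 2 ((∑ b, p (ω.1 i, b)) *
        A i (ω.2 i, F ω.2, ω.1) / (B (F ω.2, ω.1) * p (ω.1 i, ω.2 i))) := by
    intro i
    rw [condMutualInfo_eq_sum]
    simp only [law_jointLaw_fst p (letterChannel_mem hp F i),
      law_jointLaw_snd_fst p (letterChannel_mem hp F i)]
    rw [← law_letterTriple]
    rw [sum_law_mul P (letterTriple F i) (fun c => Real.logb 2 ((∑ b, p (c.1, b)) *
      law (law P (letterTriple F i)) (fun ω => (ω.2.2, ω.2.1, ω.1)) (c.2.2, c.2.1, c.1) /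
      (law (law P (letterTriple F i)) (fun ω => (ω.2.2, ω.1)) (c.2.2, c.1) * p (c.1, c.2.1))))]
    refine Finset.sum_congr rfl fun ω _ => ?_
    rw [law_law, law_law]
    congr 3
    · congr 1
      exact law_congr P (fun ω => (((letterTriple F i ω).2.2, (letterTriple F i ω).2.1,
        (letterTriple F i ω).1))) (fun ω => (ω.2 i, F ω.2, ω.1)) ω fun ω' => by
          simp only [letterTriple, Prod.mk.injEq, eq_iff_removeNth i ω'.1 ω.1]
          tauto
    · congr 1
      exact law_congr P (fun ω => (((letterTriple F i ω).2.2, 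
        (letterTriple F i ω).1))) (fun ω => (F ω.2, ω.1)) ω fun ω' => by
          simp only [letterTriple, Prod.mk.injEq, eq_iff_removeNth i ω'.1 ω.1]
          tauto
  simp only [e]
  rw [Finset.sum_comm, condEntropy_eq_sum, ← sub_nonpos, ← Finset.sum_sub_distrib]
  refine le_of_eq_of_le (Finset.sum_congr rfl fun ω _ => ?_) g
  rcases (hP ω).eq_or_lt with h0 | h0
  · simp [← h0]
  rw [← Finset.mul_sum, ← mul_sub]
  congr 1
  have hprod : P ω = ∏ i, p (ω.1 i, ω.2 i) := rfl
  have hpi : ∀ i, 0 < p (ω.1 i, ω.2 i) := fun i => lt_of_le_of_ne (hp.1 _) fun h => by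
    rw [hprod, Finset.prod_eq_zero (Finset.mem_univ i) h.symm] at h0
    exact lt_irrefl _ h0
  have hsi : ∀ i, 0 < ∑ b, p (ω.1 i, b) := fun i => (hpi i).trans_le
    (Finset.single_le_sum (f := fun b => p (ω.1 i, b)) (fun b _ => hp.1 _) (Finset.mem_univ _))
  have hb := hBpos ω h0
  have ha := fun i => hApos i ω h0
  have e2 : ∀ i, Real.logb 2 ((∑ b, p (ω.1 i, b)) * A i (ω.2 i, F ω.2, ω.1) /
      (B (F ω.2, ω.1) * p (ω.1 i, ω.2 i))) = Real.logb 2 (∑ b, p (ω.1 i, b)) +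
        Real.logb 2 (A i (ω.2 i, F ω.2, ω.1) / B (F ω.2, ω.1)) -
        Real.logb 2 (p (ω.1 i, ω.2 i)) := fun i => by
    rw [Real.logb_div (mul_pos (hsi i) (ha i)).ne' (mul_pos hb (hpi i)).ne',
      Real.logb_mul (hsi i).ne' (ha i).ne', Real.logb_mul hb.ne' (hpi i).ne',
      Real.logb_div (ha i).ne' hb.ne']
    ring
  simp only [e2]
  have hfst : law P (fun ω => ω.1) ω.1 = ∏ i, ∑ b, p (ω.1 i, b) := law_blockLaw_fst p ω.1
  rw [hfst, Real.logb_div (hb.ne') (Finset.prod_pos fun i _ => hsi i).ne',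
    Real.logb_div (mul_pos hb (Finset.prod_pos fun i _ => div_pos (ha i) hb)).ne' h0.ne',
    Real.logb_mul hb.ne' (Finset.prod_pos fun i _ => div_pos (ha i) hb).ne', hprod,
    Real.logb_prod _ _ (fun i _ => (hsi i).ne'), Real.logb_prod _ _ (fun i _ => (hpi i).ne'),
    Real.logb_prod _ _ (fun i _ => (div_pos (ha i) hb).ne'), Finset.sum_sub_distrib,
    Finset.sum_add_distrib]
  ring

/-- Single-letterization of a block code in which the second block is described by `F` and the
decoder knows the first block. -/
theorem exists_single_letter {p : X₁ × X₂ → ℝ} (hp : p ∈ stdSimplex ℝ (X₁ × X₂)) {m : ℕ}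
    (F : (Fin (m + 1) → X₂) → 𝓜) (d : X₂ → Y → ℝ)
    (g : (Fin (m + 1) → X₁) → 𝓜 → Fin (m + 1) → Y) :
    ∃ (q : X₂ → Fin (m + 1) × 𝓜 × (Fin m → X₁) → ℝ)
      (xhat : X₁ → Fin (m + 1) × 𝓜 × (Fin m → X₁) → Y),
      (∀ b, q b ∈ stdSimplex ℝ _) ∧
      (m + 1 : ℝ) * condEntropy (jointLaw p q) (fun ω => ω.1) (fun ω => ω.2.2) ≤
        condEntropy (blockLaw p (m + 1)) (fun ω => ω.1) (fun ω => F ω.2) ∧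
      (m + 1 : ℝ) * condMutualInfo (jointLaw p q) (fun ω => ω.2.2) (fun ω => ω.2.1)
        (fun ω => ω.1) ≤ condEntropy (blockLaw p (m + 1)) (fun ω => F ω.2) (fun ω => ω.1) ∧
      ∑ ω, jointLaw p q ω * d ω.2.1 (xhat ω.1 ω.2.2) =
        ∑ ω, blockLaw p (m + 1) ω * blockDistortion d ω.2 (g ω.1 (F ω.2)) := by
  have hm : (m + 1 : ℝ) ≠ 0 := by positivity
  -- The label includes a uniform time index, whence the factor 1/(m+1).
  let q : X₂ → Fin (m + 1) × 𝓜 × (Fin m → X₁) → ℝ := fun b v =>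
    (m + 1 : ℝ)⁻¹ * letterChannel p F v.1 b v.2
  -- Inserting the current letter into the rest, which the label carries, restores the whole first
  -- block, so the block decoder can be run on single letters.
  let xhat : X₁ → Fin (m + 1) × 𝓜 × (Fin m → X₁) → Y := fun a v =>
    g (v.1.insertNth (α := fun _ => X₁) a v.2.2) v.2.1 v.1
  have hq : ∀ b, q b ∈ stdSimplex ℝ _ := fun b => by
    refine ⟨fun v => mul_nonneg (by positivity) ((letterChannel_mem hp F v.1 b).1 _), ?_⟩
    simp only [q]
    rw [← Finset.mul_sum, Fintype.sum_prod_type]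
    simp only [(letterChannel_mem hp F _ b).2]
    simp [hm]
  have hP := blockLaw_nonneg hp.1 (m + 1)
  refine ⟨q, xhat, hq, ?_, ?_, ?_⟩
  · rw [condEntropy_jointLaw hp.1 (fun b => (hq b).1), Fintype.sum_prod_type]
    simp only [q, columnEntropy_smul, ← Finset.mul_sum]
    rw [mul_inv_cancel_left₀ hm]
    refine le_of_eq_of_le ?_ (sum_condEntropy_removeNth_le hP (fun ω => ω.1) (fun ω => F ω.2))
    refine Finset.sum_congr rfl fun i _ => ?_
    rw [← condEntropy_jointLaw hp.1 (fun b => (letterChannel_mem hp F i b).1), ← law_letterTriple]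
    simp only [condEntropy, law_law]
    rfl
  · rw [condMutualInfo_jointLaw hp.1 hq, Fintype.sum_prod_type]
    simp only [q, columnInfo_smul, ← Finset.mul_sum]
    rw [mul_inv_cancel_left₀ hm]
    refine le_of_eq_of_le ?_ (sum_condMutualInfo_letterChannel_le hp F)
    refine Finset.sum_congr rfl fun i _ => ?_
    rw [← condMutualInfo_jointLaw hp.1 (letterChannel_mem hp F i)]
  · have h1 : ∀ i, ∑ ω, jointLaw p (letterChannel p F i) ω * d ω.2.1 (xhat ω.1 (i, ω.2.2)) =
        ∑ ω, blockLaw p (m + 1) ω * d (ω.2 i) (g ω.1 (F ω.2) i) := fun i => by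
      rw [← law_letterTriple]
      refine (sum_law_mul (blockLaw p (m + 1)) (letterTriple F i)
        (fun c => d c.2.1 (xhat c.1 (i, c.2.2)))).trans ?_
      refine Finset.sum_congr rfl fun ω _ => ?_
      simp only [letterTriple, xhat, Fin.insertNth_self_removeNth]
    rw [sum_jointLaw_mul p q (fun a b v => d b (xhat a v)), Fintype.sum_prod_type]
    simp only [blockDistortion, Finset.mul_sum]
    conv_rhs => rw [Finset.sum_comm]
    refine Finset.sum_congr rfl fun i _ => ?_
    calc _ = (m + 1 : ℝ)⁻¹ * ∑ v, ∑ a, ∑ b, p (a, b) * letterChannel p F i b v *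
            d b (xhat a (i, v)) := by
          simp only [Finset.mul_sum, q]
          refine Finset.sum_congr rfl fun v _ => Finset.sum_congr rfl fun a _ =>
            Finset.sum_congr rfl fun b _ => by ring
      _ = _ := by
          rw [← sum_jointLaw_mul p (letterChannel p F i) (fun a b v => d b (xhat a (i, v))), h1,
            Finset.mul_sum]
          refine Finset.sum_congr rfl fun ω _ => ?_
          push_cast
          ring

end Block

/-! ### Sums of independent variables under product laws -/

section Product

variable {Ω : Type*} [Fintype Ω]

theorem sum_prod_mul_sum {P : Ω → ℝ} (hP1 : ∑ ω, P ω = 1) {n : ℕ} (g : Fin n → Ω → ℝ) :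
    ∑ x : Fin n → Ω, (∏ k, P (x k)) * ∑ k, g k (x k) = ∑ k, ∑ ω, P ω * g k ω := by
  induction n with
  | zero => simp
  | succ n ih =>
    have h1 : ∑ z : Fin n → Ω, ∏ k, P (z k) = 1 := by
      rw [sum_prod_apply fun _ => P, hP1]; simp
    rw [sum_insertNth 0, Fin.sum_univ_succAbove _ 0]
    simp only [Fin.prod_univ_succAbove _ 0, Fin.sum_univ_succAbove _ 0, Fin.insertNth_apply_same,
      Fin.insertNth_apply_succAbove]
    rw [← ih fun k => g (Fin.succAbove 0 k)]
    calc ∑ a, ∑ z : Fin n → Ω, P a * (∏ k, P (z k)) * (g 0 a + ∑ k, g (Fin.succAbove 0 k) (z k))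
        = ∑ a, ((P a * g 0 a) * ∑ z : Fin n → Ω, ∏ k, P (z k)) + (∑ a, P a) *
          ∑ z : Fin n → Ω, (∏ k, P (z k)) * ∑ k, g (Fin.succAbove 0 k) (z k) := by
          rw [Finset.sum_mul, ← Finset.sum_add_distrib]
          refine Finset.sum_congr rfl fun a _ => ?_
          rw [Finset.mul_sum, Finset.mul_sum, ← Finset.sum_add_distrib]
          exact Finset.sum_congr rfl fun z _ => by ring
      _ = _ := by rw [h1, hP1]; simp

/-- The variance of a sum of independent centred random variables. -/
theorem sum_prod_mul_sq {P : Ω → ℝ} (hP1 : ∑ ω, P ω = 1) {n : ℕ} (g : Fin n → Ω → ℝ)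
    (hg : ∀ k, ∑ ω, P ω * g k ω = 0) :
    ∑ x : Fin n → Ω, (∏ k, P (x k)) * (∑ k, g k (x k)) ^ 2 = ∑ k, ∑ ω, P ω * g k ω ^ 2 := by
  induction n with
  | zero => simp
  | succ n ih =>
    have h1 : ∑ z : Fin n → Ω, ∏ k, P (z k) = 1 := by
      rw [sum_prod_apply fun _ => P, hP1]; simp
    have h2 := sum_prod_mul_sum hP1 fun k : Fin n => g (Fin.succAbove 0 k)
    simp only [hg, Finset.sum_const_zero] at h2
    rw [sum_insertNth 0, Fin.sum_univ_succAbove _ 0]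
    simp only [Fin.prod_univ_succAbove _ 0, Fin.sum_univ_succAbove _ 0, Fin.insertNth_apply_same,
      Fin.insertNth_apply_succAbove]
    rw [← ih (fun k => g (Fin.succAbove 0 k)) fun k => hg _]
    calc ∑ a, ∑ z : Fin n → Ω, P a * (∏ k, P (z k)) *
          (g 0 a + ∑ k, g (Fin.succAbove 0 k) (z k)) ^ 2
        = ∑ a, ((P a * g 0 a ^ 2) * ∑ z : Fin n → Ω, ∏ k, P (z k)) +
          2 * (∑ a, P a * g 0 a) *
          (∑ z : Fin n → Ω, (∏ k, P (z k)) * ∑ k, g (Fin.succAbove 0 k) (z k)) + (∑ a, P a) *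
          ∑ z : Fin n → Ω, (∏ k, P (z k)) * (∑ k, g (Fin.succAbove 0 k) (z k)) ^ 2 := by
          rw [Finset.sum_mul, Finset.mul_sum _ _ (2 : ℝ), Finset.sum_mul, ← Finset.sum_add_distrib,
            ← Finset.sum_add_distrib]
          refine Finset.sum_congr rfl fun a _ => ?_
          rw [Finset.mul_sum, Finset.mul_sum, Finset.mul_sum, ← Finset.sum_add_distrib,
            ← Finset.sum_add_distrib]
          exact Finset.sum_congr rfl fun z _ => by ring
      _ = _ := by rw [h1, hP1, hg]; simp

end Product

/-! ### Distortions of a system and the probability of non-edges -/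

section Systems

variable {X₁ X₂ Y : Type*} [Fintype X₁] [DecidableEq X₁] [Fintype X₂] [DecidableEq X₂]

theorem sum_blockLaw_mul (p : X₁ × X₂ → ℝ) (n : ℕ) (φ : (Fin n → X₁) → (Fin n → X₂) → ℝ) :
    ∑ ω, blockLaw p n ω * φ ω.1 ω.2 =
      ∑ x : Fin n → X₁ × X₂, (∏ k, p (x k)) * φ (fun k => (x k).1) (fun k => (x k).2) := by
  rw [← (Equiv.arrowProdEquivProdArrow (Fin n) (fun _ => X₁) (fun _ => X₂)).sum_comp]
  rfl

theorem hammingDistortion_nonneg {X : Type*} [DecidableEq X] (a b : X) :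
    0 ≤ hammingDistortion a b := by
  unfold hammingDistortion; split_ifs <;> norm_num

theorem blockDistortion_nonneg {X Z : Type*} {d : X → Z → ℝ} (hd : ∀ x y, 0 ≤ d x y) {n : ℕ}
    (x : Fin n → X) (y : Fin n → Z) : 0 ≤ blockDistortion d x y :=
  mul_nonneg (by positivity) (Finset.sum_nonneg fun _ _ => hd _ _)

namespace DSCSystem

variable {n Δ₁ Δ₂ : ℕ} {E : Finset (Fin Δ₁ × Fin Δ₂)}

/-- The decoder, extended by the fallback to pairs that are not edges. -/
def decode (S : DSCSystem X₁ X₂ Y n E) (u : Fin Δ₁) (v : Fin Δ₂) : (Fin n → X₁) × (Fin n → Y) :=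
  if h : (u, v) ∈ E then S.g ⟨(u, v), h⟩ else S.fallback

theorem reconstruct_eq (S : DSCSystem X₁ X₂ Y n E) (x₁ : Fin n → X₁) (x₂ : Fin n → X₂) :
    S.reconstruct x₁ x₂ = S.decode (S.f₁ x₁) (S.f₂ x₂) := rfl

theorem τ₁_eq (S : DSCSystem X₁ X₂ Y n E) (p : X₁ × X₂ → ℝ) :
    S.τ₁ p = ∑ ω, blockLaw p n ω *
      blockDistortion hammingDistortion ω.1 (S.reconstruct ω.1 ω.2).1 := by
  rw [τ₁, Fintype.sum_prod_type]; rfl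

theorem τ₂_eq (S : DSCSystem X₁ X₂ Y n E) (p : X₁ × X₂ → ℝ) (d : X₂ → Y → ℝ) :
    S.τ₂ p d = ∑ ω, blockLaw p n ω * blockDistortion d ω.2 (S.reconstruct ω.1 ω.2).2 := by
  rw [τ₂, Fintype.sum_prod_type]; rfl

/-- The probability that the encoder outputs do not form an edge. -/
def nonEdgeProb (S : DSCSystem X₁ X₂ Y n E) (p : X₁ × X₂ → ℝ) : ℝ :=
  ∑ ω, blockLaw p n ω * if (S.f₁ ω.1, S.f₂ ω.2) ∈ E then 0 else 1

/-- If no letter has probability more than `1 - η`, a fixed reconstruction is far from the first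
block, so that non-edges must be rare. -/
theorem nonEdgeProb_le (S : DSCSystem X₁ X₂ Y n E) {p : X₁ × X₂ → ℝ}
    (hp : p ∈ stdSimplex ℝ (X₁ × X₂)) (hn : 0 < n) {η : ℝ} (hη : 0 < η)
    (hη' : ∀ c, η ≤ ∑ x, p x * if x.1 = c then 0 else 1) :
    S.nonEdgeProb p ≤ 2 / η * S.τ₁ p + 4 / (n * η ^ 2) := by
  have hn' : (0 : ℝ) < n := by exact_mod_cast hn
  set c := S.fallback.1 with hc
  let μ : Fin n → ℝ := fun k => ∑ x, p x * if x.1 = c k then 0 else 1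
  have hμ1 : ∀ k, μ k ≤ 1 := fun k => by
    rw [← hp.2]
    refine Finset.sum_le_sum fun x _ => mul_le_of_le_one_right (hp.1 x) ?_
    split_ifs <;> norm_num
  let g : Fin n → X₁ × X₂ → ℝ := fun k x => (if x.1 = c k then 0 else 1) - μ k
  have hg0 : ∀ k, ∑ x, p x * g k x = 0 := fun k => by
    simp only [g, mul_sub, Finset.sum_sub_distrib, ← Finset.sum_mul, hp.2, one_mul]
    exact sub_self _
  have hg1 : ∀ k x, g k x ^ 2 ≤ 1 := fun k x => by
    have h0 := hη' (c k)
    have h1 := hμ1 k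
    have h2 : η ≤ μ k := h0
    simp only [g]
    split_ifs <;> nlinarith
  let Z : (Fin n → X₁) × (Fin n → X₂) → ℝ := fun ω => (∑ k, g k (ω.1 k, ω.2 k)) ^ 2
  have hZ : ∑ ω, blockLaw p n ω * Z ω ≤ n := by
    have h1 := sum_blockLaw_mul p n (fun x₁ x₂ => (∑ k, g k (x₁ k, x₂ k)) ^ 2)
    have h2 := sum_prod_mul_sq hp.2 g hg0
    rw [show ∑ ω, blockLaw p n ω * Z ω = _ from h1, h2]
    calc ∑ k : Fin n, ∑ ω, p ω * g k ω ^ 2 ≤ ∑ k : Fin n, (1 : ℝ) := by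
          refine Finset.sum_le_sum fun k _ => ?_
          rw [← hp.2]
          exact Finset.sum_le_sum fun x _ => mul_le_of_le_one_right (hp.1 x) (hg1 k x)
      _ = n := by simp
  -- On a non-edge the reconstruction is the fallback. Either its distortion is at least η/2, or the
  -- number of mismatches is below its mean by at least nη/2: Markov handles the first case,
  -- Chebyshev the second.
  have key : ∀ ω : (Fin n → X₁) × (Fin n → X₂),
      (if (S.f₁ ω.1, S.f₂ ω.2) ∈ E then (0 : ℝ) else 1) ≤
      2 / η * blockDistortion hammingDistortion ω.1 (S.reconstruct ω.1 ω.2).1 +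
        4 / (n ^ 2 * η ^ 2) * Z ω := by
    intro ω
    have hZ0 : 0 ≤ Z ω := sq_nonneg _
    have hB0 := blockDistortion_nonneg (fun a b : X₁ => hammingDistortion_nonneg a b) ω.1
      (S.reconstruct ω.1 ω.2).1
    split_ifs with h
    · positivity
    have hrec : (S.reconstruct ω.1 ω.2).1 = c := by rw [reconstruct, dif_neg h]
    rw [hrec] at hB0 ⊢
    set B := blockDistortion hammingDistortion ω.1 c with hB
    by_cases hBη : η / 2 ≤ B
    · have : 1 ≤ 2 / η * B := by
        rw [div_mul_eq_mul_div, le_div_iff₀ hη]; linarith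
      have h4 : 0 ≤ 4 / (n ^ 2 * η ^ 2) * Z ω := by positivity
      linarith
    · have hS : ∑ k, g k (ω.1 k, ω.2 k) = n * B - ∑ k, μ k := by
        rw [hB, blockDistortion, ← mul_assoc, mul_one_div_cancel hn'.ne', one_mul,
          ← Finset.sum_sub_distrib]
        rfl
      have hμs : n * η ≤ ∑ k, μ k := by
        calc (n : ℝ) * η = ∑ _k : Fin n, η := by simp
          _ ≤ _ := Finset.sum_le_sum fun k _ => hη' (c k)
      have hle : ∑ k, g k (ω.1 k, ω.2 k) ≤ -(n * η / 2) := by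
        rw [hS]; nlinarith
      have hZ' : (n * η / 2) ^ 2 ≤ Z ω := by
        have : 0 ≤ n * η / 2 := by positivity
        simp only [Z]
        nlinarith
      have : 1 ≤ 4 / (n ^ 2 * η ^ 2) * Z ω := by
        rw [div_mul_eq_mul_div, le_div_iff₀ (by positivity)]
        nlinarith
      have h5 : 0 ≤ 2 / η * B := by positivity
      linarith
  calc S.nonEdgeProb p ≤ ∑ ω, blockLaw p n ω *
        (2 / η * blockDistortion hammingDistortion ω.1 (S.reconstruct ω.1 ω.2).1 +
        4 / (n ^ 2 * η ^ 2) * Z ω) :=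
        Finset.sum_le_sum fun ω _ => mul_le_mul_of_nonneg_left (key ω) (blockLaw_nonneg hp.1 n ω)
    _ = 2 / η * S.τ₁ p + 4 / (n ^ 2 * η ^ 2) * ∑ ω, blockLaw p n ω * Z ω := by
        rw [τ₁_eq, Finset.mul_sum, Finset.mul_sum, ← Finset.sum_add_distrib]
        exact Finset.sum_congr rfl fun ω _ => by ring
    _ ≤ 2 / η * S.τ₁ p + 4 / (n ^ 2 * η ^ 2) * n := by gcongr
    _ = _ := by
        congr 1
        field_simp

end DSCSystem

/-! ### A test channel for blocks known up to Hamming distortion -/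

section Smoothing

/-- A product channel around a sequence that keeps each letter with probability about `1 - δ`. -/
def smoothing {X : Type*} [Fintype X] [DecidableEq X] (δ : ℝ) {n : ℕ} (x y : Fin n → X) : ℝ :=
  ∏ k, ((if x k = y k then 1 - δ else 0) + δ / Fintype.card X)

variable {X : Type*} [Fintype X] [DecidableEq X] {δ : ℝ} {n : ℕ}

theorem smoothing_nonneg (h0 : 0 < δ) (h1 : δ < 1) (x y : Fin n → X) : 0 ≤ smoothing δ x y := by
  refine Finset.prod_nonneg fun k _ => add_nonneg ?_ (by positivity)
  split_ifs <;> linarith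

theorem smoothing_pos (h0 : 0 < δ) (h1 : δ < 1) (x y : Fin n → X) : 0 < smoothing δ x y := by
  refine Finset.prod_pos fun k _ => add_pos_of_nonneg_of_pos ?_ ?_
  · split_ifs <;> linarith
  · have : 0 < Fintype.card X := Fintype.card_pos_iff.2 ⟨x k⟩
    positivity

theorem sum_smoothing [Nonempty X] (y : Fin n → X) : ∑ x, smoothing δ x y = 1 := by
  simp only [smoothing]
  rw [sum_prod_apply fun k a => (if a = y k then 1 - δ else 0) + δ / Fintype.card X]
  refine Finset.prod_eq_one fun k _ => ?_
  rw [Finset.sum_add_distrib]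
  have : (Fintype.card X : ℝ) ≠ 0 := by simp
  simp [mul_div_cancel₀ _ this]

/-- A correct letter costs at most −log(1−δ) bits and a wrong one at most log(|X|/δ). This plays the
part of Fano's inequality when only the average Hamming distortion is small. -/
theorem neg_logb_smoothing_le (h0 : 0 < δ) (h1 : δ < 1) (hn : 0 < n) (x y : Fin n → X) :
    -Real.logb 2 (smoothing δ x y) ≤ n * -Real.logb 2 (1 - δ) +
      n * blockDistortion hammingDistortion x y * Real.logb 2 (Fintype.card X / δ) := by
  have hn' : (n : ℝ) ≠ 0 := by exact_mod_cast hn.ne'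
  have hc : ∀ k : Fin n, (0 : ℝ) < Fintype.card X := fun k => by
    exact_mod_cast Fintype.card_pos_iff.2 ⟨x k⟩
  have hpos : ∀ k, 0 < (if x k = y k then 1 - δ else 0) + δ / Fintype.card X := fun k => by
    refine add_pos_of_nonneg_of_pos ?_ (div_pos h0 (hc k))
    split_ifs <;> linarith
  rw [smoothing, Real.logb_prod _ _ (fun k _ => (hpos k).ne'), ← Finset.sum_neg_distrib,
    blockDistortion, ← mul_assoc, mul_one_div_cancel hn', one_mul, Finset.sum_mul,
    show (n : ℝ) * -Real.logb 2 (1 - δ) = ∑ _k : Fin n, -Real.logb 2 (1 - δ) by simp,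
    ← Finset.sum_add_distrib]
  refine Finset.sum_le_sum fun k _ => ?_
  have hl : Real.logb 2 (1 - δ) ≤ 0 := Real.logb_nonpos (by norm_num) (by linarith) (by linarith)
  by_cases h : x k = y k
  · simp only [h, if_true, hammingDistortion, zero_mul, add_zero, neg_le_neg_iff]
    exact Real.logb_le_logb_of_le (by norm_num) (by linarith)
      (le_add_of_nonneg_right (div_pos h0 (hc k)).le)
  · simp only [h, if_false, hammingDistortion, zero_add, one_mul]
    rw [← Real.logb_inv, inv_div]
    linarith

end Smoothing
end Systems

/-! ### Degrees of nearly semi-regular graphs -/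

section Degrees

variable {Δ₁ Δ₂ : ℕ} {E : Finset (Fin Δ₁ × Fin Δ₂)} {Δ₁' Δ₂' μ : ℝ}

theorem sum_ite_mem_left (E : Finset (Fin Δ₁ × Fin Δ₂)) (u : Fin Δ₁) :
    ∑ v, (if (u, v) ∈ E then (1 : ℝ) else 0) = deg₁ E u := by
  simp [deg₁]

theorem sum_ite_mem_right (E : Finset (Fin Δ₁ × Fin Δ₂)) (v : Fin Δ₂) :
    ∑ u, (if (u, v) ∈ E then (1 : ℝ) else 0) = deg₂ E v := by
  simp [deg₂]

theorem IsNearlySemiRegular.one_le_deg₁ (hE : IsNearlySemiRegular E Δ₁' Δ₂' μ) (u : Fin Δ₁) :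
    (1 : ℝ) ≤ deg₁ E u := by
  have h : (0 : ℝ) < deg₁ E u := (mul_pos hE.pos₂ (inv_pos.2 (one_pos.trans hE.one_lt_slack))).trans_le
    (hE.degree₁ u).1
  exact_mod_cast h

theorem IsNearlySemiRegular.one_le_deg₂ (hE : IsNearlySemiRegular E Δ₁' Δ₂' μ) (v : Fin Δ₂) :
    (1 : ℝ) ≤ deg₂ E v := by
  have h : (0 : ℝ) < deg₂ E v := (mul_pos hE.pos₁ (inv_pos.2 (one_pos.trans hE.one_lt_slack))).trans_le
    (hE.degree₂ v).1
  exact_mod_cast h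

theorem sum_deg₁_eq_sum_deg₂ (E : Finset (Fin Δ₁ × Fin Δ₂)) :
    ∑ u, (deg₁ E u : ℝ) = ∑ v, (deg₂ E v : ℝ) := by
  simp only [← sum_ite_mem_left, ← sum_ite_mem_right]
  exact Finset.sum_comm

end Degrees

/-! ### Entropy bounds from the graph parameters -/

section Bounds

/-- A code length: one bit selects a half of the test law, log D an item in a list of size `D`, and
the remaining term refines that item. -/
theorem neg_logb_le_of_half_le {Q D W : ℝ} (hD : 0 < D) (hW : 0 < W) (h : 2⁻¹ * (D⁻¹ * W) ≤ Q) :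
    -Real.logb 2 Q ≤ 1 + Real.logb 2 D + -Real.logb 2 W := by
  have h1 := Real.logb_le_logb_of_le (b := 2) (by norm_num) (by positivity) h
  rw [Real.logb_mul (by norm_num) (by positivity), Real.logb_mul (by positivity) hW.ne',
    Real.logb_inv, Real.logb_inv, Real.logb_self_eq_one (by norm_num)] at h1
  linarith

variable {X₁ X₂ Y : Type*} [Fintype X₁] [DecidableEq X₁] [Fintype X₂] [DecidableEq X₂]
  {n Δ₁ Δ₂ : ℕ} {E : Finset (Fin Δ₁ × Fin Δ₂)} {Δ₁' Δ₂' μ : ℝ} {p : X₁ × X₂ → ℝ}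

namespace DSCSystem

theorem sum_blockLaw_mul_bound (S : DSCSystem X₁ X₂ Y n E) (hp : p ∈ stdSimplex ℝ (X₁ × X₂))
    (c l k : ℝ) :
    ∑ ω, blockLaw p n ω * (c + n * blockDistortion hammingDistortion ω.1
      (S.reconstruct ω.1 ω.2).1 * l + (if (S.f₁ ω.1, S.f₂ ω.2) ∈ E then 0 else 1) * k) =
      c + n * S.τ₁ p * l + S.nonEdgeProb p * k := by
  rw [τ₁_eq, nonEdgeProb, Finset.mul_sum, Finset.sum_mul, Finset.sum_mul]
  conv_rhs => rw [show c = ∑ ω, blockLaw p n ω * c by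
    rw [← Finset.sum_mul, sum_blockLaw hp.2 n, one_mul]]
  rw [← Finset.sum_add_distrib, ← Finset.sum_add_distrib]
  exact Finset.sum_congr rfl fun ω _ => by ring

/-- The test channel guesses a neighbour of `v` and smooths around the block decoded there; the
upper degree bound makes it a subchannel. The other half is smoothed around the fallback, so
non-edges cost nothing extra. -/
theorem condEntropy_fst_le [Nonempty X₁] (S : DSCSystem X₁ X₂ Y n E)
    (hE : IsNearlySemiRegular E Δ₁' Δ₂' μ) (hp : p ∈ stdSimplex ℝ (X₁ × X₂)) (hn : 0 < n) {δ : ℝ}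
    (h0 : 0 < δ) (h1 : δ < 1) :
    condEntropy (blockLaw p n) (fun ω => ω.1) (fun ω => S.f₂ ω.2) ≤
      1 + Real.logb 2 (Δ₁' * μ) + n * -Real.logb 2 (1 - δ) +
        n * S.τ₁ p * Real.logb 2 (Fintype.card X₁ / δ) := by
  have hD : 0 < Δ₁' * μ := mul_pos hE.pos₁ (one_pos.trans hE.one_lt_slack)
  let R : (Fin n → X₁) → Fin Δ₂ → ℝ := fun x v =>
    2⁻¹ * ((Δ₁' * μ)⁻¹ * ∑ u, (if (u, v) ∈ E then 1 else 0) * smoothing δ x (S.decode u v).1) +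
      2⁻¹ * smoothing δ x S.fallback.1
  have hW := fun x y : Fin n → X₁ => smoothing_nonneg h0 h1 x y
  have hs : ∀ x v, 0 ≤ ∑ u, (if (u, v) ∈ E then (1 : ℝ) else 0) *
      smoothing δ x (S.decode u v).1 := fun x v =>
    Finset.sum_nonneg fun u _ => mul_nonneg (by split_ifs <;> norm_num) (hW _ _)
  have hlow : ∀ ω : (Fin n → X₁) × (Fin n → X₂), 2⁻¹ * ((Δ₁' * μ)⁻¹ *
      smoothing δ ω.1 (S.reconstruct ω.1 ω.2).1) ≤ R ω.1 (S.f₂ ω.2) := by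
    intro ω
    have h1D : (1 : ℝ) ≤ Δ₁' * μ := (hE.one_le_deg₂ (S.f₂ ω.2)).trans (hE.degree₂ _).2
    by_cases h : (S.f₁ ω.1, S.f₂ ω.2) ∈ E
    · have : smoothing δ ω.1 (S.reconstruct ω.1 ω.2).1 ≤ ∑ u, (if (u, S.f₂ ω.2) ∈ E then (1 : ℝ)
          else 0) * smoothing δ ω.1 (S.decode u (S.f₂ ω.2)).1 := by
        refine le_of_eq_of_le ?_ (Finset.single_le_sum (f := fun u => (if (u, S.f₂ ω.2) ∈ E then
          (1 : ℝ) else 0) * smoothing δ ω.1 (S.decode u (S.f₂ ω.2)).1) (fun u _ =>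
            mul_nonneg (by split_ifs <;> norm_num) (hW _ _)) (Finset.mem_univ (S.f₁ ω.1)))
        simp [h, reconstruct_eq]
      refine (le_add_of_nonneg_right (mul_nonneg (by norm_num) (hW _ _))).trans' ?_
      gcongr
    · have hrec : S.reconstruct ω.1 ω.2 = S.fallback := by rw [reconstruct, dif_neg h]
      rw [hrec]
      refine (le_add_of_nonneg_left (mul_nonneg (by norm_num) (mul_nonneg (inv_nonneg.2 hD.le)
        (hs _ _)))).trans' ?_
      gcongr
      exact mul_le_of_le_one_left (hW _ _) (inv_le_one_of_one_le₀ h1D)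
  refine (condEntropy_le (blockLaw_nonneg hp.1 n) _ _ (Q := R) (fun x v => ?_) (fun v => ?_)
    (fun ω _ => ?_)).trans ?_
  · exact add_nonneg (mul_nonneg (by norm_num) (mul_nonneg (inv_nonneg.2 hD.le) (hs _ _)))
      (mul_nonneg (by norm_num) (hW _ _))
  · simp only [R]
    rw [Finset.sum_add_distrib, ← Finset.mul_sum, ← Finset.mul_sum, ← Finset.mul_sum, sum_smoothing,
      Finset.sum_comm]
    simp only [← Finset.mul_sum, sum_smoothing, mul_one, sum_ite_mem_right]
    have : (Δ₁' * μ)⁻¹ * deg₂ E v ≤ 1 := by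
      rw [inv_mul_le_iff₀ hD, mul_one]; exact (hE.degree₂ v).2
    linarith
  · exact (hlow ω).trans_lt' (by have := smoothing_pos h0 h1 ω.1 (S.reconstruct ω.1 ω.2).1; positivity)
  · have := sum_blockLaw_mul_bound S hp (1 + Real.logb 2 (Δ₁' * μ) + n * -Real.logb 2 (1 - δ))
      (Real.logb 2 (Fintype.card X₁ / δ)) 0
    rw [mul_zero, add_zero] at this
    rw [← this]
    refine Finset.sum_le_sum fun ω _ => mul_le_mul_of_nonneg_left ?_ (blockLaw_nonneg hp.1 n ω)
    have h2 := neg_logb_le_of_half_le hD (smoothing_pos h0 h1 _ _) (hlow ω)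
    have h3 := neg_logb_smoothing_le h0 h1 hn ω.1 (S.reconstruct ω.1 ω.2).1
    linarith

/-- Half of the test channel weights all neighbours of `f₁ x₁` equally, the other half is uniform on
all vertices; only non-edges pay the full log Δ₂. -/
theorem condEntropy_snd_le (S : DSCSystem X₁ X₂ Y n E)
    (hE : IsNearlySemiRegular E Δ₁' Δ₂' μ) (hp : p ∈ stdSimplex ℝ (X₁ × X₂)) :
    condEntropy (blockLaw p n) (fun ω => S.f₂ ω.2) (fun ω => ω.1) ≤
      1 + Real.logb 2 (Δ₂' * μ) + S.nonEdgeProb p * Real.logb 2 Δ₂ := by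
  have hD : 0 < Δ₂' * μ := mul_pos hE.pos₂ (one_pos.trans hE.one_lt_slack)
  let R : Fin Δ₂ → (Fin n → X₁) → ℝ := fun v x =>
    2⁻¹ * ((Δ₂' * μ)⁻¹ * if (S.f₁ x, v) ∈ E then 1 else 0) + 2⁻¹ * ((Δ₂ : ℝ)⁻¹ * 1)
  have hΔ : ∀ v : Fin Δ₂, (1 : ℝ) ≤ Δ₂ := fun v => by exact_mod_cast v.pos
  have hpos : ∀ v x, 0 < R v x := fun v x => by
    have := zero_lt_one.trans_le (hΔ v)
    exact add_pos_of_nonneg_of_pos (mul_nonneg (by norm_num) (mul_nonneg (inv_nonneg.2 hD.le)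
      (by split_ifs <;> norm_num))) (by positivity)
  refine (condEntropy_le (blockLaw_nonneg hp.1 n) _ _ (Q := R) (fun v x => (hpos v x).le)
    (fun x => ?_) (fun ω _ => hpos _ _)).trans ?_
  · simp only [R]
    rw [Finset.sum_add_distrib, ← Finset.mul_sum, ← Finset.mul_sum, sum_ite_mem_left]
    have h1 : (Δ₂' * μ)⁻¹ * deg₁ E (S.f₁ x) ≤ 1 := by
      rw [inv_mul_le_iff₀ hD, mul_one]; exact (hE.degree₁ _).2
    have h2 : ∑ _v : Fin Δ₂, 2⁻¹ * ((Δ₂ : ℝ)⁻¹ * 1) ≤ 2⁻¹ := by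
      rw [Finset.sum_const, Finset.card_univ, Fintype.card_fin, nsmul_eq_mul]
      calc (Δ₂ : ℝ) * (2⁻¹ * ((Δ₂ : ℝ)⁻¹ * 1)) = 2⁻¹ * (Δ₂ * (Δ₂ : ℝ)⁻¹) := by ring
        _ ≤ 2⁻¹ * 1 := by gcongr; exact mul_inv_le_one
        _ = 2⁻¹ := mul_one _
    linarith
  · have := sum_blockLaw_mul_bound S hp (1 + Real.logb 2 (Δ₂' * μ)) 0 (Real.logb 2 Δ₂)
    rw [mul_zero, add_zero] at this
    rw [← this]
    refine Finset.sum_le_sum fun ω _ => mul_le_mul_of_nonneg_left ?_ (blockLaw_nonneg hp.1 n ω)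
    have hΔ' := hΔ (S.f₂ ω.2)
    have h1D : (1 : ℝ) ≤ Δ₂' * μ := (hE.one_le_deg₁ (S.f₁ ω.1)).trans (hE.degree₁ _).2
    have hl1 : 0 ≤ Real.logb 2 (Δ₂' * μ) := Real.logb_nonneg (by norm_num) h1D
    by_cases h : (S.f₁ ω.1, S.f₂ ω.2) ∈ E
    · have := neg_logb_le_of_half_le (Q := R (S.f₂ ω.2) ω.1) hD one_pos (by
        simp only [R, h, if_true]
        exact le_add_of_nonneg_right (by positivity))
      simp only [Real.logb_one, neg_zero, add_zero] at this
      simpa [h] using this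
    · have := neg_logb_le_of_half_le (Q := R (S.f₂ ω.2) ω.1) (D := Δ₂) (by linarith) one_pos (by
        simp only [R, h, if_false]
        exact le_add_of_nonneg_left (by simp))
      simp only [Real.logb_one, neg_zero, add_zero] at this
      simp only [h, if_false]
      linarith

/-- One half of the test law weights all edges equally and smooths around the decoded block; there
are at most Δ₁Δ₂'μ edges, and this count yields the sum-rate bound. The uniform half on all pairs
covers non-edges. -/
theorem entropy_pair_le [Nonempty X₁] (S : DSCSystem X₁ X₂ Y n E)
    (hE : IsNearlySemiRegular E Δ₁' Δ₂' μ) (hp : p ∈ stdSimplex ℝ (X₁ × X₂)) (hn : 0 < n)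
    (hΔ₁ : 0 < Δ₁) {δ : ℝ} (h0 : 0 < δ) (h1 : δ < 1) :
    entropy (blockLaw p n) (fun ω => (S.f₂ ω.2, ω.1)) ≤
      1 + Real.logb 2 (Δ₁ * (Δ₂' * μ)) + n * -Real.logb 2 (1 - δ) +
        n * S.τ₁ p * Real.logb 2 (Fintype.card X₁ / δ) +
        S.nonEdgeProb p * (Real.logb 2 Δ₂ + n * Real.logb 2 (Fintype.card X₁)) := by
  have hΔ₁' : (1 : ℝ) ≤ Δ₁ := by exact_mod_cast hΔ₁
  have hD' : 0 < Δ₂' * μ := mul_pos hE.pos₂ (one_pos.trans hE.one_lt_slack)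
  have hD : 0 < Δ₁ * (Δ₂' * μ) := mul_pos (by linarith) hD'
  have hc : (1 : ℝ) ≤ Fintype.card X₁ := by exact_mod_cast Fintype.card_pos
  have hcn : (0 : ℝ) < Fintype.card X₁ ^ n := by positivity
  let R : Fin Δ₂ × (Fin n → X₁) → ℝ := fun c =>
    2⁻¹ * ((Δ₁ * (Δ₂' * μ))⁻¹ * ∑ u, (if (u, c.1) ∈ E then 1 else 0) *
      smoothing δ c.2 (S.decode u c.1).1) +
      2⁻¹ * (((Δ₂ : ℝ) * Fintype.card X₁ ^ n)⁻¹ * 1)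
  have hW := fun x y : Fin n → X₁ => smoothing_nonneg h0 h1 x y
  have hs : ∀ c : Fin Δ₂ × (Fin n → X₁), 0 ≤ ∑ u, (if (u, c.1) ∈ E then (1 : ℝ) else 0) *
      smoothing δ c.2 (S.decode u c.1).1 := fun c =>
    Finset.sum_nonneg fun u _ => mul_nonneg (by split_ifs <;> norm_num) (hW _ _)
  have hΔ : ∀ v : Fin Δ₂, (1 : ℝ) ≤ Δ₂ := fun v => by exact_mod_cast v.pos
  have hpos : ∀ c, 0 < R c := fun c => by
    have := zero_lt_one.trans_le (hΔ c.1)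
    exact add_pos_of_nonneg_of_pos (mul_nonneg (by norm_num) (mul_nonneg (inv_nonneg.2 hD.le)
      (hs c))) (by positivity)
  refine (entropy_le (blockLaw_nonneg hp.1 n) (sum_blockLaw hp.2 n) _ (Q := R)
    (fun c => (hpos c).le) ?_ (fun ω _ => hpos _)).trans ?_
  · simp only [R]
    rw [Finset.sum_add_distrib, ← Finset.mul_sum, ← Finset.mul_sum, Fintype.sum_prod_type]
    have e1 : ∀ v, ∑ x : Fin n → X₁, ∑ u, (if (u, v) ∈ E then (1 : ℝ) else 0) *
        smoothing δ x (S.decode u v).1 = deg₂ E v := fun v => by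
      rw [Finset.sum_comm]
      simp only [← Finset.mul_sum, sum_smoothing, mul_one, sum_ite_mem_right]
    simp only [e1]
    rw [← sum_deg₁_eq_sum_deg₂]
    have h3 : ∑ u, (deg₁ E u : ℝ) ≤ Δ₁ * (Δ₂' * μ) := by
      calc ∑ u, (deg₁ E u : ℝ) ≤ ∑ _u : Fin Δ₁, Δ₂' * μ :=
            Finset.sum_le_sum fun u _ => (hE.degree₁ u).2
        _ = _ := by simp
    have h4 : (Δ₁ * (Δ₂' * μ))⁻¹ * ∑ u, (deg₁ E u : ℝ) ≤ 1 := by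
      rwa [inv_mul_le_iff₀ hD, mul_one]
    have h2 : ∑ _c : Fin Δ₂ × (Fin n → X₁), 2⁻¹ * (((Δ₂ : ℝ) * Fintype.card X₁ ^ n)⁻¹ * 1) ≤
        2⁻¹ := by
      rw [Finset.sum_const, Finset.card_univ, nsmul_eq_mul]
      have : ((Fintype.card (Fin Δ₂ × (Fin n → X₁)) : ℕ) : ℝ) = (Δ₂ : ℝ) * Fintype.card X₁ ^ n := by
        simp
      rw [this, mul_one]
      calc (Δ₂ : ℝ) * Fintype.card X₁ ^ n * (2⁻¹ * ((Δ₂ : ℝ) * Fintype.card X₁ ^ n)⁻¹) =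
            2⁻¹ * (((Δ₂ : ℝ) * Fintype.card X₁ ^ n) * ((Δ₂ : ℝ) * Fintype.card X₁ ^ n)⁻¹) := by ring
        _ ≤ 2⁻¹ * 1 := by gcongr; exact mul_inv_le_one
        _ = 2⁻¹ := mul_one _
    linarith
  · have hsum := sum_blockLaw_mul_bound S hp
      (1 + Real.logb 2 (Δ₁ * (Δ₂' * μ)) + n * -Real.logb 2 (1 - δ))
      (Real.logb 2 (Fintype.card X₁ / δ)) (Real.logb 2 Δ₂ + n * Real.logb 2 (Fintype.card X₁))
    rw [← hsum]
    refine Finset.sum_le_sum fun ω _ => mul_le_mul_of_nonneg_left ?_ (blockLaw_nonneg hp.1 n ω)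
    have hΔ' := hΔ (S.f₂ ω.2)
    have h1D : (1 : ℝ) ≤ Δ₂' * μ := (hE.one_le_deg₁ (S.f₁ ω.1)).trans (hE.degree₁ _).2
    have hl1 : 0 ≤ Real.logb 2 (Δ₁ * (Δ₂' * μ)) :=
      Real.logb_nonneg (by norm_num) (one_le_mul_of_one_le_of_one_le hΔ₁' h1D)
    by_cases h : (S.f₁ ω.1, S.f₂ ω.2) ∈ E
    · have h2 := neg_logb_le_of_half_le (Q := R (S.f₂ ω.2, ω.1)) hD
        (smoothing_pos h0 h1 ω.1 (S.reconstruct ω.1 ω.2).1) (by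
          refine (le_add_of_nonneg_right (by positivity)).trans' ?_
          gcongr
          refine le_of_eq_of_le ?_ (Finset.single_le_sum (f := fun u => (if (u, S.f₂ ω.2) ∈ E then
            (1 : ℝ) else 0) * smoothing δ ω.1 (S.decode u (S.f₂ ω.2)).1) (fun u _ =>
              mul_nonneg (by split_ifs <;> norm_num) (hW _ _)) (Finset.mem_univ (S.f₁ ω.1)))
          simp [h, reconstruct_eq])
      have h3 := neg_logb_smoothing_le h0 h1 hn ω.1 (S.reconstruct ω.1 ω.2).1
      simp only [h, if_true, zero_mul, add_zero]
      linarith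
    · have h2 := neg_logb_le_of_half_le (Q := R (S.f₂ ω.2, ω.1)) 
        (D := Δ₂ * Fintype.card X₁ ^ n) (mul_pos (by linarith) hcn) one_pos
        (le_add_of_nonneg_left (mul_nonneg (by norm_num) (mul_nonneg (inv_nonneg.2 hD.le) (hs _))))
      rw [Real.logb_mul (by linarith) hcn.ne', Real.logb_pow, Real.logb_one] at h2
      have h3 : 0 ≤ (n : ℝ) * -Real.logb 2 (1 - δ) := mul_nonneg (by positivity)
        (neg_nonneg.2 (Real.logb_nonpos (by norm_num) (by linarith) (by linarith)))
      have h4 : 0 ≤ n * blockDistortion hammingDistortion ω.1 (S.reconstruct ω.1 ω.2).1 *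
          Real.logb 2 (Fintype.card X₁ / δ) := by
        refine mul_nonneg (mul_nonneg (by positivity) (blockDistortion_nonneg
          (fun a b : X₁ => hammingDistortion_nonneg a b) _ _)) (Real.logb_nonneg (by norm_num) ?_)
        rw [le_div_iff₀ h0]; linarith
      simp only [h, if_false]
      linarith

end DSCSystem

theorem entropy_blockLaw_fst {m : ℕ} (hp : p ∈ stdSimplex ℝ (X₁ × X₂)) :
    entropy (blockLaw p (m + 1)) (fun ω => ω.1) = (m + 1 : ℝ) * entropy p Prod.fst := by
  have hfst : ∀ a, law p Prod.fst a = ∑ b, p (a, b) := fun a => by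
    rw [law_eq_sum_ite, Fintype.sum_prod_type]
    simp only [mul_ite, mul_one, mul_zero]
    rw [Finset.sum_eq_single a (by intro c _ h; simp [h]) (by simp)]
    simp
  rw [entropy_eq_sum, entropy_eq_sum]
  have h1 : ∀ ω : (Fin (m + 1) → X₁) × (Fin (m + 1) → X₂), blockLaw p (m + 1) ω *
      -Real.logb 2 (law (blockLaw p (m + 1)) (fun ω => ω.1) ω.1) =
      blockLaw p (m + 1) ω * ∑ k, -Real.logb 2 (∑ b, p (ω.1 k, b)) := fun ω => by
    rcases (blockLaw_nonneg hp.1 (m + 1) ω).eq_or_lt with h0 | h0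
    · rw [← h0, zero_mul, zero_mul]
    have hprod : blockLaw p (m + 1) ω = ∏ i, p (ω.1 i, ω.2 i) := rfl
    have hsi : ∀ i, 0 < ∑ b, p (ω.1 i, b) := fun i => by
      have : 0 < p (ω.1 i, ω.2 i) := lt_of_le_of_ne (hp.1 _) fun h => by
        rw [hprod, Finset.prod_eq_zero (Finset.mem_univ i) h.symm] at h0
        exact lt_irrefl _ h0
      exact this.trans_le (Finset.single_le_sum (f := fun b => p (ω.1 i, b))
        (fun b _ => hp.1 _) (Finset.mem_univ _))
    have := law_blockLaw_fst p ω.1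
    rw [show law (blockLaw p (m + 1)) (fun ω => ω.1) ω.1 = _ from this,
      Real.logb_prod _ _ fun k _ => (hsi k).ne', Finset.sum_neg_distrib]
  rw [Finset.sum_congr rfl fun ω _ => h1 ω,
    sum_blockLaw_mul p (m + 1) (fun x _ => ∑ k, -Real.logb 2 (∑ b, p (x k, b))),
    sum_prod_mul_sum hp.2 fun (_ : Fin (m + 1)) (x : X₁ × X₂) => -Real.logb 2 (∑ b, p (x.1, b))]
  simp [hfst]

end Bounds

/-! ### Achievable graphical tuples lie in the single-letter region -/

section Converse

variable {X₁ X₂ Y : Type*} [Fintype X₁] [DecidableEq X₁] [Fintype X₂] [DecidableEq X₂]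
  {p : X₁ × X₂ → ℝ}

theorem exists_pos_of_mem_stdSimplex {ι : Type*} [Fintype ι] {p : ι → ℝ}
    (hp : p ∈ stdSimplex ℝ ι) : ∃ i, 0 < p i := by
  obtain ⟨i, _, hi⟩ := Finset.exists_ne_zero_of_sum_ne_zero (s := Finset.univ) (f := p)
    (by rw [hp.2]; exact one_ne_zero)
  exact ⟨i, lt_of_le_of_ne (hp.1 i) hi.symm⟩

/-- The sum-rate bound follows from the conditional one by the chain rule, because the entropy of
X₁ⁿ is exactly additive. -/
theorem exists_channel_of_code {𝓜 : Type*} [Fintype 𝓜] [DecidableEq 𝓜] [Nonempty Y]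
    (hp : p ∈ stdSimplex ℝ (X₁ × X₂)) {n : ℕ} (hn : 0 < n) (F : (Fin n → X₂) → 𝓜)
    (d : X₂ → Y → ℝ) (g : (Fin n → X₁) → 𝓜 → Fin n → Y) :
    ∃ (q : X₂ → Fin (Fintype.card X₂ + 2) → ℝ) (xhat : X₁ → Fin (Fintype.card X₂ + 2) → Y),
      (∀ b, q b ∈ stdSimplex ℝ _) ∧
      n * condEntropy (jointLaw p q) (fun ω => ω.1) (fun ω => ω.2.2) ≤
        condEntropy (blockLaw p n) (fun ω => ω.1) (fun ω => F ω.2) ∧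
      n * condMutualInfo (jointLaw p q) (fun ω => ω.2.2) (fun ω => ω.2.1)
        (fun ω => ω.1) ≤ condEntropy (blockLaw p n) (fun ω => F ω.2) (fun ω => ω.1) ∧
      n * entropy p Prod.fst + n * condMutualInfo (jointLaw p q) (fun ω => ω.2.2) (fun ω => ω.2.1)
        (fun ω => ω.1) ≤ entropy (blockLaw p n) (fun ω => (F ω.2, ω.1)) ∧
      ∑ ω, jointLaw p q ω * d ω.2.1 (xhat ω.1 ω.2.2) ≤
        ∑ ω, blockLaw p n ω * blockDistortion d ω.2 (g ω.1 (F ω.2)) := by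
  obtain ⟨m, rfl⟩ : ∃ m, n = m + 1 := ⟨n - 1, by omega⟩
  obtain ⟨q, xhat, hq, h1, h2, h3⟩ := exists_single_letter hp F d g
  obtain ⟨q', xhat', hq', k1, k2, k3⟩ := exists_channel_fin hp.1 hq d xhat
  refine ⟨q', xhat', hq', ?_, ?_, ?_, k3.trans h3.le⟩
  · rw [k1]; exact_mod_cast h1
  · rw [k2]; exact_mod_cast h2
  · rw [k2, entropy_pair (blockLaw_nonneg hp.1 _) (fun ω => F ω.2) (fun ω => ω.1),
      entropy_blockLaw_fst hp]
    push_cast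
    linarith

theorem exists_min_prob_ne [Nonempty X₁] (hp : ∀ x, 0 ≤ p x)
    (h : ¬∃ a₀, ∀ a b, 0 < p (a, b) → a = a₀) :
    ∃ η : ℝ, 0 < η ∧ ∀ c, η ≤ ∑ x, p x * if x.1 = c then 0 else 1 := by
  obtain ⟨c, hc⟩ := Finite.exists_min fun c => ∑ x, p x * if x.1 = c then 0 else 1
  refine ⟨_, ?_, hc⟩
  push Not at h
  obtain ⟨a, b, hab, hne⟩ := h c
  refine Finset.sum_pos' (fun x _ => mul_nonneg (hp x) (by split_ifs <;> norm_num))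
    ⟨(a, b), Finset.mem_univ _, ?_⟩
  simpa [hne] using hab

/-- Meant for a constant first source, where non-edges need not be rare. All non-neighbours of `u`
lead to the same fallback, so merging them into one symbol loses nothing and costs at most one extra
bit. -/
theorem condEntropy_neighbour_le {n Δ₁ Δ₂ : ℕ} {E : Finset (Fin Δ₁ × Fin Δ₂)}
    {Δ₁' Δ₂' μ : ℝ} (hE : IsNearlySemiRegular E Δ₁' Δ₂' μ) (hp : p ∈ stdSimplex ℝ (X₁ × X₂))
    (u : Fin Δ₁) (f : (Fin n → X₂) → Fin Δ₂) :
    condEntropy (blockLaw p n) (fun ω => if (u, f ω.2) ∈ E then some (f ω.2) else none)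
      (fun ω => ω.1) ≤ 1 + Real.logb 2 (Δ₂' * μ) := by
  have hD : 0 < Δ₂' * μ := mul_pos hE.pos₂ (one_pos.trans hE.one_lt_slack)
  have h1D : (1 : ℝ) ≤ Δ₂' * μ := (hE.one_le_deg₁ u).trans (hE.degree₁ u).2
  let R : Option (Fin Δ₂) → (Fin n → X₁) → ℝ := fun o _ =>
    o.elim 2⁻¹ (fun v => 2⁻¹ * ((Δ₂' * μ)⁻¹ * if (u, v) ∈ E then 1 else 0))
  have hlow : ∀ ω : (Fin n → X₁) × (Fin n → X₂), 2⁻¹ * ((Δ₂' * μ)⁻¹ * 1) ≤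
      R (if (u, f ω.2) ∈ E then some (f ω.2) else none) ω.1 := fun ω => by
    by_cases h : (u, f ω.2) ∈ E
    · simp [R, h]
    · simp only [h, if_false, R, Option.elim_none, mul_one]
      exact mul_le_of_le_one_right (by norm_num) (inv_le_one_of_one_le₀ h1D)
  refine (condEntropy_le (blockLaw_nonneg hp.1 n) _ _ (Q := R) (fun o x => ?_) (fun x => ?_)
    (fun ω _ => (hlow ω).trans_lt' (by positivity))).trans ?_
  · cases o with
    | none => simp [R]
    | some v => exact mul_nonneg (by norm_num) (mul_nonneg (inv_nonneg.2 hD.le)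
        (by split_ifs <;> norm_num))
  · simp only [R]
    rw [Fintype.sum_option]
    simp only [Option.elim_none, Option.elim_some]
    rw [← Finset.mul_sum, ← Finset.mul_sum, sum_ite_mem_left]
    have h1 : (Δ₂' * μ)⁻¹ * deg₁ E u ≤ 1 := by
      rw [inv_mul_le_iff₀ hD, mul_one]; exact (hE.degree₁ _).2
    linarith
  · calc _ ≤ ∑ ω, blockLaw p n ω * (1 + Real.logb 2 (Δ₂' * μ)) := by
          refine Finset.sum_le_sum fun ω _ =>
            mul_le_mul_of_nonneg_left ?_ (blockLaw_nonneg hp.1 n ω)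
          have := neg_logb_le_of_half_le hD one_pos (hlow ω)
          simpa using this
      _ = _ := by rw [← Finset.sum_mul, sum_blockLaw hp.2, one_mul]

theorem blockLaw_pos_letter (hp : ∀ x, 0 ≤ p x) {n : ℕ} {ω : (Fin n → X₁) × (Fin n → X₂)}
    (h : 0 < blockLaw p n ω) (k : Fin n) : 0 < p (ω.1 k, ω.2 k) := by
  refine lt_of_le_of_ne (hp _) fun h0 => ?_
  have hprod : blockLaw p n ω = ∏ i, p (ω.1 i, ω.2 i) := rfl
  rw [hprod, Finset.prod_eq_zero (Finset.mem_univ k) h0.symm] at h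
  exact lt_irrefl _ h

/-- An achievable tuple satisfies the single-letter conditions up to any positive slack. -/
theorem Achievable.exists_channel {d : X₂ → Y → ℝ} {t : RateTuple} (ht : Achievable p d t)
    (hp : p ∈ stdSimplex ℝ (X₁ × X₂)) (hR₁ : 0 ≤ t.R₁) (hR₁' : 0 ≤ t.R₁') {ε₀ : ℝ}
    (hε₀ : 0 < ε₀) :
    ∃ (q : X₂ → Fin (Fintype.card X₂ + 2) → ℝ) (xhat : X₁ → Fin (Fintype.card X₂ + 2) → Y),
      (∀ b, q b ∈ stdSimplex ℝ _) ∧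
      condEntropy (jointLaw p q) (fun ω => ω.1) (fun ω => ω.2.2) ≤ t.R₁' + ε₀ ∧
      condMutualInfo (jointLaw p q) (fun ω => ω.2.2) (fun ω => ω.2.1) (fun ω => ω.1) ≤
        t.R₂' + ε₀ ∧
      entropy p Prod.fst +
        condMutualInfo (jointLaw p q) (fun ω => ω.2.2) (fun ω => ω.2.1) (fun ω => ω.1) ≤
          t.R₁ + t.R₂' + ε₀ ∧
      ∑ ω, jointLaw p q ω * d ω.2.1 (xhat ω.1 ω.2.2) ≤ t.D + ε₀ := by
  obtain ⟨⟨x₁, x₂⟩, _⟩ := exists_pos_of_mem_stdSimplex hp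
  have : Nonempty X₁ := ⟨x₁⟩
  have hP := fun n => blockLaw_nonneg (X₁ := X₁) hp.1 n
  by_cases hconst : ∃ a₀, ∀ a b, 0 < p (a, b) → a = a₀
  · obtain ⟨a₀, ha₀⟩ := hconst
    obtain ⟨N, hN⟩ := ht (ε₀ / 4) (by linarith)
    obtain ⟨n, hnN, hn0, hn1⟩ : ∃ n : ℕ, N ≤ n ∧ 0 < n ∧ 1 / (n : ℝ) ≤ ε₀ / 4 := by
      obtain ⟨k, hk⟩ := exists_nat_gt (4 / ε₀)
      have hk0 : (0 : ℝ) < k := (by positivity : (0 : ℝ) < 4 / ε₀).trans hk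
      refine ⟨max N k, le_max_left _ _, ?_, ?_⟩
      · exact (by exact_mod_cast hk0 : 0 < k).trans_le (le_max_right _ _)
      · have : (k : ℝ) ≤ (max N k : ℕ) := by exact_mod_cast le_max_right _ _
        rw [div_le_iff₀ (hk0.trans_le this)]
        rw [div_lt_iff₀ hε₀] at hk
        nlinarith
    obtain ⟨Δ₁, Δ₂, Δ₁', Δ₂', μ, E, S, hE, -, -, -, h2', hμ, -, hτ⟩ := hN n hnN
    have hn : (0 : ℝ) < n := by exact_mod_cast hn0
    have : Nonempty Y := ⟨S.fallback.2 ⟨0, hn0⟩⟩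
    -- The vertex that the first encoder sends almost surely.
    let u := S.f₁ fun _ => a₀
    let F : (Fin n → X₂) → Option (Fin Δ₂) := fun x₂ =>
      if (u, S.f₂ x₂) ∈ E then some (S.f₂ x₂) else none
    let g : (Fin n → X₁) → Option (Fin Δ₂) → Fin n → Y := fun _ o =>
      o.elim S.fallback.2 (fun v => (S.decode u v).2)
    obtain ⟨q, xhat, hq, -, k2, -, k4⟩ := exists_channel_of_code hp hn0 F d g
    have hA : ∀ a b, a ≠ a₀ → p (a, b) = 0 := fun a b h => by
      by_contra h0
      exact h (ha₀ a b (lt_of_le_of_ne (hp.1 _) (Ne.symm h0)))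
    have hJ : ∀ ω, 0 ≤ jointLaw p q ω := fun ω => mul_nonneg (hp.1 _) ((hq _).1 _)
    have hH1 : condEntropy (jointLaw p q) (fun ω => ω.1) (fun ω => ω.2.2) ≤ 0 := by
      refine (condEntropy_le hJ _ _ (Q := fun a _ => if a = a₀ then 1 else 0) (fun a _ => by
        split_ifs <;> norm_num) (fun _ => by simp) (fun ω hω => ?_)).trans_eq
        (Finset.sum_eq_zero fun ω _ => ?_)
      · have : ω.1 = a₀ := ha₀ _ ω.2.1 (pos_of_mul_pos_left hω ((hq _).1 _))
        simp [this]
      · by_cases h : ω.1 = a₀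
        · simp [h]
        · simp [jointLaw, hA _ _ h]
    have hH : entropy p Prod.fst ≤ 0 := by
      refine (entropy_le hp.1 hp.2 _ (Q := fun a => if a = a₀ then 1 else 0) (fun a => by
        split_ifs <;> norm_num) (by simp) (fun ω hω => ?_)).trans_eq
        (Finset.sum_eq_zero fun ω _ => ?_)
      · have : ω.1 = a₀ := ha₀ _ ω.2 hω
        simp [this]
      · by_cases h : ω.1 = a₀
        · simp [h]
        · rw [show p ω = 0 from hA _ _ h, zero_mul]
    have hI : condMutualInfo (jointLaw p q) (fun ω => ω.2.2) (fun ω => ω.2.1) (fun ω => ω.1) ≤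
        t.R₂' + ε₀ := by
      have h1 := k2.trans (condEntropy_neighbour_le hE hp u S.f₂)
      rw [Real.logb_mul hE.pos₂.ne' (one_pos.trans hE.one_lt_slack).ne', ← le_div_iff₀' hn] at h1
      refine h1.trans ?_
      have : (1 + (Real.logb 2 Δ₂' + Real.logb 2 μ)) / n = 1 / n + 1 / n * Real.logb 2 Δ₂' +
        1 / n * Real.logb 2 μ := by ring
      rw [this]
      linarith
    -- With H(X₁) = 0 the sum bound reduces to the bound on I(V;X₂|X₁), since R₁ ≥ 0.
    refine ⟨q, xhat, hq, by linarith, hI, by linarith, ?_⟩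
    refine k4.trans (le_trans (le_of_eq ?_) (hτ.trans (by linarith)))
    rw [DSCSystem.τ₂_eq]
    refine Finset.sum_congr rfl fun ω _ => ?_
    rcases (hP n ω).eq_or_lt with h0 | h0
    · rw [← h0, zero_mul, zero_mul]
    have hω : ω.1 = fun _ => a₀ := funext fun k => ha₀ _ _ (blockLaw_pos_letter hp.1 h0 k)
    congr 2
    rw [DSCSystem.reconstruct_eq, hω]
    by_cases h : (u, S.f₂ ω.2) ∈ E
    · simp only [F, g, h, if_true, Option.elim_some]
      rfl
    · simp only [F, g, h, if_false, Option.elim_none]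
      rw [DSCSystem.decode, dif_neg h]
  · obtain ⟨η, hη, hη'⟩ := exists_min_prob_ne hp.1 hconst
    obtain ⟨δ, hδ0, hδ1, hδ⟩ : ∃ δ : ℝ, 0 < δ ∧ δ < 1 ∧ -Real.logb 2 (1 - δ) = ε₀ / 8 := by
      refine ⟨1 - (2 : ℝ) ^ (-(ε₀ / 8)), ?_, ?_, ?_⟩
      · have : (2 : ℝ) ^ (-(ε₀ / 8)) < 1 := Real.rpow_lt_one_of_one_lt_of_neg (by norm_num)
          (by linarith)
        linarith
      · have : 0 < (2 : ℝ) ^ (-(ε₀ / 8)) := by positivity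
        linarith
      · rw [sub_sub_cancel, Real.logb_rpow (by norm_num) (by norm_num), neg_neg]
    have hcard : (1 : ℝ) ≤ Fintype.card X₁ := by exact_mod_cast Fintype.card_pos
    set l := Real.logb 2 (Fintype.card X₁ / δ) with hl
    have hl0 : 0 ≤ l := Real.logb_nonneg (by norm_num) (by rw [le_div_iff₀ hδ0]; linarith)
    -- Bounds the cost per letter of a non-edge: (1/n) log Δ₂ < R₂ + ε with ε ≤ 1, plus log |X₁| for
    -- the block.
    set C := |t.R₂| + 1 + Real.logb 2 (Fintype.card X₁) with hC
    have hlc : 0 ≤ Real.logb 2 (Fintype.card X₁) := Real.logb_nonneg (by norm_num) hcard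
    have hC0 : 0 < C := by positivity
    -- `ε` absorbs the rate and slack margins, the smoothing term `ε * l`, and the Markov part of
    -- the non-edge probability; the Chebyshev part is left to the choice of `n`.
    obtain ⟨ε, hε0, hε1, hεb⟩ : ∃ ε : ℝ, 0 < ε ∧ ε ≤ 1 ∧ ε * (3 + l + 2 / η * C) ≤ ε₀ / 8 := by
      have hpos : 0 < 3 + l + 2 / η * C := by positivity
      refine ⟨min 1 (ε₀ / 8 / (3 + l + 2 / η * C)), lt_min one_pos (by positivity),
        min_le_left _ _, ?_⟩
      rw [← le_div_iff₀ hpos]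
      exact min_le_right _ _
    obtain ⟨N, hN⟩ := ht ε hε0
    obtain ⟨n, hnN, hn0, hn1⟩ : ∃ n : ℕ, N ≤ n ∧ 0 < n ∧
        1 / (n : ℝ) * (1 + 4 / η ^ 2 * C) ≤ ε₀ / 8 := by
      have hpos : 0 < 1 + 4 / η ^ 2 * C := by positivity
      obtain ⟨k, hk⟩ := exists_nat_gt ((1 + 4 / η ^ 2 * C) / (ε₀ / 8))
      have hk0 : (0 : ℝ) < k := (by positivity : (0 : ℝ) < _).trans hk
      refine ⟨max N k, le_max_left _ _, ?_, ?_⟩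
      · exact (by exact_mod_cast hk0 : 0 < k).trans_le (le_max_right _ _)
      · have : (k : ℝ) ≤ (max N k : ℕ) := by exact_mod_cast le_max_right _ _
        rw [div_mul_eq_mul_div, one_mul, div_le_iff₀ (hk0.trans_le this)]
        rw [div_lt_iff₀ (by linarith)] at hk
        nlinarith
    obtain ⟨Δ₁, Δ₂, Δ₁', Δ₂', μ, E, S, hE, h1, h2, h1', h2', hμ, hτ1, hτ⟩ := hN n hnN
    have hn : (0 : ℝ) < n := by exact_mod_cast hn0
    have hn' : (n : ℝ) ≠ 0 := hn.ne'
    have : Nonempty Y := ⟨S.fallback.2 ⟨0, hn0⟩⟩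
    have hΔ₁ : 0 < Δ₁ := (S.f₁ fun _ => x₁).pos
    have hΔ₂ : 0 < Δ₂ := (S.f₂ fun _ => x₂).pos
    have hμ0 : μ ≠ 0 := (one_pos.trans hE.one_lt_slack).ne'
    set π := S.nonEdgeProb p with hπ
    have hπ0 : 0 ≤ π := Finset.sum_nonneg fun ω _ => mul_nonneg (hP n ω)
      (by split_ifs <;> norm_num)
    have hτ0 : 0 ≤ S.τ₁ p := by
      rw [DSCSystem.τ₁_eq]
      exact Finset.sum_nonneg fun ω _ => mul_nonneg (hP n ω) (blockDistortion_nonneg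
        (fun a b : X₁ => hammingDistortion_nonneg a b) _ _)
    have hπle : π * C ≤ ε * (2 / η * C) + 1 / n * (4 / η ^ 2 * C) := by
      have hb := S.nonEdgeProb_le hp hn0 hη hη'
      have : 2 / η * S.τ₁ p ≤ 2 / η * ε := by gcongr
      calc π * C ≤ (2 / η * ε + 4 / (n * η ^ 2)) * C := by
            gcongr; linarith
        _ = _ := by field_simp
    have hτl : S.τ₁ p * l ≤ ε * l := by gcongr
    obtain ⟨q, xhat, hq, k1, k2, k3, k4⟩ := exists_channel_of_code hp hn0 S.f₂ d
      (fun x₁ v => (S.decode (S.f₁ x₁) v).2)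
    have b1 := k1.trans (S.condEntropy_fst_le hE hp hn0 hδ0 hδ1)
    have b2 := k2.trans (S.condEntropy_snd_le hE hp)
    have b3 := k3.trans (S.entropy_pair_le hE hp hn0 hΔ₁ hδ0 hδ1)
    have hlogΔ₂ : π * (1 / n * Real.logb 2 Δ₂ + Real.logb 2 (Fintype.card X₁)) ≤ π * C := by
      gcongr
      have := le_abs_self t.R₂
      rw [hC]; linarith
    have hlogΔ₂' : π * (1 / n * Real.logb 2 Δ₂) ≤ π * C := by
      refine hlogΔ₂.trans' ?_
      gcongr
      linarith
    rw [Real.logb_mul hE.pos₁.ne' hμ0, hδ, ← le_div_iff₀' hn] at b1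
    rw [Real.logb_mul hE.pos₂.ne' hμ0, ← le_div_iff₀' hn] at b2
    rw [Real.logb_mul (by exact_mod_cast hΔ₁.ne') (mul_pos hE.pos₂
      (one_pos.trans hE.one_lt_slack)).ne', Real.logb_mul hE.pos₂.ne' hμ0, hδ, ← mul_add,
      ← le_div_iff₀' hn] at b3
    have e1 : (1 + (Real.logb 2 Δ₁' + Real.logb 2 μ) + n * (ε₀ / 8) + n * S.τ₁ p * l) / n =
        1 / n + (1 / n * Real.logb 2 Δ₁' + 1 / n * Real.logb 2 μ) + ε₀ / 8 + S.τ₁ p * l := by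
      field_simp
    have e2 : (1 + (Real.logb 2 Δ₂' + Real.logb 2 μ) + π * Real.logb 2 Δ₂) / n =
        1 / n + (1 / n * Real.logb 2 Δ₂' + 1 / n * Real.logb 2 μ) +
          π * (1 / n * Real.logb 2 Δ₂) := by
      field_simp
    have e3 : (1 + (Real.logb 2 Δ₁ + (Real.logb 2 Δ₂' + Real.logb 2 μ)) + n * (ε₀ / 8) +
        n * S.τ₁ p * l + π * (Real.logb 2 Δ₂ + n * Real.logb 2 (Fintype.card X₁))) / n =
        1 / n + (1 / n * Real.logb 2 Δ₁ + 1 / n * Real.logb 2 Δ₂' + 1 / n * Real.logb 2 μ) +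
          ε₀ / 8 + S.τ₁ p * l +
          π * (1 / n * Real.logb 2 Δ₂ + Real.logb 2 (Fintype.card X₁)) := by
      field_simp
      ring
    rw [e1] at b1
    rw [e2] at b2
    rw [e3] at b3
    have hA0 : 0 ≤ ε * l := by positivity
    have hB0 : 0 ≤ ε * (2 / η * C) := by positivity
    have hD0 : 0 ≤ 1 / n * (4 / η ^ 2 * C) := by positivity
    have hE0 : 0 ≤ 1 / (n : ℝ) := by positivity
    have hεb' : 3 * ε + ε * l + ε * (2 / η * C) ≤ ε₀ / 8 := by
      refine le_of_eq_of_le ?_ hεb; ring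
    have hn1' : 1 / n + 1 / n * (4 / η ^ 2 * C) ≤ ε₀ / 8 := by
      refine le_of_eq_of_le ?_ hn1; ring
    refine ⟨q, xhat, hq, by linarith, by linarith, by linarith, ?_⟩
    refine k4.trans ?_
    rw [DSCSystem.τ₂_eq] at hτ
    exact hτ.trans (by linarith)

theorem mem_rateRegion_of_achievable [Fintype Y] {d : X₂ → Y → ℝ} {t : RateTuple}
    (hp : p ∈ stdSimplex ℝ (X₁ × X₂)) (ht : Achievable p d t) (hg : t.IsGraphical) :
    t ∈ rateRegion p d := by
  obtain ⟨⟨x₁, x₂⟩, _⟩ := exists_pos_of_mem_stdSimplex hp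
  have : Nonempty X₂ := ⟨x₂⟩
  obtain ⟨⟨g1, g2⟩, ⟨g3, g4⟩, g5⟩ := hg
  obtain ⟨q, xhat, hq, h1, h2, h3, h4⟩ := exists_channel_of_forall_slack hp.1 d
    (Fintype.card X₂ + 2) t.R₁' t.R₂' (t.R₁ + t.R₂') t.D
    fun ε hε => ht.exists_channel hp (g1.trans g2) g1 hε
  refine ⟨_, q, le_rfl, hq, ⟨xhat, h4⟩, ⟨g2, g1⟩, ⟨g4, g3⟩, h1, h2, g5, ?_⟩
  rwa [entropy_jointLaw_fst p hq]

end Converse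

/-! ### Exact achievability implies the graphical relations -/

section Exact

variable {X₁ X₂ Y : Type*} [Fintype X₁] [DecidableEq X₁] [Fintype X₂] [DecidableEq X₂]
  {p : X₁ × X₂ → ℝ} {d : X₂ → Y → ℝ} {t : RateTuple}

theorem ExactlyAchievable.achievable (h : ExactlyAchievable p d t) : Achievable p d t := by
  intro ε hε
  obtain ⟨N, hN⟩ := h ε hε
  refine ⟨N, fun n hn => ?_⟩
  obtain ⟨Δ₁, Δ₂, Δ₁', Δ₂', μ, E, S, hE, h1, h2, h3, h4, h5⟩ := hN n hn
  rw [abs_lt] at h1 h2 h3 h4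
  exact ⟨Δ₁, Δ₂, Δ₁', Δ₂', μ, E, S, hE, by linarith, by linarith, by linarith, by linarith, h5⟩

/-- Double counting of the edges; the discrepancy is a factor μ², which has vanishing exponent. -/
theorem IsNearlySemiRegular.mul_le_mul {Δ₁ Δ₂ : ℕ} {E : Finset (Fin Δ₁ × Fin Δ₂)} {Δ₁' Δ₂' μ : ℝ}
    (hE : IsNearlySemiRegular E Δ₁' Δ₂' μ) :
    Δ₁ * Δ₂' * μ⁻¹ ≤ Δ₂ * Δ₁' * μ ∧ Δ₂ * Δ₁' * μ⁻¹ ≤ Δ₁ * Δ₂' * μ := by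
  have a1 : Δ₁ * Δ₂' * μ⁻¹ ≤ ∑ u, (deg₁ E u : ℝ) := by
    calc Δ₁ * Δ₂' * μ⁻¹ = ∑ _u : Fin Δ₁, Δ₂' * μ⁻¹ := by simp [mul_assoc]
      _ ≤ _ := Finset.sum_le_sum fun u _ => (hE.degree₁ u).1
  have a2 : ∑ u, (deg₁ E u : ℝ) ≤ Δ₁ * Δ₂' * μ := by
    calc _ ≤ ∑ _u : Fin Δ₁, Δ₂' * μ := Finset.sum_le_sum fun u _ => (hE.degree₁ u).2
      _ = Δ₁ * Δ₂' * μ := by simp [mul_assoc]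
  have b1 : Δ₂ * Δ₁' * μ⁻¹ ≤ ∑ v, (deg₂ E v : ℝ) := by
    calc Δ₂ * Δ₁' * μ⁻¹ = ∑ _v : Fin Δ₂, Δ₁' * μ⁻¹ := by simp [mul_assoc]
      _ ≤ _ := Finset.sum_le_sum fun v _ => (hE.degree₂ v).1
  have b2 : ∑ v, (deg₂ E v : ℝ) ≤ Δ₂ * Δ₁' * μ := by
    calc _ ≤ ∑ _v : Fin Δ₂, Δ₁' * μ := Finset.sum_le_sum fun v _ => (hE.degree₂ v).2
      _ = Δ₂ * Δ₁' * μ := by simp [mul_assoc]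
  have e := sum_deg₁_eq_sum_deg₂ E
  constructor <;> linarith

theorem le_of_forall_pos_le_add_mul {a b c : ℝ} (h : ∀ ε : ℝ, 0 < ε → a ≤ b + c * ε) : a ≤ b := by
  refine le_of_forall_pos_le_add fun ε hε => ?_
  have hc : 0 < |c| + 1 := by positivity
  refine (h (ε / (|c| + 1)) (by positivity)).trans ?_
  have : c * (ε / (|c| + 1)) ≤ ε := by
    rw [mul_div_assoc', div_le_iff₀ hc]
    nlinarith [le_abs_self c]
  linarith

theorem ExactlyAchievable.isGraphical (hp : p ∈ stdSimplex ℝ (X₁ × X₂))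
    (h : ExactlyAchievable p d t) : t.IsGraphical := by
  obtain ⟨⟨x₁, x₂⟩, _⟩ := exists_pos_of_mem_stdSimplex hp
  have key : ∀ ε : ℝ, 0 < ε → (0 ≤ t.R₁' + 2 * ε ∧ t.R₁' ≤ t.R₁ + 3 * ε) ∧
      (0 ≤ t.R₂' + 2 * ε ∧ t.R₂' ≤ t.R₂ + 3 * ε) ∧
      t.R₁ + t.R₂' ≤ t.R₁' + t.R₂ + 6 * ε ∧ t.R₁' + t.R₂ ≤ t.R₁ + t.R₂' + 6 * ε := by
    intro ε hε
    obtain ⟨N, hN⟩ := h ε hε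
    -- The block length may be 0 here; then 1/n is 0 and the comparisons below stay valid.
    obtain ⟨Δ₁, Δ₂, Δ₁', Δ₂', μ, E, S, hE, h1, h2, h1', h2', hμ, -⟩ := hN _ le_rfl
    rw [abs_lt] at h1 h2 h1' h2'
    have hμ0 : 0 < μ := one_pos.trans hE.one_lt_slack
    let u := S.f₁ fun _ => x₁
    let v := S.f₂ fun _ => x₂
    have hΔ₁ : (0 : ℝ) < Δ₁ := by exact_mod_cast u.pos
    have hΔ₂ : (0 : ℝ) < Δ₂ := by exact_mod_cast v.pos
    have p1 := hE.pos₁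
    have p2 := hE.pos₂
    have du : (deg₁ E u : ℝ) ≤ Δ₂ := by
      have : deg₁ E u ≤ Δ₂ := (Finset.card_filter_le _ _).trans (by simp)
      exact_mod_cast this
    have dv : (deg₂ E v : ℝ) ≤ Δ₁ := by
      have : deg₂ E v ≤ Δ₁ := (Finset.card_filter_le _ _).trans (by simp)
      exact_mod_cast this
    have hn : (0 : ℝ) ≤ 1 / (N : ℝ) := by positivity
    have L : ∀ {x y : ℝ}, 0 < x → x ≤ y → 1 / (N : ℝ) * Real.logb 2 x ≤ 1 / (N : ℝ) * Real.logb 2 y :=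
      fun hx hxy => mul_le_mul_of_nonneg_left (Real.logb_le_logb_of_le (by norm_num) hx hxy) hn
    have a1 := L one_pos ((hE.one_le_deg₂ v).trans (hE.degree₂ v).2)
    have a2 := L one_pos ((hE.one_le_deg₁ u).trans (hE.degree₁ u).2)
    have a3 := L (by positivity) ((hE.degree₂ v).1.trans dv)
    have a4 := L (by positivity) ((hE.degree₁ u).1.trans du)
    have a5 := L (by positivity) hE.mul_le_mul.1
    have a6 := L (by positivity) hE.mul_le_mul.2
    simp (disch := positivity) only [Real.logb_mul, Real.logb_inv, Real.logb_one, mul_zero, mul_add,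
      mul_neg] at a1 a2 a3 a4 a5 a6
    refine ⟨⟨?_, ?_⟩, ⟨?_, ?_⟩, ?_, ?_⟩ <;> linarith
  refine ⟨⟨le_of_forall_pos_le_add_mul fun ε hε => (key ε hε).1.1,
    le_of_forall_pos_le_add_mul fun ε hε => (key ε hε).1.2⟩,
    ⟨le_of_forall_pos_le_add_mul fun ε hε => (key ε hε).2.1.1,
    le_of_forall_pos_le_add_mul fun ε hε => (key ε hε).2.1.2⟩,
    le_antisymm (le_of_forall_pos_le_add_mul fun ε hε => (key ε hε).2.2.1)
      (le_of_forall_pos_le_add_mul fun ε hε => (key ε hε).2.2.2)⟩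

end Exact

/-! ### Tools for random coding -/

section Averaging

theorem exists_le_of_weighted_sum_le {ι : Type*} [Fintype ι] {w f : ι → ℝ} (hw : ∀ i, 0 ≤ w i)
    (hw1 : ∑ i, w i = 1) {B : ℝ} (h : ∑ i, w i * f i ≤ B) : ∃ i, f i ≤ B := by
  by_contra! hcon
  obtain ⟨i, hi⟩ := exists_pos_of_mem_stdSimplex (p := w) ⟨hw, hw1⟩
  have : ∑ i, w i * B < ∑ i, w i * f i :=
    Finset.sum_lt_sum (fun j _ => mul_le_mul_of_nonneg_left (hcon j).le (hw j))
      ⟨i, Finset.mem_univ i, mul_lt_mul_of_pos_left (hcon i) hi⟩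
  rw [← Finset.sum_mul, hw1, one_mul] at this
  linarith

/-- First 1 − x ≤ e^{−x}, then convexity of the exponential between −z and 0. It bounds the chance
that none of `M` codewords is suitable when `x` is the chance of one under the codebook law and `y`
the chance under the true channel. -/
theorem one_sub_pow_le {x y z : ℝ} (M : ℕ) (hx1 : x ≤ 1) (hy0 : 0 ≤ y) (hy1 : y ≤ 1)
    (h : z * y ≤ M * x) : (1 - x) ^ M ≤ 1 - y + Real.exp (-z) := by
  have h1 : (1 - x) ^ M ≤ Real.exp (-(M * x)) := by
    calc (1 - x) ^ M ≤ Real.exp (-x) ^ M :=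
          pow_le_pow_left₀ (by linarith) (Real.one_sub_le_exp_neg x) M
      _ = Real.exp (-(M * x)) := by rw [← Real.exp_nat_mul]; ring_nf
  have h2 : Real.exp (-(M * x)) ≤ Real.exp (y * (-z) + (1 - y) * 0) :=
    Real.exp_le_exp.2 (by linarith)
  have h3 := convexOn_exp.2 (Set.mem_univ (-z)) (Set.mem_univ 0) hy0 (by linarith : 0 ≤ 1 - y)
    (by ring)
  simp only [smul_eq_mul, Real.exp_zero, mul_one] at h3
  have h4 : y * Real.exp (-z) ≤ Real.exp (-z) := mul_le_of_le_one_left (Real.exp_pos _).le hy1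
  linarith

theorem sum_mul_ite_le_one {ι : Type*} [Fintype ι] {R : ι → ℝ} (hR : R ∈ stdSimplex ℝ ι)
    (G : ι → Prop) [DecidablePred G] : ∑ v, R v * (if G v then 1 else 0) ≤ 1 :=
  (Finset.sum_le_sum fun v _ => mul_le_of_le_one_right (hR.1 v)
    (by split_ifs <;> norm_num)).trans_eq hR.2

theorem sum_mul_ite_compl {ι : Type*} [Fintype ι] {R : ι → ℝ} (hR : R ∈ stdSimplex ℝ ι)
    (G : ι → Prop) [DecidablePred G] :
    ∑ v, R v * (if G v then 0 else 1) = 1 - ∑ v, R v * (if G v then 1 else 0) := by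
  rw [eq_sub_iff_add_eq, ← Finset.sum_add_distrib]
  refine (Finset.sum_congr rfl fun v _ => ?_).trans hR.2
  split_ifs <;> simp

end Averaging

/-! ### Covering by a random codebook -/

section Covering

open Classical in
/-- One-shot covering with side constraints: a random codebook has an encoder `s` for which the
source letter `a`, correlated with `b` only, is jointly good with the chosen codeword, and for which
few codewords are compatible with `a`. -/
theorem exists_codebook {𝒜 ℬ 𝒱 : Type*} [Fintype 𝒜] [Fintype ℬ] [Fintype 𝒱]
    {P : 𝒜 → ℬ → ℝ} (hP : ∀ a b, 0 ≤ P a b) (hP1 : ∑ a, ∑ b, P a b = 1)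
    {Q : ℬ → 𝒱 → ℝ} (hQ : ∀ b, Q b ∈ stdSimplex ℝ 𝒱) {R : 𝒱 → ℝ} (hR : R ∈ stdSimplex ℝ 𝒱)
    (Bad : 𝒜 → ℬ → 𝒱 → Prop) (T : 𝒜 → 𝒱 → Prop) {Γ ε l κ L : ℝ} (hΓ : 0 < Γ) (hl0 : 0 < l)
    (hl1 : l < 1) (hL : 0 < L) {M : ℕ} (hM : 0 < M)
    (hgood : ∀ a b v, 0 < P a b → ¬Bad a b v → Q b v ≤ Γ * R v)
    (hbad : ∑ a, ∑ b, ∑ v, P a b * Q b v * (if Bad a b v then 1 else 0) ≤ ε)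
    (hT : ∀ a, ∑ v, R v * (if T a v then 1 else 0) ≤ κ) :
    ∃ (c : Fin M → 𝒱) (s : ℬ → Fin M),
      ∑ a, ∑ b, P a b * (if Bad a b (c (s b)) ∨
        L < (Finset.univ.filter fun j => T a (c j)).card then 1 else 0) ≤
        l + ε / l + Real.exp (-(M / Γ)) + M * κ / L := by
  let Pb : ℬ → ℝ := fun b => ∑ a, P a b
  have hPb : ∀ b, 0 ≤ Pb b := fun b => Finset.sum_nonneg fun a _ => hP a b
  have hPb1 : ∑ b, Pb b = 1 := by rw [← hP1, Finset.sum_comm]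
  let π : ℬ → 𝒱 → ℝ := fun b v => ∑ a, P a b * (if Bad a b v then 1 else 0)
  have hπ : ∀ b v, 0 ≤ π b v := fun b v => Finset.sum_nonneg fun a _ =>
    mul_nonneg (hP a b) (by split_ifs <;> norm_num)
  have hπP : ∀ b v, π b v ≤ Pb b := fun b v => Finset.sum_le_sum fun a _ =>
    mul_le_of_le_one_right (hP a b) (by split_ifs <;> norm_num)
  -- A codeword suits `b` if, given `b`, the triple is bad with probability at most `l`. The encoder
  -- sees only `b`, so this averaging over `a` stands in for a Markov lemma.
  obtain ⟨G, hGdef⟩ : ∃ G : ℬ → 𝒱 → Prop, ∀ b v, G b v ↔ π b v ≤ l * Pb b :=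
    ⟨_, fun _ _ => Iff.rfl⟩
  -- Since l < 1, a suitable pair has some `a` of positive probability that is not bad, and the
  -- density bound at this `a` does not involve `a`.
  have hG : ∀ b v, 0 < Pb b → G b v → Q b v ≤ Γ * R v := fun b v hb hG => by
    by_contra hcon
    have : π b v = Pb b := Finset.sum_congr rfl fun a _ => by
      rcases (hP a b).eq_or_lt with h | h
      · simp [← h]
      · have : Bad a b v := by
          by_contra hB
          exact hcon (hgood a b v h hB)
        simp [this]
    have h1 := (hGdef b v).1 hG
    nlinarith
  let w : (Fin M → 𝒱) → ℝ := fun c => ∏ j, R (c j)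
  have hw : ∀ c, 0 ≤ w c := fun c => Finset.prod_nonneg fun j _ => hR.1 _
  have hw1 : ∑ c, w c = 1 := by
    simp only [w]
    rw [sum_prod_apply fun (_ : Fin M) => R, hR.2]; simp
  let s : (Fin M → 𝒱) → ℬ → Fin M := fun c b =>
    if h : ∃ j, G b (c j) then h.choose else ⟨0, hM⟩
  let miss : (Fin M → 𝒱) → ℬ → ℝ := fun c b => if ∃ j, G b (c j) then 0 else 1
  let cnt : (Fin M → 𝒱) → 𝒜 → ℝ := fun c a => ∑ j, if T a (c j) then 1 else 0
  have hcnt0 : ∀ c a, 0 ≤ cnt c a := fun c a => Finset.sum_nonneg fun j _ => by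
    split_ifs <;> norm_num
  -- Probabilistic method: a bound on the average over codebooks drawn i.i.d. from `R` yields one
  -- codebook.
  suffices hsuff : ∑ c, w c * (∑ b, (l * Pb b + Pb b * miss c b) + (∑ a, (∑ b, P a b) * cnt c a) / L)
      ≤ l + ε / l + Real.exp (-(M / Γ)) + M * κ / L by
    obtain ⟨c, hc⟩ := exists_le_of_weighted_sum_le hw hw1 hsuff
    refine ⟨c, s c, le_trans ?_ hc⟩
    have hsplit : ∑ a, ∑ b, P a b * (if Bad a b (c (s c b)) ∨
        L < (Finset.univ.filter fun j => T a (c j)).card then (1 : ℝ) else 0) ≤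
        ∑ a, ∑ b, (P a b * (if Bad a b (c (s c b)) then 1 else 0) + P a b * (cnt c a / L)) := by
      refine Finset.sum_le_sum fun a _ => Finset.sum_le_sum fun b _ => ?_
      rw [← mul_add]
      refine mul_le_mul_of_nonneg_left ?_ (hP a b)
      have hc0 : 0 ≤ cnt c a / L := div_nonneg (hcnt0 c a) hL.le
      have hcard : ((Finset.univ.filter fun j => T a (c j)).card : ℝ) = cnt c a := by
        simp [cnt]
      by_cases h1 : Bad a b (c (s c b))
      · simp only [h1, true_or, if_true]; linarith
      · simp only [h1, false_or, if_false, zero_add]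
        split_ifs with h2
        · rw [hcard] at h2
          rw [le_div_iff₀ hL]; linarith
        · exact hc0
    refine hsplit.trans ?_
    simp only [Finset.sum_add_distrib]
    refine add_le_add ?_ (le_of_eq ?_)
    · rw [Finset.sum_comm, ← Finset.sum_add_distrib]
      refine Finset.sum_le_sum fun b _ => ?_
      change π b (c (s c b)) ≤ _
      by_cases h : ∃ j, G b (c j)
      · have h1 : G b (c (s c b)) := by
          simp only [s, dif_pos h]; exact h.choose_spec
        have h2 := (hGdef _ _).1 h1
        simpa [miss, h] using h2
      · have h1 := hπP b (c (s c b))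
        simp only [miss, h, if_false, mul_one]
        have := mul_nonneg hl0.le (hPb b)
        linarith
    · rw [Finset.sum_div]
      refine Finset.sum_congr rfl fun a _ => ?_
      rw [← Finset.sum_mul, mul_div_assoc]
  have hmiss : ∀ b, ∑ c, w c * miss c b = (1 - ∑ v, R v * (if G b v then 1 else 0)) ^ M := by
    intro b
    have e1 : ∀ c, w c * miss c b = ∏ j, (R (c j) * if G b (c j) then 0 else 1) := fun c => by
      rw [Finset.prod_mul_distrib]
      congr 1
      by_cases h : ∃ j, G b (c j)
      · obtain ⟨j, hj⟩ := h
        rw [Finset.prod_eq_zero (Finset.mem_univ j) (by simp [hj])]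
        have : ∃ j, G b (c j) := ⟨j, hj⟩
        simp [miss, this]
      · have h' : ∀ j, ¬G b (c j) := fun j hj => h ⟨j, hj⟩
        simp [miss, h']
    simp only [e1]
    rw [sum_prod_apply fun (_ : Fin M) v => R v * if G b v then 0 else 1]
    rw [Finset.prod_const, Finset.card_univ, Fintype.card_fin, sum_mul_ite_compl hR]
  have hmiss' : ∀ b, Pb b * (1 - ∑ v, R v * (if G b v then 1 else 0)) ^ M ≤
      Pb b * ∑ v, Q b v * (if G b v then 0 else 1) + Pb b * Real.exp (-(M / Γ)) := by
    intro b
    rcases (hPb b).eq_or_lt with h0 | h0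
    · simp [← h0]
    rw [← mul_add]
    refine mul_le_mul_of_nonneg_left ?_ h0.le
    rw [sum_mul_ite_compl (hQ b)]
    refine one_sub_pow_le M (sum_mul_ite_le_one hR _) (Finset.sum_nonneg fun v _ =>
      mul_nonneg ((hQ b).1 v) (by split_ifs <;> norm_num)) (sum_mul_ite_le_one (hQ b) _) ?_
    rw [div_mul_eq_mul_div, mul_div_assoc]
    refine mul_le_mul_of_nonneg_left ?_ (by positivity)
    rw [div_le_iff₀' hΓ, Finset.mul_sum]
    refine Finset.sum_le_sum fun v _ => ?_
    split_ifs with h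
    · simpa using hG b v h0 h
    · simp
  -- Markov's inequality for the conditional probability of being bad.
  have hout : ∑ b, Pb b * ∑ v, Q b v * (if G b v then 0 else 1) ≤ ε / l := by
    rw [le_div_iff₀' hl0]
    refine le_trans ?_ hbad
    have e2 : ∑ a, ∑ b, ∑ v, P a b * Q b v * (if Bad a b v then 1 else 0) =
        ∑ b, ∑ v, Q b v * π b v := by
      rw [Finset.sum_comm]
      refine Finset.sum_congr rfl fun b _ => ?_
      rw [Finset.sum_comm]
      refine Finset.sum_congr rfl fun v _ => ?_
      rw [Finset.mul_sum]
      exact Finset.sum_congr rfl fun a _ => by ring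
    rw [e2, Finset.mul_sum]
    refine Finset.sum_le_sum fun b _ => ?_
    rw [← mul_assoc, Finset.mul_sum]
    refine Finset.sum_le_sum fun v _ => ?_
    split_ifs with h
    · rw [mul_zero, mul_zero]; exact mul_nonneg ((hQ b).1 v) (hπ b v)
    · have : l * Pb b < π b v := not_le.1 fun h' => h ((hGdef _ _).2 h')
      have := mul_le_mul_of_nonneg_left this.le ((hQ b).1 v)
      linarith
  have hcntE : ∀ a, ∑ c, w c * cnt c a ≤ M * κ := fun a => by
    rw [sum_prod_mul_sum hR.2 fun (_ : Fin M) v => if T a v then (1 : ℝ) else 0]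
    calc _ ≤ ∑ _j : Fin M, κ := Finset.sum_le_sum fun j _ => hT a
      _ = M * κ := by simp
  calc ∑ c, w c * (∑ b, (l * Pb b + Pb b * miss c b) + (∑ a, (∑ b, P a b) * cnt c a) / L)
      = l + ∑ b, Pb b * ∑ c, w c * miss c b + (∑ a, (∑ b, P a b) * ∑ c, w c * cnt c a) / L := by
        have e3 : ∑ b, Pb b * ∑ c, w c * miss c b = ∑ c, w c * ∑ b, Pb b * miss c b := by
          simp only [Finset.mul_sum]
          rw [Finset.sum_comm]
          exact Finset.sum_congr rfl fun c _ => Finset.sum_congr rfl fun b _ => by ring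
        have e4 : ∑ a, (∑ b, P a b) * ∑ c, w c * cnt c a =
            ∑ c, w c * ∑ a, (∑ b, P a b) * cnt c a := by
          simp only [Finset.mul_sum]
          rw [Finset.sum_comm]
          exact Finset.sum_congr rfl fun c _ => Finset.sum_congr rfl fun b _ => by ring
        have e5 : ∀ c, ∑ b, (l * Pb b + Pb b * miss c b) = l + ∑ b, Pb b * miss c b := fun c => by
          rw [Finset.sum_add_distrib, ← Finset.mul_sum, hPb1, mul_one]
        rw [e3, e4]
        simp only [e5, mul_add, Finset.sum_add_distrib, ← Finset.sum_mul, hw1, one_mul,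
          mul_div_assoc', ← Finset.sum_div]
    _ ≤ l + (ε / l + Real.exp (-(M / Γ))) + (M * κ) / L := by
        refine add_le_add (add_le_add le_rfl ?_) (div_le_div_of_nonneg_right ?_ hL.le)
        · simp only [hmiss]
          refine (Finset.sum_le_sum fun b _ => hmiss' b).trans ?_
          rw [Finset.sum_add_distrib, ← Finset.sum_mul, hPb1, one_mul]
          linarith
        · calc _ ≤ ∑ a, (∑ b, P a b) * (M * κ) := Finset.sum_le_sum fun a _ =>
                mul_le_mul_of_nonneg_left (hcntE a) (Finset.sum_nonneg fun b _ => hP a b)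
            _ = M * κ := by rw [← Finset.sum_mul, hP1, one_mul]
    _ = _ := by ring

end Covering

/-! ### Random binning of both sides -/

section Binning

/-- Once the coordinate `a` is split off, its value is uniform and independent of the value at `a'`.
-/
theorem sum_ite_apply_eq {A : Type*} [Fintype A] [DecidableEq A] {N : ℕ} (a a' : A) (h : a' ≠ a) :
    ∑ f : A → Fin N, (if f a' = f a then (1 : ℝ) else 0) * N = Fintype.card (A → Fin N) := by
  rw [← Finset.sum_mul]
  rw [← (Equiv.funSplitAt a (Fin N)).symm.sum_comp, Fintype.card_congr (Equiv.funSplitAt a (Fin N)),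
    Fintype.card_prod, Fintype.sum_prod_type, Finset.sum_comm]
  have : ∀ (r : {j // j ≠ a} → Fin N) (x : Fin N),
      (if (Equiv.funSplitAt a (Fin N)).symm (x, r) a' = (Equiv.funSplitAt a (Fin N)).symm (x, r) a
        then (1 : ℝ) else 0) = if r ⟨a', h⟩ = x then 1 else 0 := fun r x => by
    simp [Equiv.funSplitAt, Equiv.piSplitAt, h]
  simp only [this]
  simp [mul_comm]

/-- Probability that two letters are put into the same of `N` bins. -/
def collisionProb {A : Type*} [DecidableEq A] (N : ℕ) (a' a : A) : ℝ :=
  if a' = a then 1 else (N : ℝ)⁻¹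

theorem sum_ite_apply_eq_card_mul {A : Type*} [Fintype A] [DecidableEq A] {N : ℕ} (hN : 0 < N)
    (a a' : A) :
    ∑ f : A → Fin N, (if f a' = f a then (1 : ℝ) else 0) =
      Fintype.card (A → Fin N) * collisionProb N a' a := by
  by_cases h : a' = a
  · simp [h, collisionProb]
  · rw [← sum_ite_apply_eq a a' h, collisionProb, if_neg h, ← Finset.sum_mul, mul_assoc,
      mul_inv_cancel₀ (by exact_mod_cast hN.ne'), mul_one]

/-- The pair `(a, b)` of the relation `T` is not recovered from its bins, or one of its bins is
overloaded. -/
def BinFailure {A B : Type*} [DecidableEq A] [DecidableEq B] {N₁ N₂ : ℕ} (T : Finset (A × B))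
    (D₁ D₂ : ℝ) (f : A → Fin N₁) (g : B → Fin N₂) (a : A) (b : B) : Prop :=
  (∃ c ∈ T, c ≠ (a, b) ∧ f c.1 = f a ∧ g c.2 = g b) ∨
    D₂ < (T.filter fun c => f c.1 = f a).card ∨ D₁ < (T.filter fun c => g c.2 = g b).card

open Classical in
/-- Random binning: averaged over a sub-distribution on the relation `T`, failures are rare. -/
theorem exists_binning {A B I : Type*} [Fintype A] [DecidableEq A] [Fintype B] [DecidableEq B]
    [Fintype I] {N₁ N₂ : ℕ} (hN₁ : 0 < N₁) (hN₂ : 0 < N₂) (T : Finset (A × B)) {D₁ D₂ L₁ L₂ N : ℝ}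
    (hD₁ : 0 < D₁) (hD₂ : 0 < D₂)
    (hrow : ∀ a, ((T.filter fun c => c.1 = a).card : ℝ) ≤ L₂)
    (hcol : ∀ b, ((T.filter fun c => c.2 = b).card : ℝ) ≤ L₁) (hT : (T.card : ℝ) ≤ N)
    {w : I → ℝ} (hw : ∀ i, 0 ≤ w i) (hw1 : ∑ i, w i = 1) (α : I → A) (β : I → B) :
    ∃ (f : A → Fin N₁) (g : B → Fin N₂),
      ∑ i, w i * (if BinFailure T D₁ D₂ f g (α i) (β i) then 1 else 0) ≤
        L₁ / N₁ + L₂ / N₂ + N / (N₁ * N₂) + (L₂ + N / N₁) / D₂ + (L₁ + N / N₂) / D₁ := by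
  have hN₁' : (0 : ℝ) < N₁ := by exact_mod_cast hN₁
  have hN₂' : (0 : ℝ) < N₂ := by exact_mod_cast hN₂
  have : NeZero N₁ := ⟨hN₁.ne'⟩
  have : NeZero N₂ := ⟨hN₂.ne'⟩
  set C₁ : ℝ := ((Fintype.card (A → Fin N₁) : ℕ) : ℝ) with hC₁
  set C₂ : ℝ := ((Fintype.card (B → Fin N₂) : ℕ) : ℝ) with hC₂
  have hC₁0 : 0 < C₁ := by rw [hC₁]; exact_mod_cast Fintype.card_pos
  have hC₂0 : 0 < C₂ := by rw [hC₂]; exact_mod_cast Fintype.card_pos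
  let e₁ : (A → Fin N₁) → A → A → ℝ := fun f a' a => if f a' = f a then 1 else 0
  let e₂ : (B → Fin N₂) → B → B → ℝ := fun g b' b => if g b' = g b then 1 else 0
  have he₁ : ∀ f a' a, 0 ≤ e₁ f a' a := fun f a' a => by simp only [e₁]; split_ifs <;> norm_num
  have he₂ : ∀ g b' b, 0 ≤ e₂ g b' b := fun f a' a => by simp only [e₂]; split_ifs <;> norm_num
  have hE₁ : ∀ a' a, ∑ f, C₁⁻¹ * e₁ f a' a = collisionProb N₁ a' a := fun a' a => by
    rw [← Finset.mul_sum, sum_ite_apply_eq_card_mul hN₁, inv_mul_cancel_left₀ hC₁0.ne']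
  have hE₂ : ∀ b' b, ∑ g, C₂⁻¹ * e₂ g b' b = collisionProb N₂ b' b := fun a' a => by
    rw [← Finset.mul_sum, sum_ite_apply_eq_card_mul hN₂, inv_mul_cancel_left₀ hC₂0.ne']
  have hs₁ : ∑ _f : A → Fin N₁, C₁⁻¹ = 1 := by
    rw [Finset.sum_const, Finset.card_univ, nsmul_eq_mul, mul_inv_cancel₀ hC₁0.ne']
  have hs₂ : ∑ _g : B → Fin N₂, C₂⁻¹ = 1 := by
    rw [Finset.sum_const, Finset.card_univ, nsmul_eq_mul, mul_inv_cancel₀ hC₂0.ne']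
  -- Union bound for wrong pairs in the same bins, with Markov's inequality for each of the two bin
  -- loads.
  let cost : (A → Fin N₁) → (B → Fin N₂) → A → B → ℝ := fun f g a b =>
    ∑ c ∈ T.erase (a, b), e₁ f c.1 a * e₂ g c.2 b + (∑ c ∈ T, e₁ f c.1 a) / D₂ +
      (∑ c ∈ T, e₂ g c.2 b) / D₁
  have hcost : ∀ f g a b, (if BinFailure T D₁ D₂ f g a b then (1 : ℝ) else 0) ≤ cost f g a b := by
    intro f g a b
    have c1 : 0 ≤ ∑ c ∈ T.erase (a, b), e₁ f c.1 a * e₂ g c.2 b :=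
      Finset.sum_nonneg fun c _ => mul_nonneg (he₁ _ _ _) (he₂ _ _ _)
    have c2 : 0 ≤ (∑ c ∈ T, e₁ f c.1 a) / D₂ :=
      div_nonneg (Finset.sum_nonneg fun c _ => he₁ _ _ _) hD₂.le
    have c3 : 0 ≤ (∑ c ∈ T, e₂ g c.2 b) / D₁ :=
      div_nonneg (Finset.sum_nonneg fun c _ => he₂ _ _ _) hD₁.le
    split_ifs with h
    · rcases h with ⟨c, hc, hne, h1, h2⟩ | h | h
      · have : (1 : ℝ) ≤ ∑ c ∈ T.erase (a, b), e₁ f c.1 a * e₂ g c.2 b := by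
          refine le_of_eq_of_le ?_ (Finset.single_le_sum
            (f := fun c : A × B => e₁ f c.1 a * e₂ g c.2 b)
            (fun c _ => mul_nonneg (he₁ _ _ _) (he₂ _ _ _)) (Finset.mem_erase.2 ⟨hne, hc⟩))
          simp [e₁, e₂, h1, h2]
        simp only [cost]; linarith
      · have : 1 ≤ (∑ c ∈ T, e₁ f c.1 a) / D₂ := by
          rw [le_div_iff₀ hD₂, one_mul]
          refine h.le.trans_eq ?_
          simp [e₁]
        simp only [cost]; linarith
      · have : 1 ≤ (∑ c ∈ T, e₂ g c.2 b) / D₁ := by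
          rw [le_div_iff₀ hD₁, one_mul]
          refine h.le.trans_eq ?_
          simp [e₂]
        simp only [cost]; linarith
    · simp only [cost]; linarith
  have hp₁ : ∀ a' a : A, collisionProb N₁ a' a ≤ (if a' = a then 1 else 0) + (N₁ : ℝ)⁻¹ := by
    intro a' a
    unfold collisionProb
    split_ifs
    · exact le_add_of_nonneg_right (by positivity)
    · simp
  have hp₂ : ∀ b' b : B, collisionProb N₂ b' b ≤ (if b' = b then 1 else 0) + (N₂ : ℝ)⁻¹ := by
    intro a' a
    unfold collisionProb
    split_ifs
    · exact le_add_of_nonneg_right (by positivity)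
    · simp
  -- A competing pair shares its first coordinate, its second or neither, so at least one side must
  -- collide by chance. The three cases give the terms L₂/N₂, L₁/N₁ and N/(N₁N₂).
  have hp₁₂ : ∀ (a : A) (b : B) (c : A × B), c ≠ (a, b) →
      collisionProb N₁ c.1 a * collisionProb N₂ c.2 b ≤
      (if c.1 = a then 1 else 0) * (N₂ : ℝ)⁻¹ + (if c.2 = b then 1 else 0) * (N₁ : ℝ)⁻¹ +
        ((N₁ : ℝ) * N₂)⁻¹ := by
    intro a b c hc
    have hi : 0 ≤ ((N₁ : ℝ) * N₂)⁻¹ := by positivity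
    by_cases h1 : c.1 = a <;> by_cases h2 : c.2 = b
    · exact absurd (Prod.ext h1 h2) hc
    · simp only [collisionProb, h1, h2, if_true, if_false]; linarith
    · simp only [collisionProb, h1, h2, if_true, if_false]; linarith
    · simp only [collisionProb, h1, h2, if_false, mul_inv]; linarith
  have hrow' : ∀ a, ∑ c ∈ T, (if c.1 = a then (1 : ℝ) else 0) ≤ L₂ := fun a => by
    refine le_of_eq_of_le ?_ (hrow a); simp
  have hcol' : ∀ b, ∑ c ∈ T, (if c.2 = b then (1 : ℝ) else 0) ≤ L₁ := fun a => by
    refine le_of_eq_of_le ?_ (hcol a); simp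
  have havg : ∀ a b, ∑ f, ∑ g, C₁⁻¹ * C₂⁻¹ * cost f g a b ≤
      L₁ / N₁ + L₂ / N₂ + N / (N₁ * N₂) + (L₂ + N / N₁) / D₂ + (L₁ + N / N₂) / D₁ := by
    intro a b
    have x1 : ∑ f, ∑ g, C₁⁻¹ * C₂⁻¹ * ∑ c ∈ T.erase (a, b), e₁ f c.1 a * e₂ g c.2 b =
        ∑ c ∈ T.erase (a, b), collisionProb N₁ c.1 a * collisionProb N₂ c.2 b := by
      calc _ = ∑ c ∈ T.erase (a, b), ∑ f, ∑ g, C₁⁻¹ * e₁ f c.1 a * (C₂⁻¹ * e₂ g c.2 b) := by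
            rw [Finset.sum_comm (s := T.erase (a, b))]
            refine Finset.sum_congr rfl fun f _ => ?_
            rw [Finset.sum_comm (s := T.erase (a, b))]
            refine Finset.sum_congr rfl fun g _ => ?_
            rw [Finset.mul_sum]
            exact Finset.sum_congr rfl fun c _ => by ring
        _ = _ := Finset.sum_congr rfl fun c _ => by
            rw [← hE₁, ← hE₂, Finset.sum_mul_sum]
    have x2 : ∑ f, ∑ _g : B → Fin N₂, C₁⁻¹ * C₂⁻¹ * ((∑ c ∈ T, e₁ f c.1 a) / D₂) =
        (∑ c ∈ T, collisionProb N₁ c.1 a) / D₂ := by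
      calc _ = (∑ _g : B → Fin N₂, C₂⁻¹) * ∑ f, C₁⁻¹ * ((∑ c ∈ T, e₁ f c.1 a) / D₂) := by
            rw [Finset.sum_mul_sum, Finset.sum_comm]
            exact Finset.sum_congr rfl fun f _ => Finset.sum_congr rfl fun g _ => by ring
        _ = _ := by
            simp only [← hE₁]
            rw [hs₂, one_mul, Finset.sum_comm, Finset.sum_div]
            refine Finset.sum_congr rfl fun f _ => ?_
            rw [← Finset.mul_sum]; ring
    have x3 : ∑ _f : A → Fin N₁, ∑ g, C₁⁻¹ * C₂⁻¹ * ((∑ c ∈ T, e₂ g c.2 b) / D₁) =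
        (∑ c ∈ T, collisionProb N₂ c.2 b) / D₁ := by
      calc _ = (∑ _f : A → Fin N₁, C₁⁻¹) * ∑ g, C₂⁻¹ * ((∑ c ∈ T, e₂ g c.2 b) / D₁) := by
            rw [Finset.sum_mul_sum]
            exact Finset.sum_congr rfl fun f _ => Finset.sum_congr rfl fun g _ => by ring
        _ = _ := by
            simp only [← hE₂]
            rw [hs₁, one_mul, Finset.sum_comm, Finset.sum_div]
            refine Finset.sum_congr rfl fun f _ => ?_
            rw [← Finset.mul_sum]; ring
    simp only [cost, mul_add, Finset.sum_add_distrib]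
    rw [x1, x2, x3]
    refine add_le_add (add_le_add ?_ (div_le_div_of_nonneg_right ?_ hD₂.le))
      (div_le_div_of_nonneg_right ?_ hD₁.le)
    · calc _ ≤ ∑ c ∈ T.erase (a, b), ((if c.1 = a then 1 else 0) * (N₂ : ℝ)⁻¹ +
            (if c.2 = b then 1 else 0) * (N₁ : ℝ)⁻¹ + ((N₁ : ℝ) * N₂)⁻¹) :=
            Finset.sum_le_sum fun c hc => hp₁₂ a b c (Finset.mem_erase.1 hc).1
        _ ≤ ∑ c ∈ T, ((if c.1 = a then 1 else 0) * (N₂ : ℝ)⁻¹ +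
            (if c.2 = b then 1 else 0) * (N₁ : ℝ)⁻¹ + ((N₁ : ℝ) * N₂)⁻¹) :=
            Finset.sum_le_sum_of_subset_of_nonneg (Finset.erase_subset _ _) fun c _ _ => by
              split_ifs <;> positivity
        _ = (∑ c ∈ T, if c.1 = a then 1 else 0) * (N₂ : ℝ)⁻¹ +
            (∑ c ∈ T, if c.2 = b then 1 else 0) * (N₁ : ℝ)⁻¹ + T.card * ((N₁ : ℝ) * N₂)⁻¹ := by
            rw [Finset.sum_add_distrib, Finset.sum_add_distrib, Finset.sum_mul, Finset.sum_mul,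
              Finset.sum_const, nsmul_eq_mul]
        _ ≤ L₂ * (N₂ : ℝ)⁻¹ + L₁ * (N₁ : ℝ)⁻¹ + N * ((N₁ : ℝ) * N₂)⁻¹ := by
            gcongr
            · exact hrow' a
            · exact hcol' b
        _ = _ := by simp only [div_eq_mul_inv]; ring
    · calc _ ≤ ∑ c ∈ T, ((if c.1 = a then 1 else 0) + (N₁ : ℝ)⁻¹) :=
            Finset.sum_le_sum fun c _ => hp₁ c.1 a
        _ = (∑ c ∈ T, if c.1 = a then 1 else 0) + T.card * (N₁ : ℝ)⁻¹ := by
            rw [Finset.sum_add_distrib, Finset.sum_const, nsmul_eq_mul]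
        _ ≤ L₂ + N / N₁ := by
            rw [div_eq_mul_inv]
            gcongr
            exact hrow' a
    · calc _ ≤ ∑ c ∈ T, ((if c.2 = b then 1 else 0) + (N₂ : ℝ)⁻¹) :=
            Finset.sum_le_sum fun c _ => hp₂ c.2 b
        _ = (∑ c ∈ T, if c.2 = b then 1 else 0) + T.card * (N₂ : ℝ)⁻¹ := by
            rw [Finset.sum_add_distrib, Finset.sum_const, nsmul_eq_mul]
        _ ≤ L₁ + N / N₂ := by
            rw [div_eq_mul_inv]
            gcongr
            exact hcol' b
  obtain ⟨⟨f, g⟩, hfg⟩ := exists_le_of_weighted_sum_le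
    (ι := (A → Fin N₁) × (B → Fin N₂)) (w := fun _ => C₁⁻¹ * C₂⁻¹)
    (f := fun x => ∑ i, w i * cost x.1 x.2 (α i) (β i)) (fun _ => by positivity) (by
      rw [Fintype.sum_prod_type]
      simp only [← Finset.mul_sum, hs₂, mul_one, hs₁]) (B := L₁ / N₁ + L₂ / N₂ + N / (N₁ * N₂) +
        (L₂ + N / N₁) / D₂ + (L₁ + N / N₂) / D₁) (by
      calc _ = ∑ i, w i * ∑ f, ∑ g, C₁⁻¹ * C₂⁻¹ * cost f g (α i) (β i) := by
            rw [Fintype.sum_prod_type]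
            simp only [Finset.mul_sum]
            conv_rhs => rw [Finset.sum_comm]
            refine Finset.sum_congr rfl fun f _ => ?_
            conv_rhs => rw [Finset.sum_comm]
            exact Finset.sum_congr rfl fun g _ => Finset.sum_congr rfl fun i _ => by ring
        _ ≤ ∑ i, w i * (L₁ / N₁ + L₂ / N₂ + N / (N₁ * N₂) + (L₂ + N / N₁) / D₂ +
              (L₁ + N / N₂) / D₁) :=
            Finset.sum_le_sum fun i _ => mul_le_mul_of_nonneg_left (havg _ _) (hw i)
        _ = _ := by rw [← Finset.sum_mul, hw1, one_mul])
  exact ⟨f, g, (Finset.sum_le_sum fun i _ => mul_le_mul_of_nonneg_left (hcost f g _ _) (hw i)).trans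
    hfg⟩

end Binning

/-! ### The graph of occupied bin pairs and its regularization -/

section Graph

/-- `K` disjoint copies of the complete bipartite graph on `A` and `B` vertices. -/
def backbone (K A B : ℕ) : Finset (Fin (K * A) × Fin (K * B)) :=
  Finset.univ.filter fun e => (finProdFinEquiv.symm e.1).1 = (finProdFinEquiv.symm e.2).1

theorem deg₁_backbone (K A B : ℕ) (u : Fin (K * A)) : deg₁ (backbone K A B) u = B := by
  have : (deg₁ (backbone K A B) u : ℝ) = B := by
    rw [← sum_ite_mem_left, ← finProdFinEquiv.sum_comp, Fintype.sum_prod_type]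
    simp only [backbone, Finset.mem_filter, Finset.mem_univ, true_and, Equiv.symm_apply_apply]
    generalize (finProdFinEquiv.symm u).1 = k
    rw [Finset.sum_comm]
    simp
  exact_mod_cast this

theorem deg₂_backbone (K A B : ℕ) (v : Fin (K * B)) : deg₂ (backbone K A B) v = A := by
  have : (deg₂ (backbone K A B) v : ℝ) = A := by
    rw [← sum_ite_mem_right, ← finProdFinEquiv.sum_comp, Fintype.sum_prod_type]
    simp only [backbone, Finset.mem_filter, Finset.mem_univ, true_and, Equiv.symm_apply_apply]
    generalize (finProdFinEquiv.symm v).1 = k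
    rw [Finset.sum_comm]
    simp
  exact_mod_cast this

variable {𝒜 ℬ : Type*} [DecidableEq 𝒜] [DecidableEq ℬ]

open Classical in
/-- The pairs of bins that contain a pair of the relation `T`, without overloaded bins. -/
def binPairs {N₁ N₂ : ℕ} (T : Finset (𝒜 × ℬ)) (A B : ℕ) (f : 𝒜 → Fin N₁) (g : ℬ → Fin N₂) :
    Finset (Fin N₁ × Fin N₂) :=
  Finset.univ.filter fun e => (∃ c ∈ T, f c.1 = e.1 ∧ g c.2 = e.2) ∧
    (T.filter fun c => f c.1 = e.1).card ≤ B ∧ (T.filter fun c => g c.2 = e.2).card ≤ A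

/-- Each neighbour of `u` is witnessed by a pair of `T` whose first bin is `u`, and a vertex with
any neighbour is not overloaded. -/
theorem deg₁_binPairs_le {N₁ N₂ : ℕ} (T : Finset (𝒜 × ℬ)) (A B : ℕ) (f : 𝒜 → Fin N₁)
    (g : ℬ → Fin N₂) (u : Fin N₁) : deg₁ (binPairs T A B f g) u ≤ B := by
  rw [deg₁]
  rcases Finset.eq_empty_or_nonempty
    (Finset.univ.filter fun v => (u, v) ∈ binPairs T A B f g) with h | ⟨v, hv⟩
  · simp [h]
  · have h1 : (T.filter fun c => f c.1 = u).card ≤ B := by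
      simp only [binPairs, Finset.mem_filter, Finset.mem_univ, true_and] at hv
      exact hv.2.1
    refine le_trans (Finset.card_le_card (t := (T.filter fun c => f c.1 = u).image fun c => g c.2)
      fun v' hv' => ?_) (Finset.card_image_le.trans h1)
    simp only [binPairs, Finset.mem_filter, Finset.mem_univ, true_and] at hv'
    obtain ⟨⟨c, hc, hc1, hc2⟩, -⟩ := hv'
    exact Finset.mem_image.2 ⟨c, Finset.mem_filter.2 ⟨hc, hc1⟩, hc2⟩

theorem deg₂_binPairs_le {N₁ N₂ : ℕ} (T : Finset (𝒜 × ℬ)) (A B : ℕ) (f : 𝒜 → Fin N₁)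
    (g : ℬ → Fin N₂) (v : Fin N₂) : deg₂ (binPairs T A B f g) v ≤ A := by
  rw [deg₂]
  rcases Finset.eq_empty_or_nonempty
    (Finset.univ.filter fun u => (u, v) ∈ binPairs T A B f g) with h | ⟨u, hu⟩
  · simp [h]
  · have h1 : (T.filter fun c => g c.2 = v).card ≤ A := by
      simp only [binPairs, Finset.mem_filter, Finset.mem_univ, true_and] at hu
      exact hu.2.2
    refine le_trans (Finset.card_le_card (t := (T.filter fun c => g c.2 = v).image fun c => f c.1)
      fun u' hu' => ?_) (Finset.card_image_le.trans h1)
    simp only [binPairs, Finset.mem_filter, Finset.mem_univ, true_and] at hu'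
    obtain ⟨⟨c, hc, hc1, hc2⟩, -⟩ := hu'
    exact Finset.mem_image.2 ⟨c, Finset.mem_filter.2 ⟨hc, hc2⟩, hc1⟩

theorem deg₁_union {Δ₁ Δ₂ : ℕ} (E F : Finset (Fin Δ₁ × Fin Δ₂)) (u : Fin Δ₁) :
    deg₁ E u ≤ deg₁ (E ∪ F) u ∧ deg₁ (E ∪ F) u ≤ deg₁ E u + deg₁ F u := by
  simp only [deg₁, Finset.mem_union, Finset.filter_or]
  exact ⟨Finset.card_le_card Finset.subset_union_left, Finset.card_union_le _ _⟩

theorem deg₂_union {Δ₁ Δ₂ : ℕ} (E F : Finset (Fin Δ₁ × Fin Δ₂)) (v : Fin Δ₂) :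
    deg₂ E v ≤ deg₂ (E ∪ F) v ∧ deg₂ (E ∪ F) v ≤ deg₂ E v + deg₂ F v := by
  simp only [deg₂, Finset.mem_union, Finset.filter_or]
  exact ⟨Finset.card_le_card Finset.subset_union_left, Finset.card_union_le _ _⟩

/-- The backbone supplies the lower degree bounds and the bin pairs at most double the degrees, so
slack 2 suffices. -/
theorem isNearlySemiRegular_union_binPairs {K A B : ℕ} (hA : 0 < A) (hB : 0 < B)
    (T : Finset (𝒜 × ℬ)) (f : 𝒜 → Fin (K * A)) (g : ℬ → Fin (K * B)) :
    IsNearlySemiRegular (backbone K A B ∪ binPairs T A B f g) A B 2 := by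
  have hA' : (0 : ℝ) < A := by exact_mod_cast hA
  have hB' : (0 : ℝ) < B := by exact_mod_cast hB
  refine ⟨one_lt_two, hA', hB', fun u => ?_, fun v => ?_⟩
  · obtain ⟨h1, h2⟩ := deg₁_union (backbone K A B) (binPairs T A B f g) u
    rw [deg₁_backbone] at h1 h2
    have h3 := h2.trans (Nat.add_le_add_left (deg₁_binPairs_le T A B f g u) B)
    have h1' : (B : ℝ) ≤ deg₁ (backbone K A B ∪ binPairs T A B f g) u := by exact_mod_cast h1
    have h3' : (deg₁ (backbone K A B ∪ binPairs T A B f g) u : ℝ) ≤ B + B := by exact_mod_cast h3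
    constructor <;> linarith
  · obtain ⟨h1, h2⟩ := deg₂_union (backbone K A B) (binPairs T A B f g) v
    rw [deg₂_backbone] at h1 h2
    have h3 := h2.trans (Nat.add_le_add_left (deg₂_binPairs_le T A B f g v) A)
    have h1' : (A : ℝ) ≤ deg₂ (backbone K A B ∪ binPairs T A B f g) v := by exact_mod_cast h1
    have h3' : (deg₂ (backbone K A B ∪ binPairs T A B f g) v : ℝ) ≤ A + A := by exact_mod_cast h3
    constructor <;> linarith

end Graph

/-! ### One-shot achievability -/

section OneShot

variable {X₁ X₂ Y : Type*} [Fintype X₁] [DecidableEq X₁] [Fintype X₂] [DecidableEq X₂]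
  {p : X₁ × X₂ → ℝ}

theorem blockDistortion_le {X Z : Type*} {d : X → Z → ℝ} {D : ℝ} (hD : 0 ≤ D)
    (hd : ∀ x y, d x y ≤ D) {n : ℕ} (x : Fin n → X) (y : Fin n → Z) : blockDistortion d x y ≤ D := by
  rw [blockDistortion]
  rcases Nat.eq_zero_or_pos n with rfl | hn
  · simpa using hD
  · have hn' : (0 : ℝ) < n := by exact_mod_cast hn
    rw [div_mul_eq_mul_div, one_mul, div_le_iff₀ hn']
    calc ∑ k, d (x k) (y k) ≤ ∑ _k : Fin n, D := Finset.sum_le_sum fun k _ => hd _ _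
      _ = D * n := by simp [mul_comm]

theorem blockDistortion_hamming_self {X : Type*} [DecidableEq X] {n : ℕ} (x : Fin n → X) :
    blockDistortion hammingDistortion x x = 0 := by
  simp [blockDistortion, hammingDistortion]

open Classical in
/-- The system that decodes the unique pair of `T` in the received bins. -/
theorem exists_system_of_binning [Nonempty X₁] [Nonempty Y] (hp : p ∈ stdSimplex ℝ (X₁ × X₂))
    {d : X₂ → Y → ℝ} {D dmax e : ℝ} (hD : 0 ≤ D) (hdmax : 0 ≤ dmax) (hd : ∀ x y, d x y ≤ dmax)
    {n M K A B : ℕ} (hA : 0 < A) (hB : 0 < B) (s : (Fin n → X₂) → Fin M)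
    (r : (Fin n → X₁) → Fin M → Fin n → Y) (T : Finset ((Fin n → X₁) × Fin M))
    (f : (Fin n → X₁) → Fin (K * A)) (g : Fin M → Fin (K * B))
    (Fail : (Fin n → X₁) → (Fin n → X₂) → Prop)
    (hgood : ∀ x₁ x₂, 0 < iidLaw p x₁ x₂ → ¬Fail x₁ x₂ → (x₁, s x₂) ∈ T ∧
      ¬BinFailure T A B f g x₁ (s x₂) ∧ blockDistortion d x₂ (r x₁ (s x₂)) ≤ D)
    (herr : ∑ x₁, ∑ x₂, iidLaw p x₁ x₂ * (if Fail x₁ x₂ then 1 else 0) ≤ e) :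
    ∃ (E : Finset (Fin (K * A) × Fin (K * B))) (S : DSCSystem X₁ X₂ Y n E),
      IsNearlySemiRegular E A B 2 ∧ S.τ₁ p ≤ e ∧ S.τ₂ p d ≤ D + dmax * e := by
  let E := backbone K A B ∪ binPairs T A B f g
  let fb : (Fin n → X₁) × (Fin n → Y) := Classical.arbitrary _
  let S : DSCSystem X₁ X₂ Y n E :=
    { f₁ := f
      f₂ := fun x₂ => g (s x₂)
      -- Backbone edges whose bins hold no pair of `T` get an arbitrary value; they serve only the
      -- degree condition.
      g := fun e => if h : ∃ c ∈ T, f c.1 = e.1.1 ∧ g c.2 = e.1.2 then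
        (h.choose.1, r h.choose.1 h.choose.2) else fb
      fallback := fb }
  have hrec : ∀ x₁ x₂, 0 < iidLaw p x₁ x₂ → ¬Fail x₁ x₂ →
      S.reconstruct x₁ x₂ = (x₁, r x₁ (s x₂)) := by
    intro x₁ x₂ hpos hF
    obtain ⟨h1, h2, -⟩ := hgood x₁ x₂ hpos hF
    simp only [BinFailure, not_or, not_exists, not_and, not_lt, Nat.cast_le] at h2
    obtain ⟨h3, h4, h5⟩ := h2
    have hE : (f x₁, g (s x₂)) ∈ E := by
      refine Finset.mem_union_right _ ?_
      simp only [binPairs, Finset.mem_filter, Finset.mem_univ, true_and]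
      exact ⟨⟨(x₁, s x₂), h1, rfl, rfl⟩, h4, h5⟩
    have hex : ∃ c ∈ T, f c.1 = f x₁ ∧ g c.2 = g (s x₂) := ⟨(x₁, s x₂), h1, rfl, rfl⟩
    have hch : hex.choose = (x₁, s x₂) := by
      obtain ⟨k1, k2, k3⟩ := hex.choose_spec
      by_contra hne
      exact h3 _ k1 hne k2 k3
    have : S.reconstruct x₁ x₂ = (hex.choose.1, r hex.choose.1 hex.choose.2) := by
      rw [DSCSystem.reconstruct, dif_pos (show (S.f₁ x₁, S.f₂ x₂) ∈ E from hE)]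
      exact dif_pos hex
    rw [this, hch]
  have hnn : ∀ (x₁ : Fin n → X₁) (x₂ : Fin n → X₂), 0 ≤ iidLaw p x₁ x₂ := fun x₁ x₂ =>
    blockLaw_nonneg hp.1 n (x₁, x₂)
  refine ⟨E, S, isNearlySemiRegular_union_binPairs hA hB T f g, ?_, ?_⟩
  · refine le_trans (Finset.sum_le_sum fun x₁ _ => Finset.sum_le_sum fun x₂ _ => ?_) herr
    rcases (hnn x₁ x₂).eq_or_lt with h0 | h0
    · simp [← h0]
    refine mul_le_mul_of_nonneg_left ?_ h0.le
    split_ifs with h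
    · exact blockDistortion_le zero_le_one
        (fun a b => by unfold hammingDistortion; split_ifs <;> norm_num) _ _
    · rw [hrec x₁ x₂ h0 h, blockDistortion_hamming_self]
  · have hs : ∑ x₁ : Fin n → X₁, ∑ x₂ : Fin n → X₂, iidLaw p x₁ x₂ = 1 := by
      rw [← Fintype.sum_prod_type']
      exact sum_blockLaw hp.2 n
    calc S.τ₂ p d ≤ ∑ x₁, ∑ x₂, (iidLaw p x₁ x₂ * D +
          dmax * (iidLaw p x₁ x₂ * (if Fail x₁ x₂ then 1 else 0))) := by
          refine Finset.sum_le_sum fun x₁ _ => Finset.sum_le_sum fun x₂ _ => ?_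
          rcases (hnn x₁ x₂).eq_or_lt with h0 | h0
          · simp [← h0]
          rw [mul_left_comm dmax, ← mul_add]
          refine mul_le_mul_of_nonneg_left ?_ h0.le
          split_ifs with h
          · have := blockDistortion_le hdmax hd x₂ (S.reconstruct x₁ x₂).2
            linarith
          · rw [hrec x₁ x₂ h0 h, mul_zero, add_zero]
            exact (hgood x₁ x₂ h0 h).2.2
      _ = D + dmax * ∑ x₁, ∑ x₂, iidLaw p x₁ x₂ * (if Fail x₁ x₂ then 1 else 0) := by
          simp only [Finset.sum_add_distrib, ← Finset.sum_mul, ← Finset.mul_sum, hs, one_mul]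
      _ ≤ _ := by gcongr

open Classical in
/-- One-shot achievability: covering, binning and decoding combined. -/
theorem exists_system [Nonempty X₁] [Nonempty Y] (hp : p ∈ stdSimplex ℝ (X₁ × X₂))
    {d : X₂ → Y → ℝ} {D dmax : ℝ} (hD : 0 ≤ D) (hdmax : 0 ≤ dmax) (hd : ∀ x y, d x y ≤ dmax)
    {𝒱 : Type*} [Fintype 𝒱] {n : ℕ}
    {Q : (Fin n → X₂) → 𝒱 → ℝ} (hQ : ∀ b, Q b ∈ stdSimplex ℝ 𝒱) {R : 𝒱 → ℝ}
    (hR : R ∈ stdSimplex ℝ 𝒱) (xh : (Fin n → X₁) → 𝒱 → Fin n → Y)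
    (Bad : (Fin n → X₁) → (Fin n → X₂) → 𝒱 → Prop) (T : (Fin n → X₁) → 𝒱 → Prop)
    {Γ ε l κ L₁ L₂ N : ℝ} (hΓ : 0 < Γ) (hl0 : 0 < l) (hl1 : l < 1) (hL₂ : 0 < L₂)
    (hgood : ∀ a b v, 0 < iidLaw p a b → ¬Bad a b v →
      T a v ∧ Q b v ≤ Γ * R v ∧ blockDistortion d b (xh a v) ≤ D)
    (hbad : ∑ a, ∑ b, ∑ v, iidLaw p a b * Q b v * (if Bad a b v then 1 else 0) ≤ ε)
    (hT : ∀ a, ∑ v, R v * (if T a v then 1 else 0) ≤ κ)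
    (hcol : ∀ v, ((Finset.univ.filter fun a => T a v).card : ℝ) ≤ L₁)
    (hN : ((Finset.univ.filter fun a => ∃ v, T a v).card : ℝ) ≤ N)
    {M K A B : ℕ} (hM : 0 < M) (hK : 0 < K) (hA : 0 < A) (hB : 0 < B) :
    ∃ (E : Finset (Fin (K * A) × Fin (K * B))) (S : DSCSystem X₁ X₂ Y n E) (e : ℝ),
      IsNearlySemiRegular E A B 2 ∧ S.τ₁ p ≤ e ∧ S.τ₂ p d ≤ D + dmax * e ∧
      e = (l + ε / l + Real.exp (-(M / Γ)) + M * κ / L₂) +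
        (L₁ / (K * A) + L₂ / (K * B) + N * L₂ / (K * A * (K * B)) +
          (L₂ + N * L₂ / (K * A)) / B + (L₁ + N * L₂ / (K * B)) / A) := by
  have hnn : ∀ (x₁ : Fin n → X₁) (x₂ : Fin n → X₂), 0 ≤ iidLaw p x₁ x₂ := fun x₁ x₂ =>
    blockLaw_nonneg hp.1 n (x₁, x₂)
  have hsum : ∑ x₁ : Fin n → X₁, ∑ x₂ : Fin n → X₂, iidLaw p x₁ x₂ = 1 := by
    rw [← Fintype.sum_prod_type']
    exact sum_blockLaw hp.2 n
  obtain ⟨c, s, hcs⟩ := exists_codebook hnn hsum hQ hR Bad T (L := L₂) hΓ hl0 hl1 hL₂ hM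
    (fun a b v h1 h2 => (hgood a b v h1 h2).2.1) hbad hT
  -- First blocks compatible with too many codewords are dropped, which bounds the rows; the
  -- covering step already counts them as failures.
  let T' : Finset ((Fin n → X₁) × Fin M) := Finset.univ.filter fun x =>
    T x.1 (c x.2) ∧ ((Finset.univ.filter fun j => T x.1 (c j)).card : ℝ) ≤ L₂
  have hmem : ∀ x, x ∈ T' ↔ T x.1 (c x.2) ∧
      ((Finset.univ.filter fun j => T x.1 (c j)).card : ℝ) ≤ L₂ := fun x => by simp [T']
  have hrow : ∀ a, ((T'.filter fun x => x.1 = a).card : ℝ) ≤ L₂ := fun a => by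
    rcases Finset.eq_empty_or_nonempty (T'.filter fun x => x.1 = a) with h | ⟨x, hx⟩
    · simp [h, hL₂.le]
    · obtain ⟨hx1, rfl⟩ := Finset.mem_filter.1 hx
      refine le_trans ?_ ((hmem x).1 hx1).2
      have : (T'.filter fun y => y.1 = x.1).card ≤
          (Finset.univ.filter fun j => T x.1 (c j)).card := by
        refine Finset.card_le_card_of_injOn Prod.snd (fun y hy => ?_) fun y hy z hz h => ?_
        · obtain ⟨hy1, hy2⟩ := Finset.mem_filter.1 (Finset.mem_coe.1 hy)
          have := ((hmem y).1 hy1).1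
          rw [hy2] at this
          simpa using this
        · exact Prod.ext ((Finset.mem_filter.1 (Finset.mem_coe.1 hy)).2.trans
            (Finset.mem_filter.1 (Finset.mem_coe.1 hz)).2.symm) h
      exact_mod_cast this
  have hcol' : ∀ j, ((T'.filter fun x => x.2 = j).card : ℝ) ≤ L₁ := fun j => by
    refine le_trans ?_ (hcol (c j))
    have : (T'.filter fun x => x.2 = j).card ≤ (Finset.univ.filter fun a => T a (c j)).card := by
      refine Finset.card_le_card_of_injOn Prod.fst (fun y hy => ?_) fun y hy z hz h => ?_
      · obtain ⟨hy1, hy2⟩ := Finset.mem_filter.1 (Finset.mem_coe.1 hy)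
        have := ((hmem y).1 hy1).1
        rw [hy2] at this
        simpa using this
      · exact Prod.ext h ((Finset.mem_filter.1 (Finset.mem_coe.1 hy)).2.trans
          (Finset.mem_filter.1 (Finset.mem_coe.1 hz)).2.symm)
    exact_mod_cast this
  have htot : (T'.card : ℝ) ≤ N * L₂ := by
    have h1 := Finset.card_eq_sum_card_fiberwise (s := T') (f := Prod.fst)
      (t := Finset.univ.filter fun a => ∃ v, T a v) (fun x hx => by
        have := ((hmem x).1 (Finset.mem_coe.1 hx)).1
        simpa using ⟨_, this⟩)
    rw [h1, Nat.cast_sum]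
    calc _ ≤ ∑ _a ∈ Finset.univ.filter fun a => ∃ v, T a v, L₂ :=
          Finset.sum_le_sum fun a _ => hrow a
      _ ≤ N * L₂ := by
          rw [Finset.sum_const, nsmul_eq_mul]
          gcongr
  have hA' : (0 : ℝ) < A := by exact_mod_cast hA
  have hB' : (0 : ℝ) < B := by exact_mod_cast hB
  obtain ⟨f, g, hfg⟩ := exists_binning (Nat.mul_pos hK hA) (Nat.mul_pos hK hB) T' hA' hB' hrow hcol'
    htot (w := blockLaw p n) (blockLaw_nonneg hp.1 n) (sum_blockLaw hp.2 n) (fun ω => ω.1)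
    (fun ω => s ω.2)
  refine (exists_system_of_binning hp hD hdmax hd hA hB s (fun a j => xh a (c j)) T' f g
    (fun a b => (Bad a b (c (s b)) ∨
      L₂ < ((Finset.univ.filter fun j => T a (c j)).card : ℝ)) ∨ BinFailure T' A B f g a (s b))
    (fun a b h0 hF => ?_) ?_).imp fun E hE => hE.imp fun S hS => ⟨_, hS.1, hS.2.1, hS.2.2, rfl⟩
  · rw [not_or, not_or, not_lt] at hF
    obtain ⟨h1, h2, h3⟩ := hgood a b _ h0 hF.1.1
    exact ⟨(hmem _).2 ⟨h1, hF.1.2⟩, hF.2, h3⟩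
  · have hstep : ∑ a, ∑ b, iidLaw p a b * (if (Bad a b (c (s b)) ∨
        L₂ < ((Finset.univ.filter fun j => T a (c j)).card : ℝ)) ∨ BinFailure T' A B f g a (s b)
          then (1 : ℝ) else 0) ≤
        ∑ a, ∑ b, (iidLaw p a b * (if Bad a b (c (s b)) ∨
          L₂ < ((Finset.univ.filter fun j => T a (c j)).card : ℝ) then 1 else 0) +
          iidLaw p a b * (if BinFailure T' A B f g a (s b) then 1 else 0)) := by
      refine Finset.sum_le_sum fun a _ => Finset.sum_le_sum fun b _ => ?_
      rw [← mul_add]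
      refine mul_le_mul_of_nonneg_left ?_ (hnn a b)
      by_cases h1 : Bad a b (c (s b)) ∨
        L₂ < ((Finset.univ.filter fun j => T a (c j)).card : ℝ) <;>
      by_cases h2 : BinFailure T' A B f g a (s b) <;> simp [h1, h2]
    refine (le_of_eq (Finset.sum_congr rfl fun a _ => Finset.sum_congr rfl fun b _ => ?_)).trans
      (hstep.trans ?_)
    · congr
    simp only [Finset.sum_add_distrib]
    refine add_le_add hcs ?_
    rw [Fintype.sum_prod_type] at hfg
    push_cast at hfg
    exact hfg

end OneShot

/-! ### Weak law of large numbers -/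

section WeakLaw

open Classical in
/-- The weak law of large numbers for a finite alphabet. -/
theorem sum_prod_mul_deviation_le {Ω : Type*} [Fintype Ω] {P : Ω → ℝ} (hP : P ∈ stdSimplex ℝ Ω)
    (g : Ω → ℝ) {n : ℕ} (hn : 0 < n) {δ : ℝ} (hδ : 0 < δ) :
    ∑ x : Fin n → Ω, (∏ k, P (x k)) *
      (if n * δ < |∑ k, g (x k) - n * ∑ ω, P ω * g ω| then 1 else 0) ≤
      (∑ ω, P ω * (g ω - ∑ ω, P ω * g ω) ^ 2) / δ ^ 2 / n := by
  have hn' : (0 : ℝ) < n := by exact_mod_cast hn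
  set m := ∑ ω, P ω * g ω with hm
  have h1 := sum_prod_mul_sq hP.2 (fun (_ : Fin n) ω => g ω - m) fun _ => by
    simp only [mul_sub, Finset.sum_sub_distrib, ← Finset.sum_mul, hP.2, one_mul]
    exact sub_self _
  rw [Finset.sum_const, Finset.card_univ, Fintype.card_fin, nsmul_eq_mul] at h1
  have h2 : (∑ ω, P ω * (g ω - m) ^ 2) / δ ^ 2 / n =
      (n * δ)⁻¹ ^ 2 * (n * ∑ ω, P ω * (g ω - m) ^ 2) := by
    field_simp
  rw [h2, ← h1]
  refine le_of_le_of_eq (Finset.sum_le_sum fun x _ => ?_) (Finset.mul_sum _ _ _).symm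
  rw [mul_left_comm]
  refine mul_le_mul_of_nonneg_left ?_ (Finset.prod_nonneg fun k _ => hP.1 _)
  have h3 : ∑ k, (g (x k) - m) = ∑ k, g (x k) - n * m := by
    simp [Finset.sum_sub_distrib]
  rw [h3]
  split_ifs with h
  · rw [← mul_pow, ← sq_abs, abs_mul, abs_of_pos (by positivity : 0 < ((n : ℝ) * δ)⁻¹)]
    have : 1 ≤ ((n : ℝ) * δ)⁻¹ * |∑ k, g (x k) - n * m| := by
      rw [inv_mul_eq_div, le_div_iff₀ (by positivity), one_mul]; exact h.le
    nlinarith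
  · positivity

end WeakLaw

/-! ### Typical blocks -/

section Typicality

variable {X₁ X₂ V Y : Type*} [Fintype X₁] [DecidableEq X₁] [Fintype X₂] [DecidableEq X₂]
  [Fintype V] [DecidableEq V]

theorem sum_triple_mul (p : X₁ × X₂ → ℝ) (q : X₂ → V → ℝ) {n : ℕ}
    (φ : (Fin n → X₁) → (Fin n → X₂) → (Fin n → V) → ℝ) :
    ∑ a, ∑ b, ∑ v, iidLaw p a b * (∏ k, q (b k) (v k)) * φ a b v =
      ∑ x : Fin n → X₁ × X₂ × V, (∏ k, jointLaw p q (x k)) *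
        φ (fun k => (x k).1) (fun k => (x k).2.1) (fun k => (x k).2.2) := by
  rw [← (Equiv.arrowProdEquivProdArrow (Fin n) (fun _ => X₁) (fun _ => X₂ × V)).symm.sum_comp,
    Fintype.sum_prod_type]
  refine Finset.sum_congr rfl fun a _ => ?_
  rw [← (Equiv.arrowProdEquivProdArrow (Fin n) (fun _ => X₂) (fun _ => V)).symm.sum_comp,
    Fintype.sum_prod_type]
  refine Finset.sum_congr rfl fun b _ => Finset.sum_congr rfl fun v _ => ?_
  simp only [jointLaw, iidLaw, Equiv.arrowProdEquivProdArrow, Equiv.coe_fn_symm_mk,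
    Finset.prod_mul_distrib]

theorem jointLaw_mem_stdSimplex {p : X₁ × X₂ → ℝ} (hp : p ∈ stdSimplex ℝ (X₁ × X₂))
    {q : X₂ → V → ℝ} (hq : ∀ b, q b ∈ stdSimplex ℝ V) :
    jointLaw p q ∈ stdSimplex ℝ (X₁ × X₂ × V) := by
  refine ⟨fun ω => mul_nonneg (hp.1 _) ((hq _).1 _), ?_⟩
  have h := sum_law (jointLaw p q) (fun ω => (ω.2.1, ω.1))
  rw [← h, Fintype.sum_prod_type]
  simp only [law_jointLaw_snd_fst p hq]
  rw [Finset.sum_comm, ← Fintype.sum_prod_type]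
  exact hp.2

/-- The marginal `p(x₁)`. -/
def fstLaw (p : X₁ × X₂ → ℝ) (a : X₁) : ℝ := ∑ b, p (a, b)

/-- The marginal `p(x₁, v)`. -/
def fstLabelLaw (p : X₁ × X₂ → ℝ) (q : X₂ → V → ℝ) (a : X₁) (v : V) : ℝ := ∑ b, p (a, b) * q b v

/-- The marginal `p(v)`. -/
def labelLaw (p : X₁ × X₂ → ℝ) (q : X₂ → V → ℝ) (v : V) : ℝ := ∑ a, fstLabelLaw p q a v

theorem labelLaw_mem_stdSimplex {p : X₁ × X₂ → ℝ} (hp : p ∈ stdSimplex ℝ (X₁ × X₂))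
    {q : X₂ → V → ℝ} (hq : ∀ b, q b ∈ stdSimplex ℝ V) : labelLaw p q ∈ stdSimplex ℝ V := by
  have hJ := jointLaw_mem_stdSimplex hp hq
  have e : ∀ v, labelLaw p q v = law (jointLaw p q) (fun ω => ω.2.2) v := fun v =>
    (law_jointLaw_label p q v).symm
  refine ⟨fun v => ?_, ?_⟩
  · rw [e]; exact law_nonneg hJ.1 _ _
  · simp only [e]; rw [sum_law, hJ.2]

theorem prod_mem_stdSimplex {n : ℕ} {R : Fin n → V → ℝ} (hR : ∀ k, R k ∈ stdSimplex ℝ V) :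
    (fun v : Fin n → V => ∏ k, R k (v k)) ∈ stdSimplex ℝ (Fin n → V) := by
  refine ⟨fun v => Finset.prod_nonneg fun k _ => (hR k).1 _, ?_⟩
  rw [sum_prod_apply R]
  simp [(hR _).2]

/-- Joint typicality of `x₁` and `v`, as one-sided bounds on the products of their probabilities. -/
def IsTypical (p : X₁ × X₂ → ℝ) (q : X₂ → V → ℝ) (H h θ : ℝ) {n : ℕ} (a : Fin n → X₁)
    (v : Fin n → V) : Prop :=
  0 < ∏ k, labelLaw p q (v k) ∧
  (2 : ℝ) ^ (n * (-h - θ)) * ∏ k, labelLaw p q (v k) ≤ ∏ k, fstLabelLaw p q (a k) (v k) ∧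
  (2 : ℝ) ^ (n * (H - h - θ)) * ((∏ k, labelLaw p q (v k)) * ∏ k, fstLaw p (a k)) ≤
    ∏ k, fstLabelLaw p q (a k) (v k) ∧
  (2 : ℝ) ^ (n * (-H - θ)) ≤ ∏ k, fstLaw p (a k)

-- For fixed `v` the products of the p(x₁, v) sum to the product of the p(v), and each typical block
-- takes at least the fraction 2^{−n(h+θ)}.
open Classical in
theorem card_isTypical_right_le {p : X₁ × X₂ → ℝ} (hp : ∀ x, 0 ≤ p x) {q : X₂ → V → ℝ}
    (hq : ∀ b v, 0 ≤ q b v) (H h θ : ℝ) {n : ℕ} (v : Fin n → V) :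
    ((Finset.univ.filter fun a => IsTypical p q H h θ a v).card : ℝ) ≤ (2 : ℝ) ^ (n * (h + θ)) := by
  rcases Finset.eq_empty_or_nonempty (Finset.univ.filter fun a => IsTypical p q H h θ a v) with
    he | ⟨a₀, ha₀⟩
  · rw [he]; simp only [Finset.card_empty, Nat.cast_zero]; positivity
  have hR : 0 < ∏ k, labelLaw p q (v k) := (Finset.mem_filter.1 ha₀).2.1
  have h1 : ((Finset.univ.filter fun a => IsTypical p q H h θ a v).card : ℝ) *
      ((2 : ℝ) ^ (n * (-h - θ)) * ∏ k, labelLaw p q (v k)) ≤ ∏ k, labelLaw p q (v k) := by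
    calc _ = ∑ _a ∈ Finset.univ.filter fun a => IsTypical p q H h θ a v,
          (2 : ℝ) ^ (n * (-h - θ)) * ∏ k, labelLaw p q (v k) := by simp
      _ ≤ ∑ a ∈ Finset.univ.filter fun a => IsTypical p q H h θ a v,
          ∏ k, fstLabelLaw p q (a k) (v k) :=
          Finset.sum_le_sum fun a ha => (Finset.mem_filter.1 ha).2.2.1
      _ ≤ ∑ a : Fin n → X₁, ∏ k, fstLabelLaw p q (a k) (v k) :=
          Finset.sum_le_sum_of_subset_of_nonneg (Finset.filter_subset _ _) fun a _ _ =>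
            Finset.prod_nonneg fun k _ => Finset.sum_nonneg fun b _ => mul_nonneg (hp _) (hq _ _)
      _ = _ := sum_prod_apply fun k a => fstLabelLaw p q a (v k)
  have h2 : ((Finset.univ.filter fun a => IsTypical p q H h θ a v).card : ℝ) *
      (2 : ℝ) ^ (n * (-h - θ)) ≤ 1 := by
    rw [← mul_assoc] at h1
    exact le_of_mul_le_mul_right (by linarith) hR
  have h3 : (2 : ℝ) ^ (n * (h + θ)) * (2 : ℝ) ^ (n * (-h - θ)) = 1 := by
    rw [← Real.rpow_add (by norm_num)]; ring_nf; simp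
  rw [← h3] at h2
  exact le_of_mul_le_mul_right h2 (by positivity)

open Classical in
theorem card_exists_isTypical_le {p : X₁ × X₂ → ℝ} (hp : p ∈ stdSimplex ℝ (X₁ × X₂))
    (q : X₂ → V → ℝ) (H h θ : ℝ) (n : ℕ) :
    ((Finset.univ.filter fun a : Fin n → X₁ => ∃ v, IsTypical p q H h θ a v).card : ℝ) ≤
      (2 : ℝ) ^ (n * (H + θ)) := by
  have h0 : ∑ a : Fin n → X₁, ∏ k, fstLaw p (a k) = 1 := by
    rw [sum_prod_apply fun _ => fstLaw p]
    simp only [fstLaw]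
    rw [← Fintype.sum_prod_type, hp.2]; simp
  have h2 : ((Finset.univ.filter fun a : Fin n → X₁ => ∃ v, IsTypical p q H h θ a v).card : ℝ) *
      (2 : ℝ) ^ (n * (-H - θ)) ≤ 1 := by
    calc _ = ∑ _a ∈ Finset.univ.filter fun a : Fin n → X₁ => ∃ v, IsTypical p q H h θ a v,
          (2 : ℝ) ^ (n * (-H - θ)) := by simp
      _ ≤ ∑ a ∈ Finset.univ.filter fun a : Fin n → X₁ => ∃ v, IsTypical p q H h θ a v,
          ∏ k, fstLaw p (a k) := Finset.sum_le_sum fun a ha => by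
            obtain ⟨v, hv⟩ := (Finset.mem_filter.1 ha).2
            exact hv.2.2.2
      _ ≤ ∑ a : Fin n → X₁, ∏ k, fstLaw p (a k) :=
          Finset.sum_le_sum_of_subset_of_nonneg (Finset.filter_subset _ _) fun a _ _ =>
            Finset.prod_nonneg fun k _ => Finset.sum_nonneg fun b _ => hp.1 _
      _ = 1 := h0
  have h3 : (2 : ℝ) ^ (n * (H + θ)) * (2 : ℝ) ^ (n * (-H - θ)) = 1 := by
    rw [← Real.rpow_add (by norm_num)]; ring_nf; simp
  rw [← h3] at h2
  exact le_of_mul_le_mul_right h2 (by positivity)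

-- Change of measure: on typical pairs the law of `v` is at most 2^{−n(H−h−θ)} times its conditional
-- law given `a`, which has total mass one. Here H − h is I(X₁;V).
open Classical in
theorem sum_labelLaw_isTypical_le {p : X₁ × X₂ → ℝ} (hp : ∀ x, 0 ≤ p x)
    {q : X₂ → V → ℝ} (hq : ∀ b, q b ∈ stdSimplex ℝ V) (H h θ : ℝ) {n : ℕ} (a : Fin n → X₁) :
    ∑ v : Fin n → V, (∏ k, labelLaw p q (v k)) * (if IsTypical p q H h θ a v then 1 else 0) ≤
      (2 : ℝ) ^ (-(n * (H - h - θ))) := by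
  -- The last clause of typicality rules out blocks `a` of probability zero.
  rcases le_or_gt (∏ k, fstLaw p (a k)) 0 with h0 | h0
  · have : ∀ v : Fin n → V, ¬IsTypical p q H h θ a v := fun v hv => by
      have h1 : 0 < (2 : ℝ) ^ (n * (-H - θ)) := by positivity
      linarith [hv.2.2.2]
    simp only [this, if_false, mul_zero, Finset.sum_const_zero]
    positivity
  have hsum : ∑ v : Fin n → V, ∏ k, fstLabelLaw p q (a k) (v k) = ∏ k, fstLaw p (a k) := by
    rw [sum_prod_apply fun k v => fstLabelLaw p q (a k) v]
    refine Finset.prod_congr rfl fun k _ => ?_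
    simp only [fstLabelLaw, fstLaw]
    rw [Finset.sum_comm]
    simp [← Finset.mul_sum, (hq _).2]
  refine le_of_mul_le_mul_right ?_ h0
  rw [Finset.sum_mul]
  calc _ ≤ ∑ v : Fin n → V, (2 : ℝ) ^ (-(n * (H - h - θ))) * ∏ k, fstLabelLaw p q (a k) (v k) := by
        refine Finset.sum_le_sum fun v _ => ?_
        split_ifs with hT
        · have h1 := hT.2.2.1
          rw [Real.rpow_neg (by norm_num), ← div_eq_inv_mul, le_div_iff₀ (by positivity)]
          linarith
        · rw [mul_zero, zero_mul]
          exact mul_nonneg (by positivity) (Finset.prod_nonneg fun k _ =>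
            Finset.sum_nonneg fun b _ => mul_nonneg (hp _) ((hq _).1 _))
    _ = _ := by rw [← Finset.mul_sum, hsum]

/-! ### Means of the log-densities -/

section Moments

variable {p : X₁ × X₂ → ℝ} {q : X₂ → V → ℝ}

theorem fstLaw_pos (hp : ∀ x, 0 ≤ p x) (hq : ∀ b v, 0 ≤ q b v) {ω : X₁ × X₂ × V}
    (h : 0 < jointLaw p q ω) : 0 < fstLaw p ω.1 :=
  (pos_of_mul_pos_left h (hq _ _)).trans_le
    (Finset.single_le_sum (f := fun b => p (ω.1, b)) (fun _ _ => hp _) (Finset.mem_univ ω.2.1))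

theorem fstLabelLaw_pos (hp : ∀ x, 0 ≤ p x) (hq : ∀ b v, 0 ≤ q b v) {ω : X₁ × X₂ × V}
    (h : 0 < jointLaw p q ω) : 0 < fstLabelLaw p q ω.1 ω.2.2 :=
  h.trans_le (Finset.single_le_sum (f := fun b => p (ω.1, b) * q b ω.2.2)
    (fun _ _ => mul_nonneg (hp _) (hq _ _)) (Finset.mem_univ ω.2.1))

theorem labelLaw_pos (hp : ∀ x, 0 ≤ p x) (hq : ∀ b v, 0 ≤ q b v) {ω : X₁ × X₂ × V}
    (h : 0 < jointLaw p q ω) : 0 < labelLaw p q ω.2.2 :=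
  (fstLabelLaw_pos hp hq h).trans_le (Finset.single_le_sum (f := fun a => fstLabelLaw p q a ω.2.2)
    (fun _ _ => Finset.sum_nonneg fun _ _ => mul_nonneg (hp _) (hq _ _)) (Finset.mem_univ ω.1))

theorem sum_jointLaw_mul_logb_cond :
    ∑ ω, jointLaw p q ω * Real.logb 2 (fstLabelLaw p q ω.1 ω.2.2 / labelLaw p q ω.2.2) =
      -condEntropy (jointLaw p q) (fun ω => ω.1) (fun ω => ω.2.2) := by
  rw [condEntropy_eq_sum, ← Finset.sum_neg_distrib]
  refine Finset.sum_congr rfl fun ω _ => ?_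
  rw [law_jointLaw_fst_label, law_jointLaw_label, mul_neg, neg_neg]
  rfl

theorem sum_jointLaw_mul_logb_fst (hq : ∀ b, q b ∈ stdSimplex ℝ V) :
    ∑ ω, jointLaw p q ω * Real.logb 2 (fstLaw p ω.1) =
      -entropy (jointLaw p q) (fun ω => ω.1) := by
  rw [entropy_eq_sum, ← Finset.sum_neg_distrib]
  refine Finset.sum_congr rfl fun ω _ => ?_
  rw [law_jointLaw_fst p hq, mul_neg, neg_neg]
  rfl

/-- The joint law is p(x₁, x₂) q(v|x₂), so p(x₁, x₂) cancels from the information density. -/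
theorem sum_jointLaw_mul_logb_info (hp : ∀ x, 0 ≤ p x) (hq : ∀ b, q b ∈ stdSimplex ℝ V) :
    ∑ ω, jointLaw p q ω *
      Real.logb 2 (fstLaw p ω.1 * q ω.2.1 ω.2.2 / fstLabelLaw p q ω.1 ω.2.2) =
      condMutualInfo (jointLaw p q) (fun ω => ω.2.2) (fun ω => ω.2.1) (fun ω => ω.1) := by
  rw [condMutualInfo_eq_sum]
  refine Finset.sum_congr rfl fun ω _ => ?_
  rw [law_jointLaw_fst p hq, law_jointLaw_all, law_jointLaw_label_fst, law_jointLaw_snd_fst p hq]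
  rcases (mul_nonneg (hp (ω.1, ω.2.1)) ((hq ω.2.1).1 ω.2.2)).eq_or_lt with h | h
  · simp [jointLaw, ← h]
  have hp0 : p (ω.1, ω.2.1) ≠ 0 := (pos_of_mul_pos_left h ((hq _).1 _)).ne'
  have hr := (fstLabelLaw_pos (ω := ω) hp (fun b => (hq b).1) h).ne'
  congr 2
  change _ = fstLaw p ω.1 * _ / (fstLabelLaw p q ω.1 ω.2.2 * _)
  field_simp

/-- It equals H(V|X₁) − H(V|X₂,X₁), and conditioning reduces entropy. -/
theorem condMutualInfo_nonneg (hp : ∀ x, 0 ≤ p x) (hq : ∀ b, q b ∈ stdSimplex ℝ V) :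
    0 ≤ condMutualInfo (jointLaw p q) (fun ω => ω.2.2) (fun ω => ω.2.1) (fun ω => ω.1) := by
  have hJ : ∀ ω, 0 ≤ jointLaw p q ω := fun ω => mul_nonneg (hp _) ((hq _).1 _)
  have h := condEntropy_le_comp hJ (fun ω => ω.2.2) (fun ω => (ω.2.1, ω.1)) Prod.snd
  rw [condEntropy_eq_sum, condEntropy_eq_sum, ← sub_nonneg, ← Finset.sum_sub_distrib] at h
  rw [condMutualInfo_eq_sum]
  refine h.trans_eq (Finset.sum_congr rfl fun ω _ => ?_)
  rcases (hJ ω).eq_or_lt with h0 | h0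
  · simp [← h0]
  have e1 := (law_pos hJ (fun ω => (ω.2.2, ω.2.1, ω.1)) h0).ne'
  have e2 := (law_pos hJ (fun ω => (ω.2.1, ω.1)) h0).ne'
  have e3 := (law_pos hJ (fun ω => (ω.2.2, ω.1)) h0).ne'
  have e4 := (law_pos hJ (fun ω => ω.1) h0).ne'
  rw [Real.logb_div e1 e2, Real.logb_div e3 e4, Real.logb_div (mul_ne_zero e4 e1)
    (mul_ne_zero e3 e2), Real.logb_mul e4 e1, Real.logb_mul e3 e2]
  ring

end Moments

/-- A block whose empirical averages are close to their means is jointly typical, obeys the bound on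
the information density used for covering, and has the expected distortion. -/
theorem isTypical_of_deviation {p : X₁ × X₂ → ℝ} (hp : ∀ x, 0 ≤ p x) {q : X₂ → V → ℝ}
    (hq : ∀ b v, 0 ≤ q b v) {H h I θ : ℝ} {n : ℕ} (x : Fin n → X₁ × X₂ × V)
    (hx : ∀ k, 0 < jointLaw p q (x k)) (hθ : 0 < θ)
    (hW : |∑ k, Real.logb 2 (fstLabelLaw p q (x k).1 (x k).2.2 / labelLaw p q (x k).2.2) - n * (-h)| ≤
      n * (θ / 3))
    (hX : |∑ k, Real.logb 2 (fstLaw p (x k).1) - n * (-H)| ≤ n * (θ / 3))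
    (hI : |∑ k, Real.logb 2 (fstLaw p (x k).1 * q (x k).2.1 (x k).2.2 /
      fstLabelLaw p q (x k).1 (x k).2.2) - n * I| ≤ n * (θ / 3)) :
    IsTypical p q H h θ (fun k => (x k).1) (fun k => (x k).2.2) ∧
      ∏ k, q (x k).2.1 (x k).2.2 ≤
        (2 : ℝ) ^ (n * (I + (H - h) + θ)) * ∏ k, labelLaw p q (x k).2.2 := by
  have hX0 := fun k => fstLaw_pos hp hq (hx k)
  have hr0 := fun k => fstLabelLaw_pos hp hq (hx k)
  have hR0 := fun k => labelLaw_pos hp hq (hx k)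
  have hq0 : ∀ k, 0 < q (x k).2.1 (x k).2.2 := fun k => pos_of_mul_pos_right (hx k) (hp _)
  have hnθ : 0 ≤ n * θ := by positivity
  have eW : ∑ k, Real.logb 2 (fstLabelLaw p q (x k).1 (x k).2.2 / labelLaw p q (x k).2.2) =
      ∑ k, Real.logb 2 (fstLabelLaw p q (x k).1 (x k).2.2) -
        ∑ k, Real.logb 2 (labelLaw p q (x k).2.2) := by
    rw [← Finset.sum_sub_distrib]
    exact Finset.sum_congr rfl fun k _ => Real.logb_div (hr0 k).ne' (hR0 k).ne'
  have eI : ∑ k, Real.logb 2 (fstLaw p (x k).1 * q (x k).2.1 (x k).2.2 /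
      fstLabelLaw p q (x k).1 (x k).2.2) = ∑ k, Real.logb 2 (fstLaw p (x k).1) +
        ∑ k, Real.logb 2 (q (x k).2.1 (x k).2.2) -
        ∑ k, Real.logb 2 (fstLabelLaw p q (x k).1 (x k).2.2) := by
    rw [← Finset.sum_add_distrib, ← Finset.sum_sub_distrib]
    refine Finset.sum_congr rfl fun k _ => ?_
    rw [Real.logb_div (mul_pos (hX0 k) (hq0 k)).ne' (hr0 k).ne',
      Real.logb_mul (hX0 k).ne' (hq0 k).ne']
  rw [eW] at hW
  rw [eI] at hI
  rw [abs_le] at hW hX hI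
  rw [← Real.logb_prod _ _ fun k _ => (hr0 k).ne', ← Real.logb_prod _ _ fun k _ => (hR0 k).ne'] at hW
  rw [← Real.logb_prod _ _ fun k _ => (hX0 k).ne'] at hX
  rw [← Real.logb_prod _ _ fun k _ => (hr0 k).ne', ← Real.logb_prod _ _ fun k _ => (hX0 k).ne',
    ← Real.logb_prod _ _ fun k _ => (hq0 k).ne'] at hI
  have pX : 0 < ∏ k, fstLaw p (x k).1 := Finset.prod_pos fun k _ => hX0 k
  have pr : 0 < ∏ k, fstLabelLaw p q (x k).1 (x k).2.2 := Finset.prod_pos fun k _ => hr0 k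
  have pR : 0 < ∏ k, labelLaw p q (x k).2.2 := Finset.prod_pos fun k _ => hR0 k
  have pq : 0 < ∏ k, q (x k).2.1 (x k).2.2 := Finset.prod_pos fun k _ => hq0 k
  -- Every bound combines at most three of the averages, which explains the tolerance θ/3. The
  -- covering bound needs all three, through q/p(v) = (p(x₁) q/p(x₁,v)) · (p(x₁,v)/p(v)) / p(x₁).
  refine ⟨⟨pR, ?_, ?_, ?_⟩, ?_⟩
  · rw [← le_div_iff₀ pR, ← Real.le_logb_iff_rpow_le (by norm_num) (div_pos pr pR),
      Real.logb_div pr.ne' pR.ne']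
    linarith
  · rw [← le_div_iff₀ (mul_pos pR pX), ← Real.le_logb_iff_rpow_le (by norm_num)
      (div_pos pr (mul_pos pR pX)), Real.logb_div pr.ne' (mul_pos pR pX).ne',
      Real.logb_mul pR.ne' pX.ne']
    linarith
  · rw [← Real.le_logb_iff_rpow_le (by norm_num) pX]
    linarith
  · rw [← div_le_iff₀ pR, ← Real.logb_le_iff_le_rpow (by norm_num) (div_pos pq pR),
      Real.logb_div pq.ne' pR.ne']
    linarith

open Classical in
/-- For a typical triple of blocks all the conditions needed for coding hold, outside an event of
probability `O(1/n)`. -/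
theorem exists_sum_atypical_le {p : X₁ × X₂ → ℝ} (hp : p ∈ stdSimplex ℝ (X₁ × X₂)) {q : X₂ → V → ℝ}
    (hq : ∀ b, q b ∈ stdSimplex ℝ V) (d : X₂ → Y → ℝ) (xhat : X₁ → V → Y) {H h I D θ : ℝ}
    (hH : entropy (jointLaw p q) (fun ω => ω.1) = H)
    (hh : condEntropy (jointLaw p q) (fun ω => ω.1) (fun ω => ω.2.2) = h)
    (hI : condMutualInfo (jointLaw p q) (fun ω => ω.2.2) (fun ω => ω.2.1) (fun ω => ω.1) = I)
    (hD : ∑ ω, jointLaw p q ω * d ω.2.1 (xhat ω.1 ω.2.2) = D) (hθ : 0 < θ) :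
    ∃ C : ℝ, 0 ≤ C ∧ ∀ n : ℕ, 0 < n → ∑ a : Fin n → X₁, ∑ b : Fin n → X₂, ∑ v : Fin n → V,
      iidLaw p a b * (∏ k, q (b k) (v k)) *
      (if ¬(IsTypical p q H h θ a v ∧
        ∏ k, q (b k) (v k) ≤ (2 : ℝ) ^ (n * (I + (H - h) + θ)) * ∏ k, labelLaw p q (v k) ∧
        blockDistortion d b (fun k => xhat (a k) (v k)) ≤ D + θ) then 1 else 0) ≤ C / n := by
  have hJ := jointLaw_mem_stdSimplex hp hq
  let g : Fin 4 → X₁ × X₂ × V → ℝ := ![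
    fun ω => Real.logb 2 (fstLabelLaw p q ω.1 ω.2.2 / labelLaw p q ω.2.2),
    fun ω => Real.logb 2 (fstLaw p ω.1),
    fun ω => Real.logb 2 (fstLaw p ω.1 * q ω.2.1 ω.2.2 / fstLabelLaw p q ω.1 ω.2.2),
    fun ω => d ω.2.1 (xhat ω.1 ω.2.2)]
  let m : Fin 4 → ℝ := fun i => ∑ ω, jointLaw p q ω * g i ω
  have m0 : m 0 = -h := by rw [← hh]; exact sum_jointLaw_mul_logb_cond
  have m1 : m 1 = -H := by rw [← hH]; exact sum_jointLaw_mul_logb_fst hq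
  have m2 : m 2 = I := by rw [← hI]; exact sum_jointLaw_mul_logb_info hp.1 hq
  have m3 : m 3 = D := hD
  let C : Fin 4 → ℝ := fun i => (∑ ω, jointLaw p q ω * (g i ω - m i) ^ 2) / (θ / 3) ^ 2
  refine ⟨∑ i, C i, Finset.sum_nonneg fun i _ => div_nonneg (Finset.sum_nonneg fun ω _ =>
    mul_nonneg (hJ.1 ω) (sq_nonneg _)) (sq_nonneg _), fun n hn => ?_⟩
  have hn' : (0 : ℝ) < n := by exact_mod_cast hn
  rw [sum_triple_mul p q (fun a b v => if ¬(IsTypical p q H h θ a v ∧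
        ∏ k, q (b k) (v k) ≤ (2 : ℝ) ^ (n * (I + (H - h) + θ)) * ∏ k, labelLaw p q (v k) ∧
        blockDistortion d b (fun k => xhat (a k) (v k)) ≤ D + θ) then (1 : ℝ) else 0)]
  calc _ ≤ ∑ x : Fin n → X₁ × X₂ × V, ∑ i, (∏ k, jointLaw p q (x k)) *
        (if n * (θ / 3) < |∑ k, g i (x k) - n * m i| then 1 else 0) := by
        refine Finset.sum_le_sum fun x _ => ?_
        rw [← Finset.mul_sum]
        rcases (Finset.prod_nonneg fun k _ => hJ.1 (x k) :
          0 ≤ ∏ k, jointLaw p q (x k)).eq_or_lt with h0 | h0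
        · rw [← h0, zero_mul, zero_mul]
        refine mul_le_mul_of_nonneg_left ?_ h0.le
        have hnn : ∀ i ∈ Finset.univ, (0 : ℝ) ≤
            if n * (θ / 3) < |∑ k, g i (x k) - n * m i| then 1 else 0 := fun i _ => by
          split_ifs <;> norm_num
        by_cases hex : ∃ i, n * (θ / 3) < |∑ k, g i (x k) - n * m i|
        · obtain ⟨i, hi⟩ := hex
          refine le_trans ?_ (Finset.single_le_sum hnn (Finset.mem_univ i))
          rw [if_pos hi]
          split_ifs <;> norm_num
        · push Not at hex
          have hx : ∀ k, 0 < jointLaw p q (x k) := fun k => lt_of_le_of_ne (hJ.1 _) fun h => by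
            rw [Finset.prod_eq_zero (Finset.mem_univ k) h.symm] at h0
            exact lt_irrefl _ h0
          have h1 := hex 0
          have h2 := hex 1
          have h3 := hex 2
          have h4 := hex 3
          rw [m0] at h1
          rw [m1] at h2
          rw [m2] at h3
          rw [m3, abs_le] at h4
          obtain ⟨k1, k2⟩ := isTypical_of_deviation hp.1 (fun b => (hq b).1) x hx hθ h1 h2 h3
          have k3 : blockDistortion d (fun k => (x k).2.1)
              (fun k => xhat (x k).1 (x k).2.2) ≤ D + θ := by
            rw [blockDistortion, div_mul_eq_mul_div, one_mul, div_le_iff₀ hn']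
            have h5 : ∑ k, d (x k).2.1 (xhat (x k).1 (x k).2.2) - n * D ≤ n * (θ / 3) := h4.2
            have h6 : 0 ≤ n * θ := by positivity
            linarith
          rw [if_neg (not_not.2 ⟨k1, k2, k3⟩)]
          exact Finset.sum_nonneg hnn
    _ = ∑ i, ∑ x : Fin n → X₁ × X₂ × V, (∏ k, jointLaw p q (x k)) *
        (if n * (θ / 3) < |∑ k, g i (x k) - n * m i| then 1 else 0) := Finset.sum_comm
    _ ≤ ∑ i, C i / n := Finset.sum_le_sum fun i _ =>
        sum_prod_mul_deviation_le hJ (g i) hn (by positivity)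
    _ = _ := by rw [Finset.sum_div]

end Typicality

/-! ### Exponents of the error terms -/

section Exponents

theorem two_rpow_div_le {n : ℕ} {a b θ y : ℝ} (hy : (2 : ℝ) ^ (n * b) ≤ y) (hab : a + θ ≤ b) :
    (2 : ℝ) ^ (n * a) / y ≤ (2 : ℝ) ^ (-(n * θ)) := by
  have h0 : (0 : ℝ) < (2 : ℝ) ^ (n * b) := by positivity
  rw [div_le_iff₀ (h0.trans_le hy)]
  refine le_trans ?_ (mul_le_mul_of_nonneg_left hy (by positivity))
  rw [← Real.rpow_add two_pos]
  refine Real.rpow_le_rpow_of_exponent_le one_le_two ?_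
  have : (n : ℝ) * (a + θ) ≤ n * b := mul_le_mul_of_nonneg_left hab n.cast_nonneg
  linarith

theorem ceil_two_rpow_le {x : ℝ} (hx : 0 ≤ x) : (⌈(2 : ℝ) ^ x⌉₊ : ℝ) ≤ 2 * (2 : ℝ) ^ x := by
  have h := (Nat.ceil_lt_add_one (by positivity : (0 : ℝ) ≤ (2 : ℝ) ^ x)).le
  have := Real.one_le_rpow one_le_two hx
  linarith

theorem ceil_two_rpow_pos (x : ℝ) : 0 < ⌈(2 : ℝ) ^ x⌉₊ := Nat.ceil_pos.2 (by positivity)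

theorem logb_ceil_two_rpow {x : ℝ} (hx : 0 ≤ x) :
    x ≤ Real.logb 2 ⌈(2 : ℝ) ^ x⌉₊ ∧ Real.logb 2 ⌈(2 : ℝ) ^ x⌉₊ ≤ x + 1 := by
  have h0 : (0 : ℝ) < (2 : ℝ) ^ x := by positivity
  have h1 : (0 : ℝ) < ⌈(2 : ℝ) ^ x⌉₊ := by exact_mod_cast ceil_two_rpow_pos x
  constructor
  · rw [Real.le_logb_iff_rpow_le one_lt_two h1]
    exact Nat.le_ceil _
  · rw [Real.logb_le_iff_le_rpow one_lt_two h1, Real.rpow_add two_pos, Real.rpow_one, mul_comm]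
    exact ceil_two_rpow_le hx

theorem abs_rate_sub_lt {n : ℕ} (hn : 0 < n) {L c R ε : ℝ} {j : ℝ} (h1 : n * c ≤ L)
    (h2 : L ≤ n * c + j) (hR : R ≤ c) (hε : c - R + j / n < ε) :
    |(1 / (n : ℝ)) * L - R| < ε := by
  have hn' : (0 : ℝ) < n := by exact_mod_cast hn
  have h3 : c ≤ 1 / (n : ℝ) * L := by
    rw [one_div, inv_mul_eq_div, le_div_iff₀ hn']; linarith
  have h4 : 1 / (n : ℝ) * L ≤ c + j / n := by
    rw [one_div, inv_mul_eq_div, div_le_iff₀ hn', add_mul, div_mul_cancel₀ _ hn'.ne']; linarith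
  rw [abs_lt]
  constructor <;> linarith

theorem exp_neg_le_inv {x : ℝ} (hx : 0 < x) : Real.exp (-x) ≤ x⁻¹ := by
  rw [Real.exp_neg]
  exact inv_anti₀ hx (by linarith [Real.add_one_le_exp x])

/-- The error terms of the random code at rates that exceed their bounds by multiples of `θ`. -/
theorem code_error_le {n M K A B : ℕ} {H h J R₁ R₁' R₂' θ : ℝ} (hθ : 0 < θ)
    (hM : M = ⌈(2 : ℝ) ^ (n * (J + (H - h) + 2 * θ))⌉₊)
    (hM0 : 0 ≤ J + (H - h) + 2 * θ)
    (hA : (2 : ℝ) ^ (n * (R₁' + 6 * θ)) ≤ A) (hB : (2 : ℝ) ^ (n * (R₂' + 6 * θ)) ≤ B)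
    (hK : (2 : ℝ) ^ (n * (R₁ - R₁' + 6 * θ)) ≤ K)
    (h1 : R₁' ≤ R₁) (hh : h ≤ R₁') (hJ : J ≤ R₂')
    (hHJ : H + J ≤ R₁ + R₂') :
    Real.exp (-(M / (2 : ℝ) ^ (n * (J + (H - h) + θ)))) +
        M * (2 : ℝ) ^ (-(n * (H - h - θ))) / (2 : ℝ) ^ (n * (J + 4 * θ)) +
      ((2 : ℝ) ^ (n * (h + θ)) / (K * A) + (2 : ℝ) ^ (n * (J + 4 * θ)) / (K * B) +
        (2 : ℝ) ^ (n * (H + θ)) * (2 : ℝ) ^ (n * (J + 4 * θ)) / (K * A * (K * B)) +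
        ((2 : ℝ) ^ (n * (J + 4 * θ)) +
          (2 : ℝ) ^ (n * (H + θ)) * (2 : ℝ) ^ (n * (J + 4 * θ)) / (K * A)) / B +
        ((2 : ℝ) ^ (n * (h + θ)) +
          (2 : ℝ) ^ (n * (H + θ)) * (2 : ℝ) ^ (n * (J + 4 * θ)) / (K * B)) / A) ≤
      10 * (2 : ℝ) ^ (-(n * θ)) := by
  have hn : (0 : ℝ) ≤ n := n.cast_nonneg
  have hmul : ∀ {a b y z : ℝ}, (2 : ℝ) ^ (n * a) ≤ y → (2 : ℝ) ^ (n * b) ≤ z →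
      (2 : ℝ) ^ (n * (a + b)) ≤ y * z := fun hy hz => by
    rw [mul_add, Real.rpow_add two_pos]
    exact mul_le_mul hy hz (by positivity) (le_trans (by positivity) hy)
  have hKA := hmul hK hA
  have hKB := hmul hK hB
  -- The codebook size exceeds the density bound by a factor of at least 2^{nθ}.
  have e1 : Real.exp (-(M / (2 : ℝ) ^ (n * (J + (H - h) + θ)))) ≤ (2 : ℝ) ^ (-(n * θ)) := by
    have hM1 : (2 : ℝ) ^ (n * (J + (H - h) + 2 * θ)) ≤ M := hM ▸ Nat.le_ceil _
    have hM2 : (0 : ℝ) < M := lt_of_lt_of_le (by positivity) hM1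
    refine (exp_neg_le_inv (by positivity)).trans ?_
    rw [inv_div]
    exact two_rpow_div_le hM1 (by linarith)
  -- The expected number of codewords compatible with a block is at most 2·2^{n(J+3θ)}, a factor
  -- 2^{nθ} below twice the allowed row size.
  have e2 : M * (2 : ℝ) ^ (-(n * (H - h - θ))) / (2 : ℝ) ^ (n * (J + 4 * θ)) ≤
      2 * (2 : ℝ) ^ (-(n * θ)) := by
    have hM1 : (M : ℝ) ≤ 2 * (2 : ℝ) ^ (n * (J + (H - h) + 2 * θ)) :=
      hM ▸ ceil_two_rpow_le (by positivity)
    rw [div_le_iff₀ (by positivity)]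
    refine (mul_le_mul_of_nonneg_right hM1 (by positivity)).trans_eq ?_
    rw [mul_assoc, mul_assoc, ← Real.rpow_add two_pos, ← Real.rpow_add two_pos]
    congr 2
    ring
  have hNL : (2 : ℝ) ^ (n * (H + θ)) * (2 : ℝ) ^ (n * (J + 4 * θ)) =
      (2 : ℝ) ^ (n * (H + J + 5 * θ)) := by
    rw [← Real.rpow_add two_pos]; congr 1; ring
  rw [hNL, add_div, add_div, div_div, div_div]
  -- The margin 6θ in each of `A`, `B` and `K` exceeds the losses, at most 5θ, by the required θ.
  -- The seven binning terms with the 1 + 2 above make the constant 10.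
  have e3 := two_rpow_div_le (a := h + θ) (θ := θ) hKA (by linarith)
  have e4 := two_rpow_div_le (a := J + 4 * θ) (θ := θ) hKB (by linarith)
  have e5 := two_rpow_div_le (a := H + J + 5 * θ) (θ := θ) (hmul hKA hKB) (by linarith)
  have e6 := two_rpow_div_le (a := J + 4 * θ) (θ := θ) hB (by linarith)
  have e7 := two_rpow_div_le (a := H + J + 5 * θ) (θ := θ) (hmul hKA hB) (by linarith)
  have e8 := two_rpow_div_le (a := h + θ) (θ := θ) hA (by linarith)
  have e9 := two_rpow_div_le (a := H + J + 5 * θ) (θ := θ) (hmul hKB hA) (by linarith)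
  linarith

end Exponents

/-! ### Coding at every tuple of the region -/

section Achievability

variable {X₁ X₂ Y : Type*} [Fintype X₁] [DecidableEq X₁] [Fintype X₂] [DecidableEq X₂]

theorem condEntropy_le_entropy {Ω α β : Type*} [Fintype Ω] [Fintype α] [DecidableEq α] [Fintype β]
    [DecidableEq β] {P : Ω → ℝ} (hP : P ∈ stdSimplex ℝ Ω) (X : Ω → α) (Z : Ω → β) :
    condEntropy P X Z ≤ entropy P X := by
  refine (condEntropy_le hP.1 X Z (Q := fun a _ => law P X a) (fun a _ => law_nonneg hP.1 _ _)
    (fun _ => by rw [sum_law, hP.2]) fun ω hω => law_pos hP.1 _ hω).trans_eq ?_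
  rw [entropy_eq_sum]

theorem exactlyAchievable_of_mem_rateRegion [Fintype Y] {p : X₁ × X₂ → ℝ}
    (hp : p ∈ stdSimplex ℝ (X₁ × X₂)) {d : X₂ → Y → ℝ} (hd : ∀ x y, 0 ≤ d x y) {t : RateTuple}
    (ht : t ∈ rateRegion p d) : ExactlyAchievable p d t := by
  classical
  obtain ⟨k, q, -, hq, ⟨xhat, hD⟩, ⟨hR1, hR1'⟩, ⟨hR2, hR2'⟩, hh, hJ, hR, hHJ⟩ := ht
  obtain ⟨⟨x₁, x₂⟩, hx⟩ := exists_pos_of_mem_stdSimplex hp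
  obtain ⟨v, -⟩ := exists_pos_of_mem_stdSimplex (hq x₂)
  have : Nonempty X₁ := ⟨x₁⟩
  have : Nonempty Y := ⟨xhat x₁ v⟩
  have hJL := jointLaw_mem_stdSimplex hp hq
  set H := entropy (jointLaw p q) (fun ω => ω.1) with hHdef
  set h := condEntropy (jointLaw p q) (fun ω => ω.1) (fun ω => ω.2.2) with hhdef
  set J := condMutualInfo (jointLaw p q) (fun ω => ω.2.2) (fun ω => ω.2.1) (fun ω => ω.1)
    with hJdef
  set Dq := ∑ ω, jointLaw p q ω * d ω.2.1 (xhat ω.1 ω.2.2) with hDdef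
  have hhH : h ≤ H := condEntropy_le_entropy hJL _ _
  have hJ0 : 0 ≤ J := condMutualInfo_nonneg hp.1 hq
  have hDq : 0 ≤ Dq := Finset.sum_nonneg fun ω _ => mul_nonneg (hJL.1 _) (hd _ _)
  set dmax := ∑ x, ∑ y, d x y with hdmaxdef
  have hdmax0 : 0 ≤ dmax := Finset.sum_nonneg fun x _ => Finset.sum_nonneg fun y _ => hd x y
  have hdmax : ∀ x y, d x y ≤ dmax := fun x y =>
    (Finset.single_le_sum (f := fun y => d x y) (fun y _ => hd x y) (Finset.mem_univ y)).trans
      (Finset.single_le_sum (f := fun x => ∑ y, d x y)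
        (fun x _ => Finset.sum_nonneg fun y _ => hd x y) (Finset.mem_univ x))
  intro ε hε
  -- The vertex counts overshoot their exponents by 12θ and rounding adds less than θ, well within
  -- 25θ.
  obtain ⟨θ, hθ, hθε⟩ : ∃ θ : ℝ, 0 < θ ∧ 25 * θ = ε := ⟨ε / 25, by positivity, by ring⟩
  obtain ⟨e₀, he₀, he₀ε, he₀d⟩ : ∃ e₀ : ℝ, 0 < e₀ ∧ e₀ ≤ ε ∧ dmax * e₀ ≤ ε / 2 := by
    refine ⟨min ε (ε / (2 * (dmax + 1))), by positivity, min_le_left _ _, ?_⟩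
    refine (mul_le_mul_of_nonneg_left (min_le_right _ _) hdmax0).trans ?_
    rw [mul_div_assoc', div_le_div_iff₀ (by positivity) two_pos]
    nlinarith
  -- The error is at most l + (C/n)/l + 10·2^{−nθ}. Each term gets a third of `e₀`, and `l` must be
  -- fixed before `n` grows.
  obtain ⟨l, hl0, hl1, hle⟩ : ∃ l : ℝ, 0 < l ∧ l < 1 ∧ l ≤ e₀ / 3 :=
    ⟨min (1 / 2) (e₀ / 3), by positivity, (min_le_left _ _).trans_lt (by norm_num),
      min_le_right _ _⟩
  obtain ⟨C, hC0, hC⟩ := exists_sum_atypical_le hp hq d xhat hHdef.symm hhdef.symm hJdef.symm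
    hDdef.symm hθ
  have ev1 : ∀ᶠ n : ℕ in Filter.atTop, C / l / n < e₀ / 3 :=
    (tendsto_const_div_atTop_nhds_zero_nat (C / l)).eventually_lt_const (by positivity)
  have ev2 : ∀ᶠ n : ℕ in Filter.atTop, 10 * (2 : ℝ) ^ (-(n * θ)) < e₀ / 3 := by
    have h0 : Filter.Tendsto (fun n : ℕ => 10 * ((2 : ℝ) ^ (-θ)) ^ n) Filter.atTop (nhds (10 * 0)) :=
      (tendsto_pow_atTop_nhds_zero_of_lt_one (by positivity)
        (Real.rpow_lt_one_of_one_lt_of_neg one_lt_two (by linarith))).const_mul 10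
    rw [mul_zero] at h0
    filter_upwards [h0.eventually_lt_const (by positivity : 0 < e₀ / 3)] with n hn
    rwa [← Real.rpow_natCast, ← Real.rpow_mul zero_le_two, neg_mul, mul_comm θ] at hn
  have ev3 : ∀ᶠ n : ℕ in Filter.atTop, (2 : ℝ) / n < θ :=
    (tendsto_const_div_atTop_nhds_zero_nat 2).eventually_lt_const hθ
  obtain ⟨N, hN⟩ := Filter.eventually_atTop.1
    (ev1.and (ev2.and (ev3.and (Filter.eventually_gt_atTop 0))))
  refine ⟨N, fun n hn => ?_⟩
  obtain ⟨hn1, hn2, hn3, hn0⟩ := hN n hn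
  have hn' : (0 : ℝ) < n := by exact_mod_cast hn0
  have hn4 : (1 : ℝ) / n < θ := lt_of_le_of_lt (by gcongr; norm_num) hn3
  have hM0 : 0 ≤ J + (H - h) + 2 * θ := by linarith
  have hA0 : 0 ≤ n * (t.R₁' + 6 * θ) := by positivity
  have hB0 : 0 ≤ n * (t.R₂' + 6 * θ) := by positivity
  have hK0 : 0 ≤ n * (t.R₁ - t.R₁' + 6 * θ) := by
    have := sub_nonneg.2 hR1
    positivity
  -- By the Markov chain, J + (H − h) is I(V;X₂), the covering rate.
  obtain ⟨M, hM⟩ : ∃ M, M = ⌈(2 : ℝ) ^ (n * (J + (H - h) + 2 * θ))⌉₊ := ⟨_, rfl⟩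
  obtain ⟨A, hA⟩ : ∃ A, A = ⌈(2 : ℝ) ^ (n * (t.R₁' + 6 * θ))⌉₊ := ⟨_, rfl⟩
  obtain ⟨B, hB⟩ : ∃ B, B = ⌈(2 : ℝ) ^ (n * (t.R₂' + 6 * θ))⌉₊ := ⟨_, rfl⟩
  -- One number of components serves both sides because R₁ − R₁' = R₂ − R₂'.
  obtain ⟨K, hK⟩ : ∃ K, K = ⌈(2 : ℝ) ^ (n * (t.R₁ - t.R₁' + 6 * θ))⌉₊ := ⟨_, rfl⟩
  have hMpos : 0 < M := hM ▸ ceil_two_rpow_pos _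
  have hApos : 0 < A := hA ▸ ceil_two_rpow_pos _
  have hBpos : 0 < B := hB ▸ ceil_two_rpow_pos _
  have hKpos : 0 < K := hK ▸ ceil_two_rpow_pos _
  obtain ⟨lA1, lA2⟩ := hA ▸ logb_ceil_two_rpow hA0
  obtain ⟨lB1, lB2⟩ := hB ▸ logb_ceil_two_rpow hB0
  obtain ⟨lK1, lK2⟩ := hK ▸ logb_ceil_two_rpow hK0
  have lKA : Real.logb 2 ((K * A : ℕ) : ℝ) = Real.logb 2 K + Real.logb 2 A := by
    rw [Nat.cast_mul, Real.logb_mul (by positivity) (by positivity)]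
  have lKB : Real.logb 2 ((K * B : ℕ) : ℝ) = Real.logb 2 K + Real.logb 2 B := by
    rw [Nat.cast_mul, Real.logb_mul (by positivity) (by positivity)]
  obtain ⟨E, S, e, hE, hS1, hS2, he⟩ := exists_system hp (D := Dq + θ) (by positivity) hdmax0 hdmax
    (Q := fun b v => ∏ k, q (b k) (v k)) (fun b => prod_mem_stdSimplex fun k => hq (b k))
    (R := fun v : Fin n → Fin k => ∏ k, labelLaw p q (v k))
    (prod_mem_stdSimplex fun _ => labelLaw_mem_stdSimplex hp hq)
    (fun a v k => xhat (a k) (v k))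
    (fun a b v => ¬(IsTypical p q H h θ a v ∧
        ∏ k, q (b k) (v k) ≤ (2 : ℝ) ^ (n * (J + (H - h) + θ)) * ∏ k, labelLaw p q (v k) ∧
        blockDistortion d b (fun k => xhat (a k) (v k)) ≤ Dq + θ))
    (IsTypical p q H h θ)
    (Γ := (2 : ℝ) ^ (n * (J + (H - h) + θ))) (ε := C / n) (l := l)
    (κ := (2 : ℝ) ^ (-(n * (H - h - θ)))) (L₁ := (2 : ℝ) ^ (n * (h + θ)))
    (L₂ := (2 : ℝ) ^ (n * (J + 4 * θ))) (N := (2 : ℝ) ^ (n * (H + θ)))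
    (by positivity) hl0 hl1 (by positivity)
    (fun a b v _ hbad => not_not.1 hbad) (by convert hC n hn0)
    (fun a => by convert sum_labelLaw_isTypical_le hp.1 hq H h θ a)
    (fun v => by convert card_isTypical_right_le hp.1 (fun b => (hq b).1) H h θ v)
    (by convert card_exists_isTypical_le hp q H h θ n) hMpos hKpos hApos hBpos
  have hcode := code_error_le hθ hM hM0 (hA ▸ Nat.le_ceil _) (hB ▸ Nat.le_ceil _)
    (hK ▸ Nat.le_ceil _) hR1 hh hJ hHJ
  have hee : e ≤ e₀ := by
    rw [div_right_comm] at hn1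
    rw [he]
    linarith
  have hde := mul_le_mul_of_nonneg_left hee hdmax0
  have hn5 : (2 : ℝ) / n = 1 / n + 1 / n := by ring
  refine ⟨K * A, K * B, A, B, 2, E, S, hE, ?_, ?_, ?_, ?_, ?_, hS1.trans (hee.trans he₀ε), ?_⟩
  · exact abs_rate_sub_lt hn0 (c := t.R₁ + 12 * θ) (j := 2) (by rw [lKA]; linarith)
      (by rw [lKA]; linarith) (by linarith) (by linarith)
  · exact abs_rate_sub_lt hn0 (c := t.R₁ - t.R₁' + t.R₂' + 12 * θ) (j := 2)
      (by rw [lKB]; linarith) (by rw [lKB]; linarith) (by linarith) (by linarith)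
  · exact abs_rate_sub_lt hn0 lA1 lA2 (by linarith) (by linarith)
  · exact abs_rate_sub_lt hn0 lB1 lB2 (by linarith) (by linarith)
  · rw [Real.logb_self_eq_one one_lt_two, mul_one]
    linarith
  · linarith

end Achievability

end

theorem theorem1 {X₁ X₂ Y : Type*} [Fintype X₁] [DecidableEq X₁] [Fintype X₂] [DecidableEq X₂]
    [Fintype Y] (p : X₁ × X₂ → ℝ) (hp : p ∈ stdSimplex ℝ (X₁ × X₂)) (hcp : NoCommonPart p)
    (d : X₂ → Y → ℝ) (hd : ∀ x y, 0 ≤ d x y) :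
    {t | ExactlyAchievable p d t} = rateRegion p d ∧
      {t | Achievable p d t ∧ t.IsGraphical} = rateRegion p d := by
  have h1 : {t | ExactlyAchievable p d t} ⊆ {t | Achievable p d t ∧ t.IsGraphical} :=
    fun t ht => ⟨ExactlyAchievable.achievable ht, ExactlyAchievable.isGraphical hp ht⟩
  have h2 : {t | Achievable p d t ∧ t.IsGraphical} ⊆ rateRegion p d :=
    fun t ht => mem_rateRegion_of_achievable hp ht.1 ht.2
  have h3 : rateRegion p d ⊆ {t | ExactlyAchievable p d t} :=
    fun t ht => exactlyAchievable_of_mem_rateRegion hp hd ht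
  exact ⟨(h1.trans h2).antisymm h3, h2.antisymm (h3.trans h1)⟩
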